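/- Let $M=(\mathcal S,\mathcal A,P,c,\gamma)$ be a finite Markov decision process with $\gamma\in(0,1)$ and $n=|\mathcal A|\ge 2$. For every state $s$ let $p\mapsto h^p(s)$ be a convex differentiable function on the simplex $\Delta_n$ whose gradient is Lipschitz with constant $L>0$ (from $\|\cdot\|_1$ to $\|\cdot\|_\infty$). For a policy $\pi$ and $\tau\ge 0$ let $$Q^\pi_\tau(s,a)=\mathbb E\Big[\sum_{t\ge0}\gamma^t\big(c(s_t,a_t)+h^\pi(s_t)+\tau D^{\pi}_{\pi_0}(s_t)\big)\,\Big|\,s_0=s,a_0=a\Big],\qquad V^\pi(s)=\sum_a\pi(a|s)Q_0^\pi(s,a),$$ where $\pi_0$ is the uniform policy and $D^{p}_{p'}=\sum_a p(a)\log\frac{p(a)}{p'(a)}$. Let $\pi^*$ be a policy that minimizes $V^\pi(s)$ for all $s$ simultaneously, $\nu^*$ a stationary distribution of the state chain under $\pi^*$, and $f(\pi)=\sum_s\nu^*(s)V^\pi(s)$. Put $l=\lceil\log_\gamma(1/4)\rceil$, $\tau_k=\frac{1}{\sqrt{\gamma\log n}}2^{-(\lfloor k/l\rfloor+1)}$,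 $\eta_k=\frac{1-\gamma}{\gamma\tau_k}$, $\mu_k=1+\eta_k\tau_k=1/\gamma$, $L_k=\eta_kL+\mu_k$. The inexact SAPMD method starts from $v_0=\pi_0$ uniform. In step $k$ it receives a random estimate $\mathcal Q_k$ of $Q^{\pi_k}_{\tau_k}$ and runs, for all states $s$ in parallel, $T_k\ge 1$ iterations of accelerated gradient descent (AGD) from $x_0=y_0=\pi_0(\cdot|s)$ on $$\min_{p\in\Delta_n}\ \phi(p)+\chi(p),\qquad \phi(p)=\eta_k[\langle\mathcal Q_k(s,\cdot),p\rangle+h^p(s)],\quad \chi(p)=\eta_k\tau_kD^p_{\pi_0}(s)+D^p_{v_k}(s),$$ that is, $\underline x_t=(1-q_t)y_{t-1}+q_tx_{t-1}$, $x_t=\arg\min_{x\in\Delta_n}\{r_t[\langle\nabla\phi(\underline x_t),x\rangle+\chi(x)]+D^x_{x_{t-1}}\}$, $y_t=(1-\rho_t)y_{t-1}+\rho_tx_t$; here, with $t_0=\lfloor2\sqrt{L_k/\mu_k}-1\rfloor$ and $\kappa=\mu_k/L_k$, one takes $\rho_t=q_t=\frac2{t+1}$, $r_t=\frac t{2L_k}$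 for $t\le t_0$, and $\rho_t=\sqrt\kappa$, $q_t=\frac{\sqrt\kappa-\kappa}{1-\kappa}$, $r_t=\frac1{\sqrt{L_k\mu_k}-\mu_k}$ for $t>t_0$. Then $(\pi_{k+1},v_{k+1})=(y_{T_k},x_{T_k})$. The numbers $T_k$ are such that $\varepsilon_k(T_k)\le\frac{(1-\gamma)^2}{2\gamma^2(1+\gamma)}$, where $\varepsilon_k(t)=2L_k\min\{(1-\sqrt{\kappa})^{t-1},\frac2{t(t+1)}\}$. Let $(\mathcal F_k)$ be a filtration such that $\mathcal Q_k$ is $\mathcal F_{k+1}$-measurable and square integrable, and suppose that, almost surely, $\|\mathbb E[\mathcal Q_k|\mathcal F_k]-Q^{\pi_k}_{\tau_k}\|_\infty\le 2^{-(\lfloor k/l\rfloor+2)}$ and $\mathbb E[\|\mathcal Q_k-Q^{\pi_k}_{\tau_k}\|_\infty^2\,|\,\mathcal F_k]\le4^{-(\lfloor k/l\rfloor+2)}$ for every $k$. (1) For every $k\ge0$, $f(\pi_k)-f(\pi^*)$ is integrable and $\mathbb E[f(\pi_k)-f(\pi^*)]\le2^{-\lfloor k/l\rfloor}B$, where $$B=f(\pi_0)-f(\pi^*)+\frac1{1-\gamma}\Big(\frac{3\sqrt{\log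 n}}{\sqrt\gamma}+\frac{5(2-\gamma)}2+\max\Big\{1,\frac{1-\gamma}\gamma\Big\}\frac{5\sqrt{\log n}}{4\sqrt\gamma}\Big).$$ (2) If moreover each $T_k$ is the smallest integer $t\ge1$ with $\varepsilon_k(t)\le\frac{(1-\gamma)^2}{2\gamma^2(1+\gamma)}$, then for every $\epsilon\in(0,1/2]$ there is $K$ such that $\mathbb E[f(\pi_k)-f(\pi^*)]\le\epsilon$ for all $k\ge K$, while the total number $N$ of evaluations of the gradient $\nabla h^p(\cdot,\cdot)$ at policies $p$ (one per AGD iteration) in the first $K$ steps satisfies $$N\le l\,\Big(2+\log\Big(\frac{16L\sqrt{\log n}\,B}{(1-\gamma)\epsilon}+\frac8{(1-\gamma)^2}\Big)\Big)\Big(\log_2\frac{2B}\epsilon+5\sqrt{\frac{(1-\gamma)LB\sqrt{\gamma\log n}}\epsilon}\Big),$$ and, if $\epsilon\le L$, also $$N\le\frac{30(2+\log_2(1/\gamma))}{1-\gamma}\Big(1+\sqrt{B\sqrt{\log n}}\Big)\,(\log_\gamma\epsilon)\sqrt{L/\epsilon}.$$ In particular, $N=O\big((\log_\gamma\epsilon)\sqrt{L/\epsilon}\big)$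 with a constant that depends only on $\gamma$, $n$ and $f(\pi_0)-f(\pi^*)$. -/

import Mathlib

open scoped BigOperators MeasureTheory

noncomputable section

/-- A finite discounted Markov decision process with states `S` and actions `A`:
`P s a s'` is the probability of moving from `s` to `s'` under the action `a`. -/
structure MDP (S A : Type*) [Fintype S] where
  P : S → A → S → ℝ
  c : S → A → ℝ
  γ : ℝ
  P_nonneg : ∀ s a s', 0 ≤ P s a s'
  P_sum : ∀ s a, ∑ s', P s a s' = 1
  γ_pos : 0 < γ
  γ_lt_one : γ < 1

/-- `π s a` is the probability of taking the action `a` in the state `s`. -/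
def IsPolicy {S A : Type*} [Fintype A] (π : S → A → ℝ) : Prop :=
  ∀ s, π s ∈ stdSimplex ℝ A

/-- The uniform policy. -/
def uniformPolicy (S A : Type*) [Fintype A] : S → A → ℝ :=
  fun _ _ => 1 / (Fintype.card A : ℝ)

/-- The uniform distribution on the actions. -/
def uniformDist (A : Type*) [Fintype A] : A → ℝ :=
  fun _ => 1 / (Fintype.card A : ℝ)

/-- Kullback–Leibler divergence `KL(p ‖ p')`, the Bregman distance `D_{p'}^{p}` of the entropy.
It is used only where all `p' a` are positive; terms with `p a = 0` are `0`. -/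
def klDist {A : Type*} [Fintype A] (p p' : A → ℝ) : ℝ :=
  ∑ a, p a * Real.log (p a / p' a)

/-- `h s p` is the regularizer `h^p(s)`, a convex differentiable function of the action
distribution `p` at `s`; `dh s p` is its gradient, which is Lipschitz continuous on the simplex
with constant `L` (from the `ℓ₁` norm to the dual sup norm). -/
structure IsSmoothConvexRegularizer {S A : Type*} [Fintype A]
    (h : S → (A → ℝ) → ℝ) (dh : S → (A → ℝ) → (A → ℝ)) (L : ℝ) : Prop where
  convex : ∀ s, ConvexOn ℝ (stdSimplex ℝ A) (h s)
  hasGradient : ∀ s, ∀ p ∈ stdSimplex ℝ A,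
    HasFDerivWithinAt (h s)
      (∑ a, dh s p a • (ContinuousLinearMap.proj a : (A → ℝ) →L[ℝ] ℝ)) (stdSimplex ℝ A) p
  lipschitz : ∀ s, ∀ p ∈ stdSimplex ℝ A, ∀ p' ∈ stdSimplex ℝ A, ∀ a,
    |dh s p a - dh s p' a| ≤ L * ∑ b, |p b - p' b|

section Values

variable {S A : Type*} [Fintype S] [Fintype A]

/-- The law of `(s_t, a_t)` when `(s_0, a_0)` has law `m`, `s_{t+1} ∼ P(· | s_t, a_t)` and
`a_{t+1} ∼ π(· | s_{t+1})`. -/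
def stateActionLaw (M : MDP S A) (π : S → A → ℝ) (m : S → A → ℝ) : ℕ → S → A → ℝ
  | 0 => m
  | t + 1 => fun s' a' =>
      (∑ s, ∑ a, stateActionLaw M π m t s a * M.P s a s') * π s' a'

/-- `𝔼 ∑_t γ^t [c(s_t, a_t) + h^π(s_t) + τ D_{π₀}^π(s_t)]` when `(s_0, a_0)` has law `m`
and `π₀` is uniform. -/
def discountedCost (M : MDP S A) (h : S → (A → ℝ) → ℝ) (τ : ℝ) (π : S → A → ℝ)
    (m : S → A → ℝ) : ℝ :=
  ∑' t : ℕ, M.γ ^ t * ∑ s, ∑ a, stateActionLaw M π m t s a *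
    (M.c s a + h s (π s) + τ * klDist (π s) (uniformDist A))

open Classical in
/-- The perturbed action-value function `Q_τ^π(s, a)`. -/
def Qval (M : MDP S A) (h : S → (A → ℝ) → ℝ) (τ : ℝ) (π : S → A → ℝ) (s : S) (a : A) : ℝ :=
  discountedCost M h τ π (fun s' a' => if s' = s ∧ a' = a then 1 else 0)

open Classical in
/-- The (unperturbed) state-value function `V^π(s)`. -/
def Vval (M : MDP S A) (h : S → (A → ℝ) → ℝ) (π : S → A → ℝ) (s : S) : ℝ :=
  discountedCost M h 0 π (fun s' a' => if s' = s then π s' a' else 0)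

/-- `π` minimizes the value function over all policies at all states simultaneously. -/
def IsOptimalPolicy (M : MDP S A) (h : S → (A → ℝ) → ℝ) (πs : S → A → ℝ) : Prop :=
  IsPolicy πs ∧ ∀ π : S → A → ℝ, IsPolicy π → ∀ s, Vval M h πs s ≤ Vval M h π s

/-- `ν` is a stationary state distribution of the Markov chain induced by `π`. -/
def IsStationaryDist (M : MDP S A) (π : S → A → ℝ) (ν : S → ℝ) : Prop :=
  ν ∈ stdSimplex ℝ S ∧ ∀ s', ∑ s, ν s * ∑ a, π s a * M.P s a s' = ν s'

/-- The objective `f(π) = 𝔼_{s ∼ ν} [V^π(s)]`. -/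
def objective (M : MDP S A) (h : S → (A → ℝ) → ℝ) (ν : S → ℝ) (π : S → A → ℝ) : ℝ :=
  ∑ s, ν s * Vval M h π s

end Values

section AcceleratedGradient

open Classical in
/-- A minimizer of `F` over the simplex (the zero vector if there is none). In the algorithm
below the minimizer always exists and is unique. -/
def simplexArgmin {A : Type*} [Fintype A] (F : (A → ℝ) → ℝ) : A → ℝ :=
  if hF : ∃ p ∈ stdSimplex ℝ A, IsMinOn F (stdSimplex ℝ A) p then hF.choose else fun _ => 0

/-- The last iteration `t₀ = ⌊2 √(Lφ / μΦ) - 1⌋` of the first phase. -/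
def agdSwitch (Lφ μΦ : ℝ) : ℤ := ⌊2 * Real.sqrt (Lφ / μΦ) - 1⌋

/-- The averaging weight `ρ_t`. -/
def agdRho (Lφ μΦ : ℝ) (t : ℕ) : ℝ :=
  if (t : ℤ) ≤ agdSwitch Lφ μΦ then 2 / ((t : ℝ) + 1) else Real.sqrt (μΦ / Lφ)

/-- The extrapolation weight `q_t`. -/
def agdQ (Lφ μΦ : ℝ) (t : ℕ) : ℝ :=
  if (t : ℤ) ≤ agdSwitch Lφ μΦ then 2 / ((t : ℝ) + 1)
  else (Real.sqrt (μΦ / Lφ) - μΦ / Lφ) / (1 - μΦ / Lφ)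

/-- The stepsize `r_t`. -/
def agdR (Lφ μΦ : ℝ) (t : ℕ) : ℝ :=
  if (t : ℤ) ≤ agdSwitch Lφ μΦ then (t : ℝ) / (2 * Lφ)
  else 1 / (Real.sqrt (Lφ * μΦ) - μΦ)

/-- The accuracy `ε(t)` that is guaranteed after `t ≥ 1` accelerated gradient iterations. -/
def agdAccuracy (Lφ μΦ : ℝ) (t : ℕ) : ℝ :=
  2 * Lφ * min ((1 - Real.sqrt (μΦ / Lφ)) ^ (t - 1)) (2 / ((t : ℝ) * ((t : ℝ) + 1)))

/-- The state of the accelerated gradient method, run in parallel for all states of the MDP.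
`gradCalls` counts the evaluations of the gradient `p ↦ ∇h^p(·, ·)` of the regularizer. -/
structure AGDState (S A : Type*) where
  x : S → A → ℝ
  y : S → A → ℝ
  gradCalls : ℕ

/-- One iteration of accelerated gradient descent with parameters `q`, `r`, `ρ` for minimizing,
at every state `s`, `φ_s(p) + χ_s(p)` over the simplex, where
`φ_s(p) = η (⟨G s, p⟩ + h^p(s))` is the smooth part, which enters through its gradient only
(its convexity modulus `μφ` is `0`), and
`χ_s(p) = η τ D_{π₀}^p(s) + D_v^p(s)` is the simple part. -/
def agdStep {S A : Type*} [Fintype A] (dh : S → (A → ℝ) → (A → ℝ))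
    (η τ : ℝ) (G v : S → A → ℝ) (q r ρ : ℝ) (z : AGDState S A) : AGDState S A :=
  let u : S → A → ℝ := fun s a => (1 - q) * z.y s a + q * z.x s a
  let dφ : S → A → ℝ := fun s a => η * (G s a + dh s (u s) a)
  let x' : S → A → ℝ := fun s => simplexArgmin fun p =>
    r * ((∑ a, dφ s a * p a) + (η * τ * klDist p (uniformDist A) + klDist p (v s)))
      + klDist p (z.x s)
  { x := x'
    y := fun s a => (1 - ρ) * z.y s a + ρ * x' s a
    gradCalls := z.gradCalls + 1 }

/-- The state after `t` iterations (numbered `1, …, t`) from `x₀ = y₀ = π₀` uniform. -/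
def agdRun {S A : Type*} [Fintype A] (dh : S → (A → ℝ) → (A → ℝ))
    (η τ : ℝ) (G v : S → A → ℝ) (Lφ μΦ : ℝ) : ℕ → AGDState S A
  | 0 => { x := uniformPolicy S A, y := uniformPolicy S A, gradCalls := 0 }
  | t + 1 => agdStep dh η τ G v (agdQ Lφ μΦ (t + 1)) (agdR Lφ μΦ (t + 1)) (agdRho Lφ μΦ (t + 1))
      (agdRun dh η τ G v Lφ μΦ t)

end AcceleratedGradient

section Sapmd

/-- The epoch length `l = ⌈log_γ (1/4)⌉`. -/
def epochLen (γ : ℝ) : ℕ := ⌈Real.logb γ (1 / 4)⌉₊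

/-- The perturbation `τ_k = 2^{-(⌊k/l⌋ + 1)} / √(γ log n)`, with `n` the number of actions. -/
def sapmdTau (γ : ℝ) (n : ℕ) (k : ℕ) : ℝ :=
  1 / Real.sqrt (γ * Real.log n) * (1 / 2) ^ (k / epochLen γ + 1)

/-- The stepsize `η_k = (1 - γ) / (γ τ_k)`. -/
def sapmdEta (γ : ℝ) (n : ℕ) (k : ℕ) : ℝ := (1 - γ) / (γ * sapmdTau γ n k)

/-- The convexity modulus `1 + η_k τ_k` of the simple part of the `k`-th subproblem. -/
def sapmdMu (γ : ℝ) (n : ℕ) (k : ℕ) : ℝ := 1 + sapmdEta γ n k * sapmdTau γ n k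

/-- The smoothness constant handed to the accelerated gradient method in the `k`-th subproblem.
The smooth part has the Lipschitz constant `η_k L`; adding the modulus of the simple part gives
an upper bound of it for which all parameters of the method are well defined. -/
def sapmdSmooth (γ : ℝ) (n : ℕ) (L : ℝ) (k : ℕ) : ℝ := sapmdEta γ n k * L + sapmdMu γ n k

/-- The prescribed accuracy of the subproblem solutions, the same for all `k`. -/
def sapmdAccuracy (γ : ℝ) : ℝ := (1 - γ) ^ 2 / (2 * γ ^ 2 * (1 + γ))

/-- The state of the inexact SAPMD method: the policy `π_k`, the prox-center `v_k`, and the total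
number of evaluations of the gradient of the regularizer so far. -/
structure SapmdState (S A : Type*) where
  pol : S → A → ℝ
  center : S → A → ℝ
  gradCalls : ℕ

/-- The inexact SAPMD method with discount factor `γ`, driven by the sequence `G` of estimates of
the perturbed action-value functions, with `T k` accelerated gradient iterations in step `k`. -/
def sapmdRun {S A : Type*} [Fintype A] (γ : ℝ) (dh : S → (A → ℝ) → (A → ℝ)) (L : ℝ)
    (T : ℕ → ℕ) (G : ℕ → S → A → ℝ) : ℕ → SapmdState S A
  | 0 => { pol := uniformPolicy S A, center := uniformPolicy S A, gradCalls := 0 }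
  | k + 1 =>
      let st := sapmdRun γ dh L T G k
      let n := Fintype.card A
      let out := agdRun dh (sapmdEta γ n k) (sapmdTau γ n k) (G k) st.center
        (sapmdSmooth γ n L k) (sapmdMu γ n k) (T k)
      { pol := out.y
        center := out.x
        gradCalls := st.gradCalls + out.gradCalls }

/-- The bracket in the convergence bound, for the initial gap `Δ = f(π₀) - f(π*)`. -/
def sapmdRateConst (γ : ℝ) (n : ℕ) (Δ : ℝ) : ℝ :=
  Δ + 1 / (1 - γ) *
    (3 * Real.sqrt (Real.log n) / Real.sqrt γ + 5 * (2 - γ) / 2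
      + max 1 ((1 - γ) / γ) * (5 * Real.sqrt (Real.log n) / (4 * Real.sqrt γ)))

end Sapmd

end

/-!
Fix a policy `π*` and a stationary distribution `ν*` of its state chain. The Lyapunov function of
the method is the perturbed optimality gap of `π_k`, averaged over `ν*`, plus a multiple of
`KL(π* ‖ v_k)`. By the performance difference lemma, the gap is the average over `ν*` of the
advantages of `π*`; since `ν*` is stationary, inserting `π*` into the proximal inequality of the
`k`-th subproblem contracts this function by the factor `γ`, up to the error of the inexact
subproblem solution and the bias and variance of the estimate of the action values.

The proximal inequality has the divergence from the last *prox*-iterate of accelerated gradient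
descent on its left-hand side, so it holds although `π_{k+1}` is only an approximate minimizer; its
error is `ε_k(T_k) log n`. It follows from the one-step inequality of accelerated gradient descent,
whose error vanishes for both stepsize rules, the sublinear one and, after the switch, the linear
one.

An epoch has `l` steps with `γ ^ l ≤ 1 / 4`. At its end the perturbation `τ_k` is halved; the
contraction outweighs this change, and the expected Lyapunov function is halved too. Accuracy `ε`
thus takes about `log₂ (B / ε)` epochs, and since the condition number of the subproblems doubles
from one epoch to the next, the iteration counts of the epochs grow like powers of `√2` and their
sum is of the order of the last one, `√(L / ε)` up to logarithms.
-/

section Entropy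

open InformationTheory in
lemma three_halves_mul_sq_sub_one_le_klFun_mul {t : ℝ} (ht : 0 < t) :
    3 / 2 * (t - 1) ^ 2 ≤ klFun t * (t + 2) := by
  let g : ℝ → ℝ := fun t => klFun t * (t + 2) - 3 / 2 * (t - 1) ^ 2
  have hg : ∀ t ∈ Set.Ioi (0 : ℝ), HasDerivAt g (2 * ((t + 1) * Real.log t - 2 * (t - 1))) t := by
    intro t ht
    refine (((hasDerivAt_klFun (ne_of_gt ht)).mul ((hasDerivAt_id t).add_const 2)).sub
      ((((hasDerivAt_id t).sub_const 1).pow 2).const_mul (3 / 2))).congr_deriv ?_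
    simp only [id, klFun]
    ring
  have hg' : ∀ t ∈ Set.Ioi (0 : ℝ),
      HasDerivAt (fun t => 2 * ((t + 1) * Real.log t - 2 * (t - 1)))
        (2 * (Real.log t - (1 - t⁻¹))) t := by
    intro t ht
    have ht0 : t ≠ 0 := ne_of_gt ht
    refine ((((hasDerivAt_id t).add_const 1).mul (Real.hasDerivAt_log ht0)).sub
      (((hasDerivAt_id t).sub_const 1).const_mul 2)).const_mul 2 |>.congr_deriv ?_
    simp only [id]
    field_simp
    ring
  have hconv : ConvexOn ℝ (Set.Ioi 0) g :=
    convexOn_of_hasDerivWithinAt2_nonneg (convex_Ioi 0)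
      (fun t ht => (hg t ht).continuousAt.continuousWithinAt)
      (by simpa only [interior_Ioi] using fun t ht => (hg t ht).hasDerivWithinAt)
      (by simpa only [interior_Ioi] using fun t ht => (hg' t ht).hasDerivWithinAt)
      fun t ht => mul_nonneg zero_le_two
        (sub_nonneg.2 (Real.one_sub_inv_le_log_of_pos (interior_subset ht)))
  have hmin : IsMinOn g (Set.Ioi 0) 1 :=
    hconv.isMinOn_of_rightDeriv_eq_zero (by simp) (by
      rw [(hg 1 (Set.mem_Ioi.2 one_pos)).hasDerivWithinAt.derivWithin (uniqueDiffWithinAt_Ioi 1)]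
      simp)
  have hle : g 1 ≤ g t := hmin ht
  simp only [g, klFun_one] at hle
  linarith

lemma three_halves_mul_sq_sub_div_le {x y : ℝ} (hx : 0 ≤ x) (hy : 0 < y) :
    3 / 2 * ((x - y) ^ 2 / (x + 2 * y)) ≤ x * Real.log (x / y) - x + y := by
  rcases hx.eq_or_lt with rfl | hx
  · have : (0 - y) ^ 2 / (0 + 2 * y) = y / 2 := by
      field_simp
      ring
    rw [this, zero_mul]
    linarith
  · have hklFun := three_halves_mul_sq_sub_one_le_klFun_mul (div_pos hx hy)
    have hleft : 3 / 2 * (x / y - 1) ^ 2 = 3 / 2 * (x - y) ^ 2 / y ^ 2 := by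
      field_simp
    have hright : InformationTheory.klFun (x / y) * (x / y + 2)
        = (x * Real.log (x / y) - x + y) * (x + 2 * y) / y ^ 2 := by
      simp only [InformationTheory.klFun]
      field_simp
      ring
    rw [hleft, hright, div_le_div_iff_of_pos_right (by positivity)] at hklFun
    rwa [← mul_div_assoc, div_le_iff₀ (by positivity)]

variable {A : Type*} [Fintype A]

/-- The negative entropy of `p`, the generating function of the Bregman distance `klDist`. -/
noncomputable def negEntropy (p : A → ℝ) : ℝ := ∑ a, p a * Real.log (p a)

/-- The Gibbs distribution with energy `c` at temperature `β`. The minimizers of all proximal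
steps have this form. -/
noncomputable def gibbs (β : ℝ) (c : A → ℝ) : A → ℝ :=
  fun a => Real.exp (-(c a / β)) / ∑ b, Real.exp (-(c b / β))

variable {p q : A → ℝ}

-- Pinsker's inequality: Cauchy–Schwarz with the weights `p + 2 q`, whose total mass is `3`.
lemma sq_sum_abs_sub_le_two_mul_klDist (hp : p ∈ stdSimplex ℝ A) (hq : q ∈ stdSimplex ℝ A)
    (hq0 : ∀ a, 0 < q a) : (∑ a, |p a - q a|) ^ 2 ≤ 2 * klDist p q := by
  have hw : ∀ a, 0 < p a + 2 * q a := fun a => by linarith [hp.1 a, hq0 a]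
  have hmass : ∑ a, (p a + 2 * q a) = 3 := by
    rw [Finset.sum_add_distrib, ← Finset.mul_sum, hp.2, hq.2]
    norm_num
  have hcauchy : (∑ a, |p a - q a|) ^ 2
      ≤ (∑ a, (p a - q a) ^ 2 / (p a + 2 * q a)) * ∑ a, (p a + 2 * q a) :=
    Finset.sum_sq_le_sum_mul_sum_of_sq_le_mul Finset.univ
      (fun a _ => div_nonneg (sq_nonneg _) (hw a).le) (fun a _ => (hw a).le)
      (fun a _ => by rw [sq_abs, div_mul_cancel₀ _ (hw a).ne'])
  have hchi : 3 / 2 * ∑ a, (p a - q a) ^ 2 / (p a + 2 * q a) ≤ klDist p q :=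
    calc 3 / 2 * ∑ a, (p a - q a) ^ 2 / (p a + 2 * q a)
        ≤ ∑ a, (p a * Real.log (p a / q a) - p a + q a) := by
          rw [Finset.mul_sum]
          exact Finset.sum_le_sum fun a _ => three_halves_mul_sq_sub_div_le (hp.1 a) (hq0 a)
      _ = klDist p q := by
          rw [Finset.sum_add_distrib, Finset.sum_sub_distrib, hp.2, hq.2, klDist]
          ring
  rw [hmass] at hcauchy
  linarith

lemma klDist_nonneg (hp : p ∈ stdSimplex ℝ A) (hq : q ∈ stdSimplex ℝ A) (hq0 : ∀ a, 0 < q a) :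
    0 ≤ klDist p q := by
  linarith [sq_sum_abs_sub_le_two_mul_klDist hp hq hq0, sq_nonneg (∑ a, |p a - q a|)]

lemma klDist_pos (hp : p ∈ stdSimplex ℝ A) (hq : q ∈ stdSimplex ℝ A) (hq0 : ∀ a, 0 < q a)
    (hne : p ≠ q) : 0 < klDist p q := by
  obtain ⟨a, ha⟩ := Function.ne_iff.1 hne
  have hdist : 0 < ∑ a, |p a - q a| :=
    Finset.sum_pos' (fun _ _ => abs_nonneg _) ⟨a, Finset.mem_univ a, abs_pos.2 (sub_ne_zero.2 ha)⟩
  linarith [sq_sum_abs_sub_le_two_mul_klDist hp hq hq0, pow_pos hdist 2]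

lemma klDist_self (hp : ∀ a, 0 < p a) : klDist p p = 0 := by
  simp [klDist, div_self (hp _).ne']

lemma klDist_eq_negEntropy_sub (hq : ∀ a, 0 < q a) :
    klDist p q = negEntropy p - ∑ a, p a * Real.log (q a) := by
  rw [klDist, negEntropy, ← Finset.sum_sub_distrib]
  refine Finset.sum_congr rfl fun a _ => ?_
  rcases eq_or_ne (p a) 0 with h0 | h0
  · simp only [h0, zero_mul, sub_zero]
  · rw [Real.log_div h0 (hq a).ne', mul_sub]

lemma negEntropy_nonpos (hp : p ∈ stdSimplex ℝ A) : negEntropy p ≤ 0 :=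
  Finset.sum_nonpos fun a _ => mul_nonpos_of_nonneg_of_nonpos (hp.1 a)
    (Real.log_nonpos (hp.1 a) (mem_Icc_of_mem_stdSimplex hp a).2)

section Uniform

variable [Nonempty A]

lemma uniformDist_pos (a : A) : 0 < uniformDist A a :=
  one_div_pos.2 (Nat.cast_pos.2 Fintype.card_pos)

lemma uniformDist_mem_stdSimplex : uniformDist A ∈ stdSimplex ℝ A :=
  ⟨fun a => (uniformDist_pos a).le, by simp [uniformDist]⟩

lemma klDist_uniformDist (hp : p ∈ stdSimplex ℝ A) :
    klDist p (uniformDist A) = negEntropy p + Real.log (Fintype.card A) := by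
  simp only [klDist_eq_negEntropy_sub uniformDist_pos, uniformDist, ← Finset.sum_mul, hp.2,
    one_div, Real.log_inv]
  ring

lemma klDist_uniformDist_le (hp : p ∈ stdSimplex ℝ A) :
    klDist p (uniformDist A) ≤ Real.log (Fintype.card A) := by
  linarith [klDist_uniformDist hp, negEntropy_nonpos hp]

lemma klDist_uniformDist_nonneg (hp : p ∈ stdSimplex ℝ A) : 0 ≤ klDist p (uniformDist A) :=
  klDist_nonneg hp uniformDist_mem_stdSimplex uniformDist_pos

end Uniform

section ConvexComb

variable {x y v : A → ℝ} {ρ : ℝ}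

lemma convexComb_mem_stdSimplex (hx : x ∈ stdSimplex ℝ A) (hy : y ∈ stdSimplex ℝ A)
    (h0 : 0 ≤ ρ) (h1 : ρ ≤ 1) : (fun a => (1 - ρ) * y a + ρ * x a) ∈ stdSimplex ℝ A :=
  convex_stdSimplex ℝ A hy hx (sub_nonneg.2 h1) h0 (sub_add_cancel 1 ρ)

lemma convexComb_pos {x y : ℝ} (hx : 0 < x) (hy : 0 < y) (h0 : 0 ≤ ρ) (h1 : ρ ≤ 1) :
    0 < (1 - ρ) * y + ρ * x :=
  convex_Ioi (𝕜 := ℝ) (0 : ℝ) hy hx (sub_nonneg.2 h1) h0 (sub_add_cancel 1 ρ)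

lemma sum_convexComb_mul (x y f : A → ℝ) (ρ : ℝ) :
    ∑ a, ((1 - ρ) * y a + ρ * x a) * f a = (1 - ρ) * ∑ a, y a * f a + ρ * ∑ a, x a * f a := by
  simp only [add_mul, mul_assoc, Finset.sum_add_distrib, Finset.mul_sum]

lemma klDist_convexComb_add (hx : ∀ a, 0 < x a) (hy : ∀ a, 0 < y a) (hv : ∀ a, 0 < v a)
    (h0 : 0 ≤ ρ) (h1 : ρ ≤ 1) :
    klDist (fun a => (1 - ρ) * y a + ρ * x a) v
        + ((1 - ρ) * klDist y (fun a => (1 - ρ) * y a + ρ * x a)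
          + ρ * klDist x (fun a => (1 - ρ) * y a + ρ * x a))
      = (1 - ρ) * klDist y v + ρ * klDist x v := by
  have hw : ∀ a, 0 < (1 - ρ) * y a + ρ * x a := fun a => convexComb_pos (hx a) (hy a) h0 h1
  simp only [klDist_eq_negEntropy_sub hv, klDist_eq_negEntropy_sub hw, sum_convexComb_mul,
    negEntropy.eq_def fun a => (1 - ρ) * y a + ρ * x a]
  ring

lemma sum_abs_sub_convexComb_left (x y : A → ℝ) (h0 : 0 ≤ ρ) :
    ∑ a, |y a - ((1 - ρ) * y a + ρ * x a)| = ρ * ∑ a, |x a - y a| := by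
  rw [Finset.mul_sum]
  refine Finset.sum_congr rfl fun a _ => ?_
  rw [show y a - ((1 - ρ) * y a + ρ * x a) = ρ * (y a - x a) by ring, abs_mul, abs_of_nonneg h0,
    abs_sub_comm]

lemma sum_abs_sub_convexComb_right (x y : A → ℝ) (h1 : ρ ≤ 1) :
    ∑ a, |x a - ((1 - ρ) * y a + ρ * x a)| = (1 - ρ) * ∑ a, |x a - y a| := by
  rw [Finset.mul_sum]
  refine Finset.sum_congr rfl fun a _ => ?_
  rw [show x a - ((1 - ρ) * y a + ρ * x a) = (1 - ρ) * (x a - y a) by ring, abs_mul,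
    abs_of_nonneg (sub_nonneg.2 h1)]

-- `klDist · v` is strongly convex with modulus `1` with respect to the `ℓ₁` norm: the two extra
-- terms of the compensation identity are bounded below by Pinsker's inequality.
lemma klDist_convexComb_le (hx : x ∈ stdSimplex ℝ A) (hx0 : ∀ a, 0 < x a)
    (hy : y ∈ stdSimplex ℝ A) (hy0 : ∀ a, 0 < y a) (hv : ∀ a, 0 < v a)
    (h0 : 0 ≤ ρ) (h1 : ρ ≤ 1) :
    klDist (fun a => (1 - ρ) * y a + ρ * x a) v + ρ * (1 - ρ) / 2 * (∑ a, |x a - y a|) ^ 2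
      ≤ (1 - ρ) * klDist y v + ρ * klDist x v := by
  have hw := convexComb_mem_stdSimplex hx hy h0 h1
  have hw0 : ∀ a, 0 < (1 - ρ) * y a + ρ * x a := fun a => convexComb_pos (hx0 a) (hy0 a) h0 h1
  have hy_pinsker := sq_sum_abs_sub_le_two_mul_klDist hy hw hw0
  have hx_pinsker := sq_sum_abs_sub_le_two_mul_klDist hx hw hw0
  rw [sum_abs_sub_convexComb_left x y h0] at hy_pinsker
  rw [sum_abs_sub_convexComb_right x y h1] at hx_pinsker
  rw [← klDist_convexComb_add hx0 hy0 hv h0 h1]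
  linear_combination (1 - ρ) / 2 * hy_pinsker + ρ / 2 * hx_pinsker

end ConvexComb

lemma simplexArgmin_eq_of_forall_lt {F : (A → ℝ) → ℝ} (hq : q ∈ stdSimplex ℝ A)
    (hlt : ∀ p ∈ stdSimplex ℝ A, p ≠ q → F q < F p) : simplexArgmin F = q := by
  have hex : ∃ p ∈ stdSimplex ℝ A, IsMinOn F (stdSimplex ℝ A) p :=
    ⟨q, hq, fun p hp => (eq_or_ne p q).elim (fun h => (congrArg F h).ge) fun h => (hlt p hp h).le⟩
  rw [simplexArgmin, dif_pos hex]
  obtain ⟨hmem, hmin⟩ := hex.choose_spec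
  by_contra hne
  exact (hlt _ hmem hne).not_ge (hmin hq)

section Gibbs

variable [Nonempty A]

lemma gibbs_pos (β : ℝ) (c : A → ℝ) (a : A) : 0 < gibbs β c a :=
  div_pos (Real.exp_pos _) (Finset.sum_pos (fun _ _ => Real.exp_pos _) Finset.univ_nonempty)

lemma gibbs_mem_stdSimplex (β : ℝ) (c : A → ℝ) : gibbs β c ∈ stdSimplex ℝ A := by
  refine ⟨fun a => (gibbs_pos β c a).le, ?_⟩
  simp only [gibbs]
  rw [← Finset.sum_div, div_self]
  exact (Finset.sum_pos (fun _ _ => Real.exp_pos _) Finset.univ_nonempty).ne'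

lemma mul_negEntropy_add_sum_mul {β : ℝ} (hβ : 0 < β) (c : A → ℝ) (hp : p ∈ stdSimplex ℝ A) :
    β * negEntropy p + ∑ a, c a * p a
      = β * klDist p (gibbs β c) - β * Real.log (∑ b, Real.exp (-(c b / β))) := by
  have hZ : 0 < ∑ b, Real.exp (-(c b / β)) :=
    Finset.sum_pos (fun _ _ => Real.exp_pos _) Finset.univ_nonempty
  have hlog : ∀ a, Real.log (gibbs β c a)
      = -(c a / β) - Real.log (∑ b, Real.exp (-(c b / β))) := fun a => by
    rw [gibbs, Real.log_div (Real.exp_pos _).ne' hZ.ne', Real.log_exp]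
  have hsum : ∑ a, p a * Real.log (gibbs β c a)
      = -(β⁻¹ * ∑ a, c a * p a) - Real.log (∑ b, Real.exp (-(c b / β))) := by
    simp only [hlog, mul_sub, Finset.sum_sub_distrib]
    rw [← Finset.sum_mul, hp.2, one_mul, Finset.mul_sum, ← Finset.sum_neg_distrib]
    congr 1
    refine Finset.sum_congr rfl fun a _ => ?_
    field_simp
  rw [klDist_eq_negEntropy_sub (gibbs_pos β c), hsum]
  field_simp
  ring

variable {β : ℝ} {c : A → ℝ} {C : ℝ} {F : (A → ℝ) → ℝ}

lemma eq_gibbs_add_klDist (hβ : 0 < β)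
    (hF : ∀ p ∈ stdSimplex ℝ A, F p = β * negEntropy p + ∑ a, c a * p a + C)
    (hp : p ∈ stdSimplex ℝ A) : F p = F (gibbs β c) + β * klDist p (gibbs β c) := by
  have hmem := gibbs_mem_stdSimplex β c
  rw [hF p hp, hF _ hmem, mul_negEntropy_add_sum_mul hβ c hp, mul_negEntropy_add_sum_mul hβ c hmem,
    klDist_self (gibbs_pos β c)]
  ring

lemma simplexArgmin_eq_gibbs (hβ : 0 < β)
    (hF : ∀ p ∈ stdSimplex ℝ A, F p = β * negEntropy p + ∑ a, c a * p a + C) :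
    simplexArgmin F = gibbs β c := by
  have hmem := gibbs_mem_stdSimplex β c
  refine simplexArgmin_eq_of_forall_lt hmem fun p hp hne => ?_
  linarith [eq_gibbs_add_klDist hβ hF hp,
    mul_pos hβ (klDist_pos hp hmem (gibbs_pos β c) hne)]

end Gibbs

end Entropy

section SmoothConvex

variable {S A : Type*} [Fintype A] {h : S → (A → ℝ) → ℝ} {dh : S → (A → ℝ) → (A → ℝ)} {L : ℝ}

namespace IsSmoothConvexRegularizer

lemma hasDerivWithinAt_segment (hreg : IsSmoothConvexRegularizer h dh L) (s : S) {u p : A → ℝ}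
    (hu : u ∈ stdSimplex ℝ A) (hp : p ∈ stdSimplex ℝ A) {t : ℝ} (ht : t ∈ Set.Icc (0 : ℝ) 1) :
    HasDerivWithinAt (fun t : ℝ => h s (fun a => (1 - t) * u a + t * p a))
      (∑ a, dh s (fun a => (1 - t) * u a + t * p a) a * (p a - u a)) (Set.Icc 0 1) t := by
  have hmaps : Set.MapsTo (fun (t : ℝ) a => (1 - t) * u a + t * p a) (Set.Icc 0 1)
      (stdSimplex ℝ A) := fun t ht => convexComb_mem_stdSimplex hp hu ht.1 ht.2
  have hsegment : HasDerivAt (fun (t : ℝ) a => (1 - t) * u a + t * p a)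
      (fun a => p a - u a) t := by
    refine hasDerivAt_pi.2 fun a => ?_
    refine ((((hasDerivAt_id t).const_sub 1).mul_const (u a)).add
      ((hasDerivAt_id t).mul_const (p a))).congr_deriv ?_
    ring
  refine ((hreg.hasGradient s _ (hmaps ht)).comp_hasDerivWithinAt t
    hsegment.hasDerivWithinAt hmaps).congr_deriv ?_
  simp

lemma convexOn_segment (hreg : IsSmoothConvexRegularizer h dh L) (s : S) {u p : A → ℝ}
    (hu : u ∈ stdSimplex ℝ A) (hp : p ∈ stdSimplex ℝ A) :
    ConvexOn ℝ (Set.Icc (0 : ℝ) 1) fun t : ℝ => h s (fun a => (1 - t) * u a + t * p a) := by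
  refine ⟨convex_Icc 0 1, fun t₁ h₁ t₂ h₂ a b ha hb hab => ?_⟩
  convert (hreg.convex s).2 (convexComb_mem_stdSimplex hp hu h₁.1 h₁.2)
    (convexComb_mem_stdSimplex hp hu h₂.1 h₂.2) ha hb hab using 2
  ext c
  simp only [smul_eq_mul, Pi.add_apply, Pi.smul_apply]
  linear_combination (-u c) * hab

lemma add_sum_gradient_mul_le (hreg : IsSmoothConvexRegularizer h dh L) (s : S)
    {u p : A → ℝ} (hu : u ∈ stdSimplex ℝ A) (hp : p ∈ stdSimplex ℝ A) :
    h s u + ∑ a, dh s u a * (p a - u a) ≤ h s p := by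
  have hslope := (hreg.convexOn_segment s hu hp).le_slope_of_hasDerivWithinAt (x := 0) (y := 1)
    (by simp) (by simp) one_pos (hreg.hasDerivWithinAt_segment s hu hp (by simp))
  simp only [slope, sub_zero, sub_self, one_mul, zero_mul, add_zero, zero_add, inv_one, one_smul,
    vsub_eq_sub] at hslope
  linarith

lemma sum_gradient_sub_mul_le (hreg : IsSmoothConvexRegularizer h dh L) (s : S) {u p : A → ℝ}
    (hu : u ∈ stdSimplex ℝ A) (hp : p ∈ stdSimplex ℝ A) {t : ℝ} (ht : t ∈ Set.Icc (0 : ℝ) 1) :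
    ∑ a, (dh s (fun a => (1 - t) * u a + t * p a) a - dh s u a) * (p a - u a)
      ≤ L * (∑ a, |p a - u a|) ^ 2 * t := by
  have hdist : ∑ b, |(1 - t) * u b + t * p b - u b| = t * ∑ b, |p b - u b| := by
    simp only [abs_sub_comm _ (u _), sum_abs_sub_convexComb_left p u ht.1]
  calc ∑ a, (dh s (fun a => (1 - t) * u a + t * p a) a - dh s u a) * (p a - u a)
      ≤ ∑ a, L * (t * ∑ b, |p b - u b|) * |p a - u a| := by
        refine Finset.sum_le_sum fun a _ => (le_abs_self _).trans ?_
        rw [abs_mul, ← hdist]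
        exact mul_le_mul_of_nonneg_right
          (hreg.lipschitz s _ (convexComb_mem_stdSimplex hp hu ht.1 ht.2) _ hu a) (abs_nonneg _)
    _ = L * (∑ a, |p a - u a|) ^ 2 * t := by
        rw [← Finset.mul_sum]
        ring

-- The difference of the two sides, as a function of the position on the segment from `u` to `p`,
-- vanishes at `u` and is antitone.
lemma le_add_sum_gradient_mul_add_sq (hreg : IsSmoothConvexRegularizer h dh L)
    (s : S) {u p : A → ℝ} (hu : u ∈ stdSimplex ℝ A) (hp : p ∈ stdSimplex ℝ A) :
    h s p ≤ h s u + ∑ a, dh s u a * (p a - u a) + L / 2 * (∑ a, |p a - u a|) ^ 2 := by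
  let g := ∑ a, dh s u a * (p a - u a)
  let d := ∑ a, |p a - u a|
  let k : ℝ → ℝ := fun t => h s (fun a => (1 - t) * u a + t * p a) - (t * g + L / 2 * d ^ 2 * t ^ 2)
  have hderiv : ∀ t ∈ Set.Icc (0 : ℝ) 1, HasDerivWithinAt k
      (∑ a, dh s (fun a => (1 - t) * u a + t * p a) a * (p a - u a) - (g + L * d ^ 2 * t))
      (Set.Icc 0 1) t := fun t ht => by
    refine ((hreg.hasDerivWithinAt_segment s hu hp ht).sub
      (((hasDerivAt_id t).mul_const g).add
        (((hasDerivAt_id t).pow 2).const_mul (L / 2 * d ^ 2))).hasDerivWithinAt).congr_deriv ?_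
    simp only [id]
    ring
  have hanti : AntitoneOn k (Set.Icc 0 1) := by
    refine antitoneOn_of_hasDerivWithinAt_nonpos (convex_Icc 0 1)
      (fun t ht => (hderiv t ht).continuousWithinAt)
      (fun t ht => (hderiv t (interior_subset ht)).mono interior_subset) fun t ht => ?_
    rw [← sub_sub, sub_nonpos, ← Finset.sum_sub_distrib]
    simpa only [sub_mul (dh _ _ _)] using hreg.sum_gradient_sub_mul_le s hu hp (interior_subset ht)
  have hle := hanti (Set.left_mem_Icc.2 zero_le_one) (Set.right_mem_Icc.2 zero_le_one) zero_le_one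
  simp only [k, g, d, sub_self, zero_mul, one_mul, zero_add, sub_zero, add_zero, one_pow, mul_one,
    ne_eq, OfNat.ofNat_ne_zero, not_false_eq_true, zero_pow, mul_zero] at hle
  linarith

lemma continuousOn (hreg : IsSmoothConvexRegularizer h dh L) (s : S) :
    ContinuousOn (h s) (stdSimplex ℝ A) :=
  fun p hp => (hreg.hasGradient s p hp).continuousWithinAt

lemma continuousOn_gradient (hreg : IsSmoothConvexRegularizer h dh L) (s : S) (a : A) :
    ContinuousOn (fun p => dh s p a) (stdSimplex ℝ A) := by
  intro p hp
  rw [ContinuousWithinAt, tendsto_iff_dist_tendsto_zero]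
  have hlim : Filter.Tendsto (fun p' : A → ℝ => L * ∑ b, |p' b - p b|)
      (nhdsWithin p (stdSimplex ℝ A)) (nhds 0) := by
    have hcont : Continuous fun p' : A → ℝ => L * ∑ b, |p' b - p b| := by fun_prop
    simpa only [sub_self, abs_zero, Finset.sum_const_zero, mul_zero] using
      (hcont.tendsto p).mono_left nhdsWithin_le_nhds
  refine squeeze_zero' (Filter.Eventually.of_forall fun _ => dist_nonneg) ?_ hlim
  filter_upwards [self_mem_nhdsWithin] with p' hp'
  exact hreg.lipschitz s p' hp' p hp a

lemma convexComb_le (hreg : IsSmoothConvexRegularizer h dh L) (s : S) {u y x p : A → ℝ} {ρ : ℝ}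
    (hu : u ∈ stdSimplex ℝ A) (hy : y ∈ stdSimplex ℝ A) (hx : x ∈ stdSimplex ℝ A)
    (hp : p ∈ stdSimplex ℝ A) (h0 : 0 ≤ ρ) (h1 : ρ ≤ 1) :
    h s (fun a => (1 - ρ) * y a + ρ * x a)
      ≤ (1 - ρ) * h s y + ρ * (h s p + ∑ a, dh s u a * x a - ∑ a, dh s u a * p a)
        + L / 2 * (∑ a, |(1 - ρ) * y a + ρ * x a - u a|) ^ 2 := by
  have hdescent := hreg.le_add_sum_gradient_mul_add_sq s hu (convexComb_mem_stdSimplex hx hy h0 h1)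
  have hy_grad := mul_le_mul_of_nonneg_left (hreg.add_sum_gradient_mul_le s hu hy)
    (sub_nonneg.2 h1)
  have hp_grad := mul_le_mul_of_nonneg_left (hreg.add_sum_gradient_mul_le s hu hp) h0
  have hlin := sum_convexComb_mul x y (dh s u) ρ
  simp only [mul_comm _ (dh s u _)] at hlin
  simp only [mul_sub, Finset.sum_sub_distrib, hlin] at hdescent hy_grad hp_grad
  linarith

end IsSmoothConvexRegularizer

end SmoothConvex

section Subproblem

variable {S A : Type*} [Fintype A]
  {h : S → (A → ℝ) → ℝ} {dh : S → (A → ℝ) → (A → ℝ)} {L : ℝ}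

/-- The smooth part `φ` of the subproblem: the estimate `G` of the action values plus the
regularizer, scaled by the stepsize `η`. -/
noncomputable def smoothPart (h : S → (A → ℝ) → ℝ) (η : ℝ) (G : S → A → ℝ) (s : S)
    (p : A → ℝ) : ℝ :=
  η * ((∑ a, G s a * p a) + h s p)

/-- The gradient of `smoothPart`. -/
noncomputable def smoothPartGradient (dh : S → (A → ℝ) → (A → ℝ)) (η : ℝ) (G : S → A → ℝ) (s : S)
    (p : A → ℝ) (a : A) : ℝ :=
  η * (G s a + dh s p a)

/-- The simple part `χ` of the subproblem with prox-center `v`; `σ` stands for `η τ`. -/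
noncomputable def simplePart (σ : ℝ) (v p : A → ℝ) : ℝ :=
  σ * klDist p (uniformDist A) + klDist p v

/-- The objective `φ + χ` of the subproblem at the state `s`. -/
noncomputable def subObjective (h : S → (A → ℝ) → ℝ) (η τ : ℝ) (G v : S → A → ℝ) (s : S)
    (p : A → ℝ) : ℝ :=
  smoothPart h η G s p + simplePart (η * τ) (v s) p

/-- The objective of one proximal step from `x` with stepsize `r`, for the simple part with
prox-center `v` and the linearization `d` of the smooth part. -/
noncomputable def proxObjective (σ r : ℝ) (d v x p : A → ℝ) : ℝ :=
  r * ((∑ a, d a * p a) + simplePart σ v p) + klDist p x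

/-- The energy of the Gibbs distribution that minimizes `proxObjective`. -/
noncomputable def proxEnergy (r : ℝ) (d v x : A → ℝ) (a : A) : ℝ :=
  r * d a - r * Real.log (v a) - Real.log (x a)

lemma IsSmoothConvexRegularizer.smoothPart (hreg : IsSmoothConvexRegularizer h dh L) {η : ℝ}
    (hη : 0 ≤ η) (G : S → A → ℝ) :
    IsSmoothConvexRegularizer (smoothPart h η G) (smoothPartGradient dh η G) (η * L) where
  convex s := by
    have hlin : ConvexOn ℝ (stdSimplex ℝ A) fun p => ∑ a, G s a * p a := by
      refine ⟨convex_stdSimplex ℝ A, fun p _ q _ a b _ _ _ => le_of_eq ?_⟩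
      simp only [Pi.add_apply, Pi.smul_apply, smul_eq_mul, Finset.mul_sum,
        ← Finset.sum_add_distrib]
      exact Finset.sum_congr rfl fun _ _ => by ring
    exact (hlin.add (hreg.convex s)).smul hη
  hasGradient s p hp := by
    have hlin : HasFDerivWithinAt (fun p : A → ℝ => ∑ a, G s a * p a)
        (∑ a, G s a • (ContinuousLinearMap.proj a : (A → ℝ) →L[ℝ] ℝ)) (stdSimplex ℝ A) p :=
      HasFDerivWithinAt.fun_sum fun a _ => (hasFDerivWithinAt_apply a p _).const_mul (G s a)
    refine ((hlin.add (hreg.hasGradient s p hp)).const_mul η).congr_fderiv ?_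
    simp only [smoothPartGradient, ← Finset.sum_add_distrib, Finset.smul_sum, ← add_smul, smul_smul]
  lipschitz s p hp p' hp' a := by
    rw [smoothPartGradient, smoothPartGradient, ← mul_sub, add_sub_add_left_eq_sub, abs_mul,
      abs_of_nonneg hη, mul_assoc]
    exact mul_le_mul_of_nonneg_left (hreg.lipschitz s p hp p' hp' a) hη

variable [Nonempty A] {σ r ρ : ℝ} {d v x y u p : A → ℝ}

lemma simplePart_convexComb_le (hσ : 0 ≤ σ) (hx : x ∈ stdSimplex ℝ A) (hx0 : ∀ a, 0 < x a)
    (hy : y ∈ stdSimplex ℝ A) (hy0 : ∀ a, 0 < y a) (hv : ∀ a, 0 < v a) (h0 : 0 ≤ ρ) (h1 : ρ ≤ 1) :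
    simplePart σ v (fun a => (1 - ρ) * y a + ρ * x a)
        + (1 + σ) * (ρ * (1 - ρ) / 2) * (∑ a, |x a - y a|) ^ 2
      ≤ (1 - ρ) * simplePart σ v y + ρ * simplePart σ v x := by
  have huniform := klDist_convexComb_le hx hx0 hy hy0 uniformDist_pos h0 h1
  have hcenter := klDist_convexComb_le hx hx0 hy hy0 hv h0 h1
  simp only [simplePart]
  linear_combination σ * huniform + hcenter

lemma proxObjective_eq (hv : ∀ a, 0 < v a) (hx : ∀ a, 0 < x a) (hp : p ∈ stdSimplex ℝ A) :
    proxObjective σ r d v x p = (1 + r * (1 + σ)) * negEntropy p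
      + ∑ a, proxEnergy r d v x a * p a + r * (σ * Real.log (Fintype.card A)) := by
  have henergy : ∑ a, proxEnergy r d v x a * p a = r * ∑ a, d a * p a
      - r * ∑ a, p a * Real.log (v a) - ∑ a, p a * Real.log (x a) := by
    simp only [proxEnergy, Finset.mul_sum, ← Finset.sum_sub_distrib]
    exact Finset.sum_congr rfl fun a _ => by ring
  rw [henergy, proxObjective, simplePart, klDist_uniformDist hp, klDist_eq_negEntropy_sub hv,
    klDist_eq_negEntropy_sub hx]
  ring

lemma simplexArgmin_proxObjective (hσ : 0 ≤ σ) (hr : 0 < r) (hv : ∀ a, 0 < v a)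
    (hx : ∀ a, 0 < x a) :
    simplexArgmin (proxObjective σ r d v x) = gibbs (1 + r * (1 + σ)) (proxEnergy r d v x) :=
  simplexArgmin_eq_gibbs (by positivity) fun _ => proxObjective_eq hv hx

lemma proxObjective_eq_add_klDist (hσ : 0 ≤ σ) (hr : 0 < r) (hv : ∀ a, 0 < v a)
    (hx : ∀ a, 0 < x a) (hp : p ∈ stdSimplex ℝ A) :
    proxObjective σ r d v x p
      = proxObjective σ r d v x (simplexArgmin (proxObjective σ r d v x))
        + (1 + r * (1 + σ)) * klDist p (simplexArgmin (proxObjective σ r d v x)) := by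
  rw [simplexArgmin_proxObjective hσ hr hv hx]
  exact eq_gibbs_add_klDist (by positivity) (fun _ => proxObjective_eq hv hx) hp

lemma prox_step_le (hσ : 0 ≤ σ) (hr : 0 < r) (hv : ∀ a, 0 < v a) (hx : x ∈ stdSimplex ℝ A)
    (hx0 : ∀ a, 0 < x a) (hp : p ∈ stdSimplex ℝ A) {x' : A → ℝ}
    (hx' : x' = simplexArgmin (proxObjective σ r d v x)) :
    ∑ a, d a * x' a + simplePart σ v x' + (1 / r + (1 + σ)) * klDist p x'
        + 1 / r * ((∑ a, |x' a - x a|) ^ 2 / 2)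
      ≤ ∑ a, d a * p a + simplePart σ v p + 1 / r * klDist p x := by
  have hx'_mem : x' ∈ stdSimplex ℝ A := by
    rw [hx', simplexArgmin_proxObjective hσ hr hv hx0]
    exact gibbs_mem_stdSimplex _ _
  have hprox := proxObjective_eq_add_klDist (d := d) hσ hr hv hx0 hp
  rw [← hx', proxObjective, proxObjective] at hprox
  have hpinsker := sq_sum_abs_sub_le_two_mul_klDist hx'_mem hx hx0
  rw [← mul_le_mul_iff_right₀ hr]
  field_simp
  linarith

-- The last line is the error of the step, which the stepsize rules make nonpositive.
lemma accelerated_step_le {φ : S → (A → ℝ) → ℝ} {dφ : S → (A → ℝ) → (A → ℝ)} {ℓ : ℝ}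
    (hφ : IsSmoothConvexRegularizer φ dφ ℓ) (s : S) (hσ : 0 ≤ σ) (hr : 0 < r)
    (hρ0 : 0 ≤ ρ) (hρ1 : ρ ≤ 1) (hv : ∀ a, 0 < v a) (hu : u ∈ stdSimplex ℝ A)
    (hx : x ∈ stdSimplex ℝ A) (hx0 : ∀ a, 0 < x a) (hy : y ∈ stdSimplex ℝ A)
    (hy0 : ∀ a, 0 < y a) (hp : p ∈ stdSimplex ℝ A) {x' y' : A → ℝ}
    (hx' : x' = simplexArgmin (proxObjective σ r (dφ s u) v x))
    (hy' : y' = fun a => (1 - ρ) * y a + ρ * x' a) :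
    φ s y' + simplePart σ v y' - (φ s p + simplePart σ v p)
        + ρ * (1 / r + (1 + σ)) * klDist p x'
      ≤ (1 - ρ) * (φ s y + simplePart σ v y - (φ s p + simplePart σ v p)) + ρ / r * klDist p x
        + (ℓ / 2 * (∑ a, |y' a - u a|) ^ 2
          - (1 + σ) * (ρ * (1 - ρ) / 2) * (∑ a, |x' a - y a|) ^ 2
          - ρ / r * ((∑ a, |x' a - x a|) ^ 2 / 2)) := by
  obtain ⟨hx'_mem, hx'_pos⟩ : x' ∈ stdSimplex ℝ A ∧ ∀ a, 0 < x' a := by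
    rw [hx', simplexArgmin_proxObjective hσ hr hv hx0]
    exact ⟨gibbs_mem_stdSimplex _ _, gibbs_pos _ _⟩
  have hsmooth := hφ.convexComb_le s hu hy hx'_mem hp hρ0 hρ1
  have hsimple := simplePart_convexComb_le hσ hx'_mem hx'_pos hy hy0 hv hρ0 hρ1
  have hprox := mul_le_mul_of_nonneg_left (prox_step_le hσ hr hv hx hx0 hp hx') hρ0
  rw [← hy'] at hsimple hsmooth
  have hy'_eq : ∑ a, |(1 - ρ) * y a + ρ * x' a - u a| = ∑ a, |y' a - u a| := by rw [hy']
  rw [hy'_eq] at hsmooth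
  linear_combination hsmooth + hsimple + hprox

end Subproblem

section AcceleratedStep

variable {S A : Type*} [Fintype A] [Nonempty A] {h : S → (A → ℝ) → ℝ}
  {dh : S → (A → ℝ) → (A → ℝ)} {L η τ q r ρ : ℝ} {G v : S → A → ℝ} {z : AGDState S A}

/-- Both sequences of the accelerated gradient method lie in the relative interior of the simplex,
where all divergences are finite. -/
structure AGDState.Interior (z : AGDState S A) : Prop where
  x_mem : ∀ s, z.x s ∈ stdSimplex ℝ A
  x_pos : ∀ s a, 0 < z.x s a
  y_mem : ∀ s, z.y s ∈ stdSimplex ℝ A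
  y_pos : ∀ s a, 0 < z.y s a

lemma agdStep_x_eq_gibbs (hητ : 0 ≤ η * τ) (hr : 0 < r) (hv : ∀ s a, 0 < v s a)
    (hz : z.Interior) (s : S) :
    (agdStep dh η τ G v q r ρ z).x s = gibbs (1 + r * (1 + η * τ)) (proxEnergy r
      (smoothPartGradient dh η G s fun a => (1 - q) * z.y s a + q * z.x s a) (v s) (z.x s)) :=
  simplexArgmin_proxObjective hητ hr (hv s) (hz.x_pos s)

lemma AGDState.Interior.step (hz : z.Interior) (hητ : 0 ≤ η * τ) (hr : 0 < r) (hρ0 : 0 ≤ ρ)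
    (hρ1 : ρ ≤ 1) (hv : ∀ s a, 0 < v s a) : (agdStep dh η τ G v q r ρ z).Interior := by
  have hmem : ∀ s, (agdStep dh η τ G v q r ρ z).x s ∈ stdSimplex ℝ A := fun s => by
    rw [agdStep_x_eq_gibbs hητ hr hv hz]
    exact gibbs_mem_stdSimplex _ _
  have hpos : ∀ s a, 0 < (agdStep dh η τ G v q r ρ z).x s a := fun s => by
    rw [agdStep_x_eq_gibbs hητ hr hv hz]
    exact gibbs_pos _ _
  exact ⟨hmem, hpos, fun s => convexComb_mem_stdSimplex (hmem s) (hz.y_mem s) hρ0 hρ1,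
    fun s a => convexComb_pos (hpos s a) (hz.y_pos s a) hρ0 hρ1⟩

lemma subObjective_agdStep_le (hreg : IsSmoothConvexRegularizer h dh L) (hη : 0 ≤ η)
    (hητ : 0 ≤ η * τ) (hr : 0 < r) (hρ0 : 0 ≤ ρ) (hρ1 : ρ ≤ 1) (hq0 : 0 ≤ q) (hq1 : q ≤ 1)
    (hv : ∀ s a, 0 < v s a) (hz : z.Interior) {z' : AGDState S A}
    (hz' : z' = agdStep dh η τ G v q r ρ z) (s : S) {p : A → ℝ} (hp : p ∈ stdSimplex ℝ A) :
    subObjective h η τ G v s (z'.y s) - subObjective h η τ G v s p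
        + ρ * (1 / r + (1 + η * τ)) * klDist p (z'.x s)
      ≤ (1 - ρ) * (subObjective h η τ G v s (z.y s) - subObjective h η τ G v s p)
        + ρ / r * klDist p (z.x s)
        + (η * L / 2 * (∑ a, |z'.y s a - ((1 - q) * z.y s a + q * z.x s a)|) ^ 2
          - (1 + η * τ) * (ρ * (1 - ρ) / 2) * (∑ a, |z'.x s a - z.y s a|) ^ 2
          - ρ / r * ((∑ a, |z'.x s a - z.x s a|) ^ 2 / 2)) := by
  subst hz'
  exact accelerated_step_le (hreg.smoothPart hη G) s hητ hr hρ0 hρ1 (hv s)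
    (convexComb_mem_stdSimplex (hz.x_mem s) (hz.y_mem s) hq0 hq1)
    (hz.x_mem s) (hz.x_pos s) (hz.y_mem s) (hz.y_pos s) hp rfl rfl

end AcceleratedStep

section AGDParameters

variable {l μ : ℝ}

lemma mul_sq_sqrt_div (hμ : 0 < μ) (hμl : μ < l) : l * √(μ / l) ^ 2 = μ := by
  have hl := hμ.trans hμl
  rw [Real.sq_sqrt (div_pos hμ hl).le, mul_div_cancel₀ _ hl.ne']

lemma sqrt_div_pos (hμ : 0 < μ) (hμl : μ < l) : 0 < √(μ / l) :=
  Real.sqrt_pos.2 (div_pos hμ (hμ.trans hμl))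

lemma sqrt_div_lt_one (hμ : 0 < μ) (hμl : μ < l) : √(μ / l) < 1 := by
  rwa [Real.sqrt_lt' one_pos, one_pow, div_lt_one (hμ.trans hμl)]

lemma le_agdSwitch_iff (hμ : 0 < μ) (hμl : μ < l) (t : ℕ) :
    (t : ℤ) ≤ agdSwitch l μ ↔ √(μ / l) * ((t : ℝ) + 1) ≤ 2 := by
  have hinv : √(l / μ) = (√(μ / l))⁻¹ := by rw [← Real.sqrt_inv, inv_div]
  rw [agdSwitch, Int.le_floor, hinv, Int.cast_natCast, le_sub_iff_add_le, ← div_eq_mul_inv,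
    le_div_iff₀ (sqrt_div_pos hμ hμl), mul_comm]

lemma agdQ_of_not_le_agdSwitch (hμ : 0 < μ) (hμl : μ < l) {t : ℕ}
    (ht : ¬ (t : ℤ) ≤ agdSwitch l μ) :
    agdQ l μ t = √(μ / l) / (1 + √(μ / l)) := by
  have hw0 := sqrt_div_pos hμ hμl
  have hw1 := sqrt_div_lt_one hμ hμl
  rw [agdQ, if_neg ht]
  nth_rewrite 2 3 [← Real.sq_sqrt (div_pos hμ (hμ.trans hμl)).le]
  generalize √(μ / l) = w at hw0 hw1
  rw [div_eq_div_iff (by nlinarith) (by positivity)]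
  ring

lemma agdR_of_not_le_agdSwitch (hμ : 0 < μ) (hμl : μ < l) {t : ℕ}
    (ht : ¬ (t : ℤ) ≤ agdSwitch l μ) :
    agdR l μ t = 1 / (l * √(μ / l) * (1 - √(μ / l))) := by
  have hl := hμ.trans hμl
  have hsq := mul_sq_sqrt_div hμ hμl
  have hsqrt : √(l * μ) = l * √(μ / l) := by
    rw [Real.sqrt_eq_iff_mul_self_eq (by positivity) (by positivity)]
    linear_combination -l * hsq
  rw [agdR, if_neg ht, hsqrt]
  congr 1
  linear_combination hsq

lemma agdRho_mem_Icc (hμ : 0 < μ) (hμl : μ < l) (t : ℕ) :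
    agdRho l μ (t + 1) ∈ Set.Icc 0 1 := by
  unfold agdRho
  split_ifs
  · refine ⟨by positivity, (div_le_one (by positivity)).2 ?_⟩
    push_cast
    linarith [Nat.cast_nonneg (α := ℝ) t]
  · exact ⟨(sqrt_div_pos hμ hμl).le, (sqrt_div_lt_one hμ hμl).le⟩

lemma agdQ_mem_Icc (hμ : 0 < μ) (hμl : μ < l) (t : ℕ) : agdQ l μ (t + 1) ∈ Set.Icc 0 1 := by
  by_cases ht : ((t + 1 : ℕ) : ℤ) ≤ agdSwitch l μ
  · rw [agdQ, if_pos ht]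
    refine ⟨by positivity, (div_le_one (by positivity)).2 ?_⟩
    push_cast
    linarith [Nat.cast_nonneg (α := ℝ) t]
  · have hw := sqrt_div_pos hμ hμl
    rw [agdQ_of_not_le_agdSwitch hμ hμl ht]
    exact ⟨by positivity, (div_le_one (by positivity)).2 (by linarith)⟩

lemma agdR_pos (hμ : 0 < μ) (hμl : μ < l) (t : ℕ) : 0 < agdR l μ (t + 1) := by
  have hl := hμ.trans hμl
  by_cases ht : ((t + 1 : ℕ) : ℤ) ≤ agdSwitch l μ
  · rw [agdR, if_pos ht]
    positivity
  · have hw := sub_pos.2 (sqrt_div_lt_one hμ hμl)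
    rw [agdR_of_not_le_agdSwitch hμ hμl ht]
    positivity

lemma two_div_le_one_sub_pow {w : ℝ} (hw0 : 0 ≤ w) (t : ℕ) (hw : w * ((t : ℝ) + 2) ≤ 2) :
    2 / (((t : ℝ) + 1) * ((t : ℝ) + 2)) ≤ (1 - w) ^ t := by
  induction t with
  | zero => norm_num
  | succ t ih =>
    push_cast at hw ⊢
    have ih' := ih (by nlinarith)
    have hratio : ((t : ℝ) + 1) / ((t : ℝ) + 3) ≤ 1 - w := by
      rw [div_le_iff₀ (by positivity)]
      nlinarith
    calc 2 / (((t : ℝ) + 1 + 1) * ((t : ℝ) + 1 + 2))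
        = 2 / (((t : ℝ) + 1) * ((t : ℝ) + 2)) * (((t : ℝ) + 1) / ((t : ℝ) + 3)) := by
          field_simp
          ring
      _ ≤ (1 - w) ^ t * (1 - w) :=
          mul_le_mul ih' hratio (by positivity) (le_trans (by positivity) ih')
      _ = (1 - w) ^ (t + 1) := (pow_succ _ _).symm

lemma agdAccuracy_succ (l μ : ℝ) (t : ℕ) : agdAccuracy l μ (t + 1)
    = 2 * l * min ((1 - √(μ / l)) ^ t) (2 / (((t : ℝ) + 1) * ((t : ℝ) + 2))) := by
  rw [agdAccuracy, Nat.add_sub_cancel]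
  push_cast
  ring_nf

lemma agdAccuracy_of_le_agdSwitch (hμ : 0 < μ) (hμl : μ < l) {t : ℕ}
    (ht : ((t + 1 : ℕ) : ℤ) ≤ agdSwitch l μ) :
    agdAccuracy l μ (t + 1) = 4 * l / (((t : ℝ) + 1) * ((t : ℝ) + 2)) := by
  have hw := (le_agdSwitch_iff hμ hμl (t + 1)).1 ht
  push_cast at hw
  rw [agdAccuracy_succ, min_eq_right
    (two_div_le_one_sub_pow (Real.sqrt_nonneg _) t (by linarith))]
  ring

lemma one_sub_mul_agdAccuracy_le (hμ : 0 < μ) (hμl : μ < l) {t : ℕ}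
    (ht : ¬ ((t + 2 : ℕ) : ℤ) ≤ agdSwitch l μ) :
    (1 - √(μ / l)) * agdAccuracy l μ (t + 1) ≤ agdAccuracy l μ (t + 2) := by
  have hl := hμ.trans hμl
  have hw := mt (le_agdSwitch_iff hμ hμl (t + 2)).2 ht
  have hw1 := sub_pos.2 (sqrt_div_lt_one hμ hμl)
  rw [agdAccuracy_succ, agdAccuracy_succ, mul_left_comm,
    mul_min_of_nonneg _ _ hw1.le, ← pow_succ']
  push_cast at hw ⊢
  refine mul_le_mul_of_nonneg_left (min_le_min_left _ ?_) (by positivity)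
  have hratio : 1 - √(μ / l) ≤ ((t : ℝ) + 1) / ((t : ℝ) + 3) := by
    rw [le_div_iff₀ (by positivity)]
    nlinarith
  calc (1 - √(μ / l)) * (2 / (((t : ℝ) + 1) * ((t : ℝ) + 2)))
      ≤ ((t : ℝ) + 1) / ((t : ℝ) + 3) * (2 / (((t : ℝ) + 1) * ((t : ℝ) + 2))) := by gcongr
    _ = 2 / (((t : ℝ) + 1 + 1) * ((t : ℝ) + 1 + 2)) := by
        field_simp
        ring

end AGDParameters

section TwoPhaseRecursion

variable {l μ : ℝ} {gap dist : ℕ → ℝ}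

lemma first_phase_sum_le (hμ : 0 ≤ μ) (hdist : ∀ t, 0 ≤ dist t)
    (hfirst : ∀ t : ℕ, ((t + 1 : ℕ) : ℤ) ≤ agdSwitch l μ →
      ((t : ℝ) + 1) * ((t : ℝ) + 2) * gap (t + 1)
          + (4 * l + 2 * ((t : ℝ) + 1) * μ) * dist (t + 1)
        ≤ (t : ℝ) * ((t : ℝ) + 1) * gap t + 4 * l * dist t)
    {t : ℕ} (ht : (t : ℤ) ≤ agdSwitch l μ) :
    (t : ℝ) * ((t : ℝ) + 1) * gap t + (4 * l + 2 * (t : ℝ) * μ) * dist t ≤ 4 * l * dist 0 := by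
  induction t with
  | zero => simp
  | succ t ih =>
    have ih' := ih (by omega)
    have hdrop := mul_nonneg (mul_nonneg (Nat.cast_nonneg (α := ℝ) t) hμ) (hdist t)
    have hstep := hfirst t ht
    push_cast
    linarith

lemma gap_add_dist_le_of_le_agdSwitch (hμ : 0 < μ) (hμl : μ < l) (hdist : ∀ t, 0 ≤ dist t)
    (hfirst : ∀ t : ℕ, ((t + 1 : ℕ) : ℤ) ≤ agdSwitch l μ →
      ((t : ℝ) + 1) * ((t : ℝ) + 2) * gap (t + 1)
          + (4 * l + 2 * ((t : ℝ) + 1) * μ) * dist (t + 1)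
        ≤ (t : ℝ) * ((t : ℝ) + 1) * gap t + 4 * l * dist t)
    {t : ℕ} (ht : ((t + 1 : ℕ) : ℤ) ≤ agdSwitch l μ) :
    gap (t + 1) + μ * dist (t + 1) ≤ agdAccuracy l μ (t + 1) * dist 0 := by
  have hl := hμ.trans hμl
  have hsum := first_phase_sum_le hμ.le hdist hfirst ht
  have hw := (le_agdSwitch_iff hμ hμl (t + 1)).1 ht
  push_cast at hsum hw
  have hμt : μ * ((t : ℝ) + 2) ^ 2 ≤ 4 * l := by
    have hw_sq : (√(μ / l) * ((t : ℝ) + 2)) ^ 2 ≤ 2 ^ 2 :=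
      pow_le_pow_left₀ (by positivity) (by linarith) 2
    linear_combination l * hw_sq - ((t : ℝ) + 2) ^ 2 * mul_sq_sqrt_div hμ hμl
  have hcoef : ((t : ℝ) + 1) * ((t : ℝ) + 2) * μ ≤ 4 * l + 2 * ((t : ℝ) + 1) * μ := by
    nlinarith [mul_pos hμ (show (0 : ℝ) < (t : ℝ) + 2 by positivity)]
  rw [agdAccuracy_of_le_agdSwitch hμ hμl ht, div_mul_eq_mul_div, le_div_iff₀ (by positivity)]
  linear_combination hsum + mul_le_mul_of_nonneg_right hcoef (hdist (t + 1))

lemma gap_add_dist_le_agdAccuracy_mul (hμ : 0 < μ) (hμl : μ < l) (hdist : ∀ t, 0 ≤ dist t)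
    (hfirst : ∀ t : ℕ, ((t + 1 : ℕ) : ℤ) ≤ agdSwitch l μ →
      ((t : ℝ) + 1) * ((t : ℝ) + 2) * gap (t + 1)
          + (4 * l + 2 * ((t : ℝ) + 1) * μ) * dist (t + 1)
        ≤ (t : ℝ) * ((t : ℝ) + 1) * gap t + 4 * l * dist t)
    (hsecond : ∀ t : ℕ, ¬ ((t + 1 : ℕ) : ℤ) ≤ agdSwitch l μ →
      gap (t + 1) + μ * dist (t + 1) ≤ (1 - √(μ / l)) * (gap t + μ * dist t)) (t : ℕ) :
    gap (t + 1) + μ * dist (t + 1) ≤ agdAccuracy l μ (t + 1) * dist 0 := by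
  have hw1 := sub_pos.2 (sqrt_div_lt_one hμ hμl)
  induction t with
  | zero =>
    refine gap_add_dist_le_of_le_agdSwitch hμ hμl hdist hfirst ?_
    rw [le_agdSwitch_iff hμ hμl]
    push_cast
    linarith
  | succ t ih =>
    by_cases ht : ((t + 1 + 1 : ℕ) : ℤ) ≤ agdSwitch l μ
    · exact gap_add_dist_le_of_le_agdSwitch hμ hμl hdist hfirst ht
    · calc gap (t + 1 + 1) + μ * dist (t + 1 + 1)
          ≤ (1 - √(μ / l)) * (gap (t + 1) + μ * dist (t + 1)) := hsecond (t + 1) ht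
        _ ≤ (1 - √(μ / l)) * (agdAccuracy l μ (t + 1) * dist 0) := by gcongr
        _ ≤ agdAccuracy l μ (t + 1 + 1) * dist 0 := by
            rw [← mul_assoc]
            exact mul_le_mul_of_nonneg_right (one_sub_mul_agdAccuracy_le hμ hμl ht) (hdist 0)

end TwoPhaseRecursion

section StepErrors

variable {A : Type*} [Fintype A]

lemma first_phase_error_nonpos {ℓ l μ : ℝ} (hμ : 0 ≤ μ) (hl : 0 < l) (hℓ : ℓ ≤ l) (t : ℕ)
    (dx dy : ℝ) :
    ℓ / 2 * (2 / ((t : ℝ) + 2) * dx) ^ 2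
      - μ * (2 / ((t : ℝ) + 2) * (1 - 2 / ((t : ℝ) + 2)) / 2) * dy ^ 2
      - 2 / ((t : ℝ) + 2) / (((t : ℝ) + 1) / (2 * l)) * (dx ^ 2 / 2) ≤ 0 := by
  have hρ : 0 ≤ 1 - 2 / ((t : ℝ) + 2) := by
    rw [sub_nonneg, div_le_one (by positivity)]
    linarith [Nat.cast_nonneg (α := ℝ) t]
  have hdy : 0 ≤ μ * (2 / ((t : ℝ) + 2) * (1 - 2 / ((t : ℝ) + 2)) / 2) * dy ^ 2 := by positivity
  have hdx : ℓ / 2 * (2 / ((t : ℝ) + 2)) ^ 2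
      ≤ 2 / ((t : ℝ) + 2) / (((t : ℝ) + 1) / (2 * l)) / 2 :=
    calc ℓ / 2 * (2 / ((t : ℝ) + 2)) ^ 2 ≤ l / 2 * (2 / ((t : ℝ) + 2)) ^ 2 := by gcongr
      _ = 2 * l / ((t : ℝ) + 2) * (1 / ((t : ℝ) + 2)) := by field_simp
      _ ≤ 2 * l / ((t : ℝ) + 2) * (1 / ((t : ℝ) + 1)) := by gcongr; norm_num
      _ = 2 / ((t : ℝ) + 2) / (((t : ℝ) + 1) / (2 * l)) / 2 := by field_simp
  linear_combination mul_le_mul_of_nonneg_right hdx (sq_nonneg dx) + hdy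

lemma second_phase_error_nonpos {ℓ l w dx dy du : ℝ} (hl : 0 < l) (hw0 : 0 < w) (hw1 : w < 1)
    (hℓ : ℓ ≤ l * (1 - w ^ 2)) (hdu0 : 0 ≤ du) (hdu : du ≤ w / (1 + w) * (dx + w * dy)) :
    ℓ / 2 * du ^ 2 - l * w ^ 2 * (w * (1 - w) / 2) * dy ^ 2
      - w / (1 / (l * w * (1 - w))) * (dx ^ 2 / 2) ≤ 0 := by
  have hw1' : 0 < 1 - w := sub_pos.2 hw1
  have hcauchy : (dx + w * dy) ^ 2 ≤ (1 + w) * (dx ^ 2 + w * dy ^ 2) := by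
    nlinarith [mul_nonneg hw0.le (sq_nonneg (dx - dy))]
  have hdu_sq : du ^ 2 ≤ w ^ 2 / (1 + w) * (dx ^ 2 + w * dy ^ 2) :=
    calc du ^ 2 ≤ (w / (1 + w) * (dx + w * dy)) ^ 2 := pow_le_pow_left₀ hdu0 hdu 2
      _ = (w / (1 + w)) ^ 2 * (dx + w * dy) ^ 2 := mul_pow _ _ _
      _ ≤ (w / (1 + w)) ^ 2 * ((1 + w) * (dx ^ 2 + w * dy ^ 2)) := by gcongr
      _ = w ^ 2 / (1 + w) * (dx ^ 2 + w * dy ^ 2) := by field_simp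
  have hmain : ℓ / 2 * du ^ 2 ≤ l * (1 - w) * w ^ 2 / 2 * (dx ^ 2 + w * dy ^ 2) :=
    calc ℓ / 2 * du ^ 2 ≤ l * (1 - w ^ 2) / 2 * du ^ 2 := by gcongr
      _ ≤ l * (1 - w ^ 2) / 2 * (w ^ 2 / (1 + w) * (dx ^ 2 + w * dy ^ 2)) := by
          have : 0 ≤ 1 - w ^ 2 := by nlinarith
          gcongr
      _ = l * (1 - w) * w ^ 2 / 2 * (dx ^ 2 + w * dy ^ 2) := by
          field_simp
          ring
  have hdiv : w / (1 / (l * w * (1 - w))) = l * w ^ 2 * (1 - w) := by field_simp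
  rw [hdiv]
  linear_combination hmain

lemma sum_abs_convexComb_sub_convexComb (x y x' : A → ℝ) {ρ : ℝ} (h0 : 0 ≤ ρ) :
    ∑ a, |(1 - ρ) * y a + ρ * x' a - ((1 - ρ) * y a + ρ * x a)| = ρ * ∑ a, |x' a - x a| := by
  rw [Finset.mul_sum]
  refine Finset.sum_congr rfl fun a _ => ?_
  rw [add_sub_add_left_eq_sub, ← mul_sub, abs_mul, abs_of_nonneg h0]

lemma sum_abs_convexComb_sub_extrapolation_le (x y x' : A → ℝ) {w : ℝ} (hw : 0 ≤ w) :
    ∑ a, |(1 - w) * y a + w * x' a - ((1 - w / (1 + w)) * y a + w / (1 + w) * x a)|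
      ≤ w / (1 + w) * (∑ a, |x' a - x a| + w * ∑ a, |x' a - y a|) := by
  rw [Finset.mul_sum (a := w), ← Finset.sum_add_distrib, Finset.mul_sum]
  refine Finset.sum_le_sum fun a _ => ?_
  have hsplit : (1 - w) * y a + w * x' a - ((1 - w / (1 + w)) * y a + w / (1 + w) * x a)
      = w / (1 + w) * ((x' a - x a) + w * (x' a - y a)) := by
    field_simp
    ring
  rw [hsplit, abs_mul, abs_of_nonneg (by positivity : 0 ≤ w / (1 + w))]
  refine mul_le_mul_of_nonneg_left ((abs_add_le _ _).trans ?_) (by positivity)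
  rw [abs_mul, abs_of_nonneg hw]

end StepErrors

section AGDRun

variable {S A : Type*} [Fintype A] [Nonempty A] {h : S → (A → ℝ) → ℝ}
  {dh : S → (A → ℝ) → (A → ℝ)} {L η τ l μ : ℝ} {G v : S → A → ℝ}

lemma agdRun_interior (hητ : 0 ≤ η * τ) (hμ : 0 < μ) (hμl : μ < l) (hv : ∀ s a, 0 < v s a)
    (t : ℕ) : (agdRun dh η τ G v l μ t).Interior := by
  induction t with
  | zero =>
    exact ⟨fun _ => uniformDist_mem_stdSimplex, fun _ => uniformDist_pos,
      fun _ => uniformDist_mem_stdSimplex, fun _ => uniformDist_pos⟩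
  | succ t ih =>
    have hρ := agdRho_mem_Icc hμ hμl t
    exact ih.step hητ (agdR_pos hμ hμl t) hρ.1 hρ.2 hv

variable (hreg : IsSmoothConvexRegularizer h dh L) (hη : 0 ≤ η) (hητ : 0 ≤ η * τ)
  (hμ : μ = 1 + η * τ) (hμl : μ < l) (hl : η * L + μ ≤ l) (hv : ∀ s a, 0 < v s a) (s : S)
  {p : A → ℝ} (hp : p ∈ stdSimplex ℝ A)
include hreg hη hητ hμ hμl hl hv hp

lemma agdRun_first_phase_step {t : ℕ} (ht : ((t + 1 : ℕ) : ℤ) ≤ agdSwitch l μ) :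
    ((t : ℝ) + 1) * ((t : ℝ) + 2) * (subObjective h η τ G v s ((agdRun dh η τ G v l μ (t + 1)).y s)
          - subObjective h η τ G v s p)
        + (4 * l + 2 * ((t : ℝ) + 1) * μ) * klDist p ((agdRun dh η τ G v l μ (t + 1)).x s)
      ≤ (t : ℝ) * ((t : ℝ) + 1) * (subObjective h η τ G v s ((agdRun dh η τ G v l μ t).y s)
          - subObjective h η τ G v s p)
        + 4 * l * klDist p ((agdRun dh η τ G v l μ t).x s) := by
  have hμ0 : 0 < μ := by linarith
  have hl0 : 0 < l := hμ0.trans hμl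
  have hρ_eq : agdRho l μ (t + 1) = 2 / ((t : ℝ) + 2) := by
    rw [agdRho, if_pos ht, Nat.cast_succ, add_assoc, one_add_one_eq_two]
  have hq_eq : agdQ l μ (t + 1) = 2 / ((t : ℝ) + 2) := by
    rw [agdQ, if_pos ht, Nat.cast_succ, add_assoc, one_add_one_eq_two]
  have hr_eq : agdR l μ (t + 1) = ((t : ℝ) + 1) / (2 * l) := by
    rw [agdR, if_pos ht, Nat.cast_succ]
  have hρ := agdRho_mem_Icc hμ0 hμl t
  have hq := agdQ_mem_Icc hμ0 hμl t
  have hstep := subObjective_agdStep_le hreg hη hητ (agdR_pos hμ0 hμl t) hρ.1 hρ.2 hq.1 hq.2 hv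
    (agdRun_interior (dh := dh) (G := G) hητ hμ0 hμl hv t)
    (z' := agdRun dh η τ G v l μ (t + 1)) rfl s hp
  have hy : (agdRun dh η τ G v l μ (t + 1)).y s = fun a =>
      (1 - agdRho l μ (t + 1)) * (agdRun dh η τ G v l μ t).y s a
        + agdRho l μ (t + 1) * (agdRun dh η τ G v l μ (t + 1)).x s a := rfl
  simp only [hy, hρ_eq, hq_eq, hr_eq, ← hμ] at hstep ⊢
  rw [sum_abs_convexComb_sub_convexComb _ _ _ (by positivity)] at hstep
  have hscaled := mul_le_mul_of_nonneg_left (hstep.trans (add_le_of_nonpos_right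
      (first_phase_error_nonpos hμ0.le hl0 (by linarith) t _ _)))
    (show 0 ≤ ((t : ℝ) + 1) * ((t : ℝ) + 2) by positivity)
  refine (le_of_eq ?_).trans (hscaled.trans (le_of_eq ?_))
  · field_simp
    ring
  · field_simp
    ring

lemma agdRun_second_phase_step {t : ℕ} (ht : ¬ ((t + 1 : ℕ) : ℤ) ≤ agdSwitch l μ) :
    (subObjective h η τ G v s ((agdRun dh η τ G v l μ (t + 1)).y s)
          - subObjective h η τ G v s p)
        + μ * klDist p ((agdRun dh η τ G v l μ (t + 1)).x s)
      ≤ (1 - √(μ / l)) * ((subObjective h η τ G v s ((agdRun dh η τ G v l μ t).y s)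
          - subObjective h η τ G v s p) + μ * klDist p ((agdRun dh η τ G v l μ t).x s)) := by
  have hμ0 : 0 < μ := by linarith
  have hl0 : 0 < l := hμ0.trans hμl
  have hρ_eq : agdRho l μ (t + 1) = √(μ / l) := if_neg ht
  have hq_eq := agdQ_of_not_le_agdSwitch hμ0 hμl ht
  have hr_eq := agdR_of_not_le_agdSwitch hμ0 hμl ht
  have hρ := agdRho_mem_Icc hμ0 hμl t
  have hq := agdQ_mem_Icc hμ0 hμl t
  have hstep := subObjective_agdStep_le hreg hη hητ (agdR_pos hμ0 hμl t) hρ.1 hρ.2 hq.1 hq.2 hv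
    (agdRun_interior (dh := dh) (G := G) hητ hμ0 hμl hv t)
    (z' := agdRun dh η τ G v l μ (t + 1)) rfl s hp
  have hy : (agdRun dh η τ G v l μ (t + 1)).y s = fun a =>
      (1 - agdRho l μ (t + 1)) * (agdRun dh η τ G v l μ t).y s a
        + agdRho l μ (t + 1) * (agdRun dh η τ G v l μ (t + 1)).x s a := rfl
  have hw0 := sqrt_div_pos hμ0 hμl
  have hw1 := sqrt_div_lt_one hμ0 hμl
  have hμ_eq := mul_sq_sqrt_div hμ0 hμl
  simp only [hy, hρ_eq, hq_eq, hr_eq, ← hμ] at hstep ⊢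
  set w := √(μ / l)
  have hw1' : 0 < 1 - w := sub_pos.2 hw1
  have herror := second_phase_error_nonpos (ℓ := η * L) hl0 hw0 hw1 (by linarith)
    (Finset.sum_nonneg fun _ _ => abs_nonneg _)
    (sum_abs_convexComb_sub_extrapolation_le ((agdRun dh η τ G v l μ t).x s)
      ((agdRun dh η τ G v l μ t).y s) ((agdRun dh η τ G v l μ (t + 1)).x s) hw0.le)
  rw [hμ_eq] at herror
  refine (le_of_eq ?_).trans ((hstep.trans (add_le_of_nonpos_right herror)).trans (le_of_eq ?_))
  · rw [← hμ_eq]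
    field_simp
    ring
  · rw [← hμ_eq]
    field_simp

lemma subObjective_agdRun_le (t : ℕ) :
    (subObjective h η τ G v s ((agdRun dh η τ G v l μ (t + 1)).y s) - subObjective h η τ G v s p)
        + μ * klDist p ((agdRun dh η τ G v l μ (t + 1)).x s)
      ≤ agdAccuracy l μ (t + 1) * klDist p (uniformDist A) := by
  have hμ0 : 0 < μ := by linarith
  have hinterior := agdRun_interior (dh := dh) (G := G) hητ hμ0 hμl hv
  exact gap_add_dist_le_agdAccuracy_mul
    (gap := fun t => subObjective h η τ G v s ((agdRun dh η τ G v l μ t).y s)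
      - subObjective h η τ G v s p)
    (dist := fun t => klDist p ((agdRun dh η τ G v l μ t).x s)) hμ0 hμl
    (fun t => klDist_nonneg hp ((hinterior t).x_mem s) ((hinterior t).x_pos s))
    (fun _ ht => agdRun_first_phase_step hreg hη hητ hμ hμl hl hv s hp ht)
    (fun _ ht => agdRun_second_phase_step hreg hη hητ hμ hμl hl hv s hp ht) t

end AGDRun

section Bellman

variable {S A : Type*} [Fintype S] [Fintype A]

/-- The expected cost of one transition, including the regularizer and the perturbation by the
entropy with weight `τ`. -/
noncomputable def stageCost (M : MDP S A) (h : S → (A → ℝ) → ℝ) (τ : ℝ) (π : S → A → ℝ)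
    (s : S) (a : A) : ℝ :=
  M.c s a + h s (π s) + τ * klDist (π s) (uniformDist A)

open Classical in
/-- The state-value function of the perturbed cost; `Vval` is the case `τ = 0`. -/
noncomputable def perturbedValue (M : MDP S A) (h : S → (A → ℝ) → ℝ) (τ : ℝ) (π : S → A → ℝ)
    (s : S) : ℝ :=
  discountedCost M h τ π (fun s' a' => if s' = s then π s' a' else 0)

/-- The transition operator of the state chain under `π`. -/
noncomputable def stateTransition (M : MDP S A) (π : S → A → ℝ) (U : S → ℝ) (s : S) : ℝ :=
  ∑ a, π s a * ∑ s', M.P s a s' * U s'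

/-- The advantage of `π'` over `π` at `s`, for the perturbed cost. -/
noncomputable def advantage (M : MDP S A) (h : S → (A → ℝ) → ℝ) (τ : ℝ) (π' π : S → A → ℝ)
    (s : S) : ℝ :=
  (∑ a, Qval M h τ π s a * (π' s a - π s a)) + (h s (π' s) - h s (π s))
    + τ * (klDist (π' s) (uniformDist A) - klDist (π s) (uniformDist A))

variable (M : MDP S A) (h : S → (A → ℝ) → ℝ) (τ : ℝ) {π : S → A → ℝ}

lemma Vval_eq_perturbedValue (π : S → A → ℝ) : Vval M h π = perturbedValue M h 0 π := rfl

lemma sum_abs_stateActionLaw_le (hπ : IsPolicy π) (m : S → A → ℝ) (t : ℕ) :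
    ∑ s, ∑ a, |stateActionLaw M π m t s a| ≤ ∑ s, ∑ a, |m s a| := by
  induction t with
  | zero => exact le_rfl
  | succ t ih =>
    calc ∑ s', ∑ a', |stateActionLaw M π m (t + 1) s' a'|
        = ∑ s', |∑ s, ∑ a, stateActionLaw M π m t s a * M.P s a s'| := by
          refine Finset.sum_congr rfl fun s' _ => ?_
          simp only [stateActionLaw, abs_mul, abs_of_nonneg ((hπ s').1 _)]
          rw [← Finset.mul_sum, (hπ s').2, mul_one]
      _ ≤ ∑ s', ∑ s, ∑ a, |stateActionLaw M π m t s a| * M.P s a s' := by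
          refine Finset.sum_le_sum fun s' _ => (Finset.abs_sum_le_sum_abs _ _).trans ?_
          refine Finset.sum_le_sum fun s _ => (Finset.abs_sum_le_sum_abs _ _).trans_eq ?_
          exact Finset.sum_congr rfl fun a _ => by rw [abs_mul, abs_of_nonneg (M.P_nonneg s a s')]
      _ = ∑ s, ∑ a, |stateActionLaw M π m t s a| := by
          rw [Finset.sum_comm]
          refine Finset.sum_congr rfl fun s _ => ?_
          rw [Finset.sum_comm]
          simp only [← Finset.mul_sum, M.P_sum, mul_one]
      _ ≤ ∑ s, ∑ a, |m s a| := ih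

lemma abs_sum_sum_mul_le (m f : S → A → ℝ) :
    |∑ s, ∑ a, m s a * f s a| ≤ (∑ s, ∑ a, |m s a|) * ∑ s, ∑ a, |f s a| := by
  simp only [← Fintype.sum_prod_type' (f := fun _ _ => _)]
  calc |∑ i : S × A, m i.1 i.2 * f i.1 i.2| ≤ ∑ i : S × A, |m i.1 i.2| * |f i.1 i.2| :=
        (Finset.abs_sum_le_sum_abs _ _).trans_eq (Finset.sum_congr rfl fun _ _ => abs_mul _ _)
    _ ≤ ∑ i : S × A, |m i.1 i.2| * ∑ j : S × A, |f j.1 j.2| :=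
        Finset.sum_le_sum fun i hi => mul_le_mul_of_nonneg_left
          (Finset.single_le_sum (f := fun j : S × A => |f j.1 j.2|) (fun _ _ => abs_nonneg _) hi)
          (abs_nonneg _)
    _ = (∑ i : S × A, |m i.1 i.2|) * ∑ j : S × A, |f j.1 j.2| := (Finset.sum_mul _ _ _).symm

lemma summable_discountedCost (hπ : IsPolicy π) (m : S → A → ℝ) :
    Summable fun t : ℕ =>
      M.γ ^ t * ∑ s, ∑ a, stateActionLaw M π m t s a * stageCost M h τ π s a := by
  refine Summable.of_norm_bounded (g := fun t : ℕ => M.γ ^ t *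
    ((∑ s, ∑ a, |m s a|) * ∑ s, ∑ a, |stageCost M h τ π s a|))
    ((summable_geometric_of_lt_one M.γ_pos.le M.γ_lt_one).mul_right _) fun t => ?_
  rw [Real.norm_eq_abs, abs_mul, abs_of_nonneg (pow_nonneg M.γ_pos.le t)]
  refine mul_le_mul_of_nonneg_left ((abs_sum_sum_mul_le _ _).trans ?_) (pow_nonneg M.γ_pos.le t)
  exact mul_le_mul_of_nonneg_right (sum_abs_stateActionLaw_le M hπ m t) (by positivity)

lemma stateActionLaw_add_one (m : S → A → ℝ) (t : ℕ) :
    stateActionLaw M π m (t + 1) = stateActionLaw M π (stateActionLaw M π m 1) t := by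
  induction t with
  | zero => rfl
  | succ t ih =>
    rw [stateActionLaw, ih]
    rfl

lemma discountedCost_bellman (hπ : IsPolicy π) (m : S → A → ℝ) :
    discountedCost M h τ π m = ∑ s, ∑ a, m s a * stageCost M h τ π s a
      + M.γ * discountedCost M h τ π (stateActionLaw M π m 1) := by
  refine (summable_discountedCost M h τ hπ m).tsum_eq_zero_add.trans ?_
  rw [pow_zero, one_mul, stateActionLaw, discountedCost, ← tsum_mul_left]
  congr 1
  refine tsum_congr fun t => ?_
  rw [stateActionLaw_add_one M m t, pow_succ', mul_assoc]
  rfl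

open Classical in
lemma sum_sum_pointMass_mul (f : S → A → ℝ) (s : S) (a : A) :
    ∑ s', ∑ a', (if s' = s ∧ a' = a then 1 else 0) * f s' a' = f s a := by
  simp only [ite_and, ite_mul, one_mul, zero_mul, Finset.sum_ite_irrel, Finset.sum_const_zero,
    Finset.sum_ite_eq', Finset.mem_univ, if_true]

open Classical in
lemma stateActionLaw_eq_sum_pointMass (m : S → A → ℝ) (t : ℕ) (s' : S) (a' : A) :
    stateActionLaw M π m t s' a' = ∑ i : S × A, m i.1 i.2 *
      stateActionLaw M π (fun s' a' => if s' = i.1 ∧ a' = i.2 then 1 else 0) t s' a' := by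
  induction t generalizing s' a' with
  | zero =>
    simp only [stateActionLaw, Fintype.sum_prod_type, eq_comm (a := s'), eq_comm (a := a'),
      mul_comm (m _ _), sum_sum_pointMass_mul]
  | succ t ih =>
    simp only [stateActionLaw, ← Fintype.sum_prod_type' (f := fun _ _ => _), ← mul_assoc,
      ← Finset.sum_mul]
    congr 1
    simp only [ih, Finset.sum_mul, Finset.mul_sum, mul_assoc]
    exact Finset.sum_comm

lemma discountedCost_eq_sum_Qval (hπ : IsPolicy π) (m : S → A → ℝ) :
    discountedCost M h τ π m = ∑ s, ∑ a, m s a * Qval M h τ π s a := by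
  classical
  have hsum := hasSum_sum (s := Finset.univ) fun i (_ : i ∈ (Finset.univ : Finset (S × A))) =>
    (summable_discountedCost M h τ hπ
      (fun s' a' => if s' = i.1 ∧ a' = i.2 then 1 else 0)).hasSum.mul_left (m i.1 i.2)
  rw [← Fintype.sum_prod_type' (f := fun s a => m s a * Qval M h τ π s a)]
  refine Eq.trans (tsum_congr fun t => ?_) hsum.tsum_eq
  change M.γ ^ t * ∑ s, ∑ a, stateActionLaw M π m t s a * stageCost M h τ π s a = _
  simp only [← Fintype.sum_prod_type' (f := fun _ _ => _)]
  simp only [stateActionLaw_eq_sum_pointMass M m, Finset.sum_mul, Finset.mul_sum]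
  rw [Finset.sum_comm]
  exact Finset.sum_congr rfl fun _ _ => Finset.sum_congr rfl fun _ _ => by ring

lemma perturbedValue_eq_sum_Qval (hπ : IsPolicy π) (s : S) :
    perturbedValue M h τ π s = ∑ a, π s a * Qval M h τ π s a := by
  classical
  simp only [perturbedValue, discountedCost_eq_sum_Qval M h τ hπ, ite_mul, zero_mul,
    Finset.sum_ite_irrel, Finset.sum_const_zero, Finset.sum_ite_eq', Finset.mem_univ, if_true]

lemma Qval_bellman (hπ : IsPolicy π) (s : S) (a : A) :
    Qval M h τ π s a
      = stageCost M h τ π s a + M.γ * ∑ s', M.P s a s' * perturbedValue M h τ π s' := by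
  classical
  rw [Qval, discountedCost_bellman M h τ hπ, discountedCost_eq_sum_Qval M h τ hπ]
  simp only [stateActionLaw, sum_sum_pointMass_mul, perturbedValue_eq_sum_Qval M h τ hπ, mul_assoc,
    Finset.mul_sum]

lemma perturbedValue_bellman (hπ : IsPolicy π) (s : S) :
    perturbedValue M h τ π s = ∑ a, π s a * stageCost M h τ π s a
      + M.γ * stateTransition M π (perturbedValue M h τ π) s := by
  rw [perturbedValue_eq_sum_Qval M h τ hπ, stateTransition, Finset.mul_sum,
    ← Finset.sum_add_distrib]
  refine Finset.sum_congr rfl fun a _ => ?_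
  rw [Qval_bellman M h τ hπ]
  ring

lemma stateTransition_le {C : ℝ} (hπ : IsPolicy π) {U : S → ℝ} (hU : ∀ s, U s ≤ C) (s : S) :
    stateTransition M π U s ≤ C := by
  calc stateTransition M π U s ≤ ∑ a, π s a * ∑ s', M.P s a s' * C :=
        Finset.sum_le_sum fun a _ => mul_le_mul_of_nonneg_left (Finset.sum_le_sum fun s' _ =>
          mul_le_mul_of_nonneg_left (hU s') (M.P_nonneg s a s')) ((hπ s).1 a)
    _ = C := by simp only [← Finset.sum_mul, M.P_sum, (hπ s).2, one_mul]

-- Maximum principle: evaluate the inequality at a state where `U` is maximal.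
lemma le_div_of_le_add_stateTransition (hπ : IsPolicy π) {U : S → ℝ} {C : ℝ}
    (hU : ∀ s, U s ≤ C + M.γ * stateTransition M π U s) (s : S) : U s ≤ C / (1 - M.γ) := by
  have : Nonempty S := ⟨s⟩
  obtain ⟨s₀, hs₀⟩ := Finite.exists_max U
  have htransition := mul_le_mul_of_nonneg_left (stateTransition_le M hπ hs₀ s₀) M.γ_pos.le
  have hmax : U s₀ ≤ C / (1 - M.γ) := by
    rw [le_div_iff₀ (sub_pos.2 M.γ_lt_one)]
    linarith [hU s₀]
  exact (hs₀ s).trans hmax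

lemma stateTransition_sub (U W : S → ℝ) (s : S) :
    stateTransition M π (fun s => U s - W s) s
      = stateTransition M π U s - stateTransition M π W s := by
  simp only [stateTransition, mul_sub, Finset.sum_sub_distrib]

lemma sum_mul_stageCost_sub {π' : S → A → ℝ} (hπ' : IsPolicy π') (s : S) (τ' : ℝ) :
    ∑ a, π' s a * stageCost M h τ' π' s a - ∑ a, π' s a * stageCost M h τ π s a
      = h s (π' s) - h s (π s)
        + (τ' * klDist (π' s) (uniformDist A) - τ * klDist (π s) (uniformDist A)) := by
  have hdiff : ∀ a, stageCost M h τ' π' s a - stageCost M h τ π s a = h s (π' s) - h s (π s)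
      + (τ' * klDist (π' s) (uniformDist A) - τ * klDist (π s) (uniformDist A)) := fun a => by
    simp only [stageCost]
    ring
  simp only [← Finset.sum_sub_distrib, ← mul_sub, hdiff, ← Finset.sum_mul, (hπ' s).2, one_mul]

-- The performance difference lemma in fixed point form.
lemma perturbedValue_sub_eq_advantage {π' : S → A → ℝ} (hπ' : IsPolicy π') (hπ : IsPolicy π)
    (s : S) :
    perturbedValue M h τ π' s - perturbedValue M h τ π s = advantage M h τ π' π s
      + M.γ * stateTransition M π'
        (fun s => perturbedValue M h τ π' s - perturbedValue M h τ π s) s := by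
  have hcost := sum_mul_stageCost_sub M h τ (π := π) hπ' s τ
  have hQ : ∑ a, Qval M h τ π s a * (π' s a - π s a)
      = ∑ a, π' s a * stageCost M h τ π s a
        + M.γ * stateTransition M π' (perturbedValue M h τ π) s - perturbedValue M h τ π s := by
    rw [perturbedValue_eq_sum_Qval M h τ hπ s, stateTransition, Finset.mul_sum,
      ← Finset.sum_add_distrib, ← Finset.sum_sub_distrib]
    refine Finset.sum_congr rfl fun a _ => ?_
    rw [Qval_bellman M h τ hπ]
    ring
  rw [perturbedValue_bellman M h τ hπ' s, stateTransition_sub, advantage, hQ]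
  linear_combination hcost

lemma perturbedValue_sub_le_advantage_add {π' : S → A → ℝ} (hπ' : IsPolicy π') (hπ : IsPolicy π)
    {b : ℝ} (hb : ∀ s, advantage M h τ π' π s ≤ b) (s : S) :
    perturbedValue M h τ π' s - perturbedValue M h τ π s
      ≤ advantage M h τ π' π s + M.γ * (b / (1 - M.γ)) := by
  have hfix := perturbedValue_sub_eq_advantage M h τ hπ' hπ
  have hle : ∀ s, perturbedValue M h τ π' s - perturbedValue M h τ π s ≤ b / (1 - M.γ) :=
    le_div_of_le_add_stateTransition M hπ' fun s => by
      linarith [hfix s, hb s]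
  linarith [hfix s, mul_le_mul_of_nonneg_left (stateTransition_le M hπ' hle s) M.γ_pos.le]

lemma IsStationaryDist.sum_mul_stateTransition {M : MDP S A} {ν : S → ℝ}
    (hν : IsStationaryDist M π ν) (U : S → ℝ) :
    ∑ s, ν s * stateTransition M π U s = ∑ s, ν s * U s := by
  calc ∑ s, ν s * stateTransition M π U s
      = ∑ s, ∑ s', (ν s * ∑ a, π s a * M.P s a s') * U s' := by
        refine Finset.sum_congr rfl fun s _ => ?_
        simp only [stateTransition, Finset.mul_sum, Finset.sum_mul]
        rw [Finset.sum_comm]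
        exact Finset.sum_congr rfl fun s' _ => Finset.sum_congr rfl fun a _ => by ring
    _ = ∑ s, ν s * U s := by
        rw [Finset.sum_comm]
        simp only [← Finset.sum_mul, hν.2]

lemma IsStationaryDist.sum_mul_fixedPoint {M : MDP S A} {ν : S → ℝ} (hν : IsStationaryDist M π ν)
    {U b : S → ℝ} (hU : ∀ s, U s = b s + M.γ * stateTransition M π U s) :
    (1 - M.γ) * ∑ s, ν s * U s = ∑ s, ν s * b s := by
  have hsum : ∑ s, ν s * U s = ∑ s, ν s * b s + M.γ * ∑ s, ν s * stateTransition M π U s := by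
    rw [Finset.mul_sum, ← Finset.sum_add_distrib]
    refine Finset.sum_congr rfl fun s _ => ?_
    linear_combination ν s * hU s
  rw [hν.sum_mul_stateTransition] at hsum
  linarith

lemma perturbedValue_sub_perturbedValue (hπ : IsPolicy π) (τ' : ℝ) (s : S) :
    perturbedValue M h τ π s - perturbedValue M h τ' π s
      = (τ - τ') * klDist (π s) (uniformDist A)
      + M.γ * stateTransition M π
        (fun s => perturbedValue M h τ π s - perturbedValue M h τ' π s) s := by
  rw [stateTransition_sub, perturbedValue_bellman M h τ hπ s, perturbedValue_bellman M h τ' hπ s]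
  linear_combination sum_mul_stageCost_sub M h τ' hπ s τ

variable [Nonempty A]

lemma perturbedValue_mono {τ} (hπ : IsPolicy π) {τ' : ℝ} (hτ : τ' ≤ τ) (s : S) :
    perturbedValue M h τ' π s ≤ perturbedValue M h τ π s := by
  have hneg := le_div_of_le_add_stateTransition M hπ (C := 0)
    (U := fun s => perturbedValue M h τ' π s - perturbedValue M h τ π s) (fun s => by
      rw [perturbedValue_sub_perturbedValue M h τ' hπ τ s]
      linarith [mul_nonneg (sub_nonneg.2 hτ) (klDist_uniformDist_nonneg (hπ s))]) s
  rw [zero_div] at hneg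
  linarith

lemma perturbedValue_sub_perturbedValue_le {τ} (hπ : IsPolicy π) {τ' : ℝ} (hτ : τ' ≤ τ) (s : S) :
    perturbedValue M h τ π s - perturbedValue M h τ' π s
      ≤ (τ - τ') * Real.log (Fintype.card A) / (1 - M.γ) := by
  refine le_div_of_le_add_stateTransition M hπ
    (U := fun s => perturbedValue M h τ π s - perturbedValue M h τ' π s) (fun s => ?_) s
  linarith [perturbedValue_sub_perturbedValue M h τ hπ τ' s,
    mul_le_mul_of_nonneg_left (klDist_uniformDist_le (hπ s)) (sub_nonneg.2 hτ)]

end Bellman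

section PolicyStep

variable {S A : Type*} [Fintype S] [Fintype A]

lemma abs_sum_mul_le_norm_mul_sum_abs (δ : S → A → ℝ) (s : S) (d : A → ℝ) :
    |∑ a, δ s a * d a| ≤ ‖δ‖ * ∑ a, |d a| := by
  rw [Finset.mul_sum]
  refine (Finset.abs_sum_le_sum_abs _ _).trans (Finset.sum_le_sum fun a _ => ?_)
  rw [abs_mul]
  exact mul_le_mul_of_nonneg_right ((norm_le_pi_norm (δ s) a).trans (norm_le_pi_norm δ s))
    (abs_nonneg _)

-- Pinsker's inequality and AM-GM.
lemma neg_sq_mul_norm_le_sum_mul_add_klDist (δ : S → A → ℝ) (s : S) {p q : A → ℝ}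
    (hp : p ∈ stdSimplex ℝ A) (hq : q ∈ stdSimplex ℝ A) (hq0 : ∀ a, 0 < q a) {η : ℝ} (hη : 0 ≤ η) :
    -((η * ‖δ‖) ^ 2 / 2) ≤ η * ∑ a, δ s a * (p a - q a) + klDist p q := by
  have hnoise := mul_le_mul_of_nonneg_left
    (neg_le_of_abs_le (abs_sum_mul_le_norm_mul_sum_abs δ s fun a => p a - q a)) hη
  have hpinsker := sq_sum_abs_sub_le_two_mul_klDist hp hq hq0
  linarith [sq_nonneg (η * ‖δ‖ - ∑ a, |p a - q a|)]

/-- The Lyapunov function of the method: the perturbed optimality gap, averaged over `ν`, plus a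
multiple of the divergence of the comparator `πs` from the prox-center. -/
noncomputable def lyapunov (M : MDP S A) (h : S → (A → ℝ) → ℝ) (ν : S → ℝ) (πs : S → A → ℝ)
    (τ : ℝ) (π v : S → A → ℝ) : ℝ :=
  (∑ s, ν s * (perturbedValue M h τ π s - perturbedValue M h τ πs s))
    + τ / (1 - M.γ) * ∑ s, ν s * klDist (πs s) (v s)

/-- `(π', v')` arises from the policy `π` and the prox-center `v` by a policy mirror descent step
with the estimate `G` of the action values, up to the error `e` in the prox inequality; the last
field says that `π` itself came out of such a step. -/
structure IsInexactPolicyStep (γ : ℝ) (h : S → (A → ℝ) → ℝ) (η τ e : ℝ)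
    (G π v π' v' : S → A → ℝ) : Prop where
  pol : IsPolicy π
  center : IsPolicy v
  center_pos : ∀ s a, 0 < v s a
  pol' : IsPolicy π'
  center' : IsPolicy v'
  center'_pos : ∀ s a, 0 < v' s a
  subObjective_le : ∀ s, ∀ p ∈ stdSimplex ℝ A,
    subObjective h η τ G v s (π' s) - subObjective h η τ G v s p + 1 / γ * klDist p (v' s) ≤ e
  klDist_center_le : ∀ s, klDist (π s) (v s) ≤ γ * e

namespace IsInexactPolicyStep

variable {M : MDP S A} {h : S → (A → ℝ) → ℝ} {η τ e c : ℝ} {G π v π' v' πs : S → A → ℝ}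

lemma advantage_sub_advantage_le (hstep : IsInexactPolicyStep M.γ h η τ e G π v π' v')
    (hη : 0 < η) (hπs : IsPolicy πs) (s : S) :
    advantage M h τ π' π s - advantage M h τ πs π s
        + ∑ a, (G s a - Qval M h τ π s a) * (v s a - πs s a)
        + 1 / M.γ / η * klDist (πs s) (v' s)
      ≤ klDist (πs s) (v s) / η + (e / η + η * ‖G - Qval M h τ π‖ ^ 2 / 2) := by
  have hprox := hstep.subObjective_le s (πs s) (hπs s)
  have hγ := M.γ_pos
  have hnoise := neg_sq_mul_norm_le_sum_mul_add_klDist (G - Qval M h τ π) s (hstep.pol' s)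
    (hstep.center s) (hstep.center_pos s) hη.le
  simp only [subObjective, smoothPart, simplePart] at hprox
  simp only [Pi.sub_apply, mul_sub, sub_mul, Finset.sum_sub_distrib] at hnoise
  simp only [advantage, mul_sub, sub_mul, Finset.sum_sub_distrib]
  rw [← mul_le_mul_iff_right₀ hη]
  field_simp
  field_simp at hprox
  linear_combination 2 * hprox + 2 * M.γ * hnoise

lemma advantage_le (hstep : IsInexactPolicyStep M.γ h η τ e G π v π' v') (hη : 0 < η)
    (hc : ∀ s, ∑ a, |π s a - v s a| ≤ c) (s : S) :
    advantage M h τ π' π s ≤ (1 + M.γ) * e / η + η * ‖G - Qval M h τ π‖ ^ 2 / 2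
      + c * ‖G - Qval M h τ π‖ := by
  have hcompare := hstep.advantage_sub_advantage_le hη hstep.pol s
  have hself : advantage M h τ π π s = 0 := by
    simp only [advantage, sub_self, mul_zero, Finset.sum_const_zero, add_zero]
  have hdrop : 0 ≤ 1 / M.γ / η * klDist (π s) (v' s) :=
    mul_nonneg (div_nonneg (one_div_nonneg.2 M.γ_pos.le) hη.le)
      (klDist_nonneg (hstep.pol s) (hstep.center' s) (hstep.center'_pos s))
  have hcenter := div_le_div_of_nonneg_right (hstep.klDist_center_le s) hη.le
  have hnoise := neg_le_of_abs_le
    (abs_sum_mul_le_norm_mul_sum_abs (G - Qval M h τ π) s fun a => v s a - π s a)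
  simp only [Pi.sub_apply, abs_sub_comm (v s _)] at hnoise
  have hc' := mul_le_mul_of_nonneg_left (hc s) (norm_nonneg (G - Qval M h τ π))
  linear_combination hcompare + hdrop + hcenter + hnoise + hc' + hself

lemma value_sub_advantage_le (hstep : IsInexactPolicyStep M.γ h η τ e G π v π' v') (hη : 0 < η)
    (hc : ∀ s, ∑ a, |π s a - v s a| ≤ c) (hπs : IsPolicy πs) (s : S) :
    perturbedValue M h τ π' s - perturbedValue M h τ π s - advantage M h τ πs π s
        + ∑ a, (G s a - Qval M h τ π s a) * (v s a - πs s a)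
        + 1 / M.γ / η * klDist (πs s) (v' s)
      ≤ klDist (πs s) (v s) / η + (e / η + η / (2 * (1 - M.γ)) * ‖G - Qval M h τ π‖ ^ 2
        + M.γ / (1 - M.γ) * ((1 + M.γ) * e / η + c * ‖G - Qval M h τ π‖)) := by
  have hcompare := hstep.advantage_sub_advantage_le hη hπs s
  have hvalue := perturbedValue_sub_le_advantage_add M h τ hstep.pol' hstep.pol
    (hstep.advantage_le hη hc) s
  have hγ1 := sub_pos.2 M.γ_lt_one
  have hconst : e / η + η * ‖G - Qval M h τ π‖ ^ 2 / 2
      + M.γ * (((1 + M.γ) * e / η + η * ‖G - Qval M h τ π‖ ^ 2 / 2 + c * ‖G - Qval M h τ π‖)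
        / (1 - M.γ))
      = e / η + η / (2 * (1 - M.γ)) * ‖G - Qval M h τ π‖ ^ 2
        + M.γ / (1 - M.γ) * ((1 + M.γ) * e / η + c * ‖G - Qval M h τ π‖) := by
    field_simp
    ring
  linarith

lemma lyapunov_le {ν : S → ℝ} (hstep : IsInexactPolicyStep M.γ h η τ e G π v π' v')
    (hτ : 0 < τ) (hη : η = (1 - M.γ) / (M.γ * τ)) (hc : ∀ s, ∑ a, |π s a - v s a| ≤ c)
    (hπs : IsPolicy πs) (hν : IsStationaryDist M πs ν) :
    lyapunov M h ν πs τ π' v' ≤ M.γ * lyapunov M h ν πs τ π v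
      + (e / η + η / (2 * (1 - M.γ)) * ‖G - Qval M h τ π‖ ^ 2
        + M.γ / (1 - M.γ) * ((1 + M.γ) * e / η + c * ‖G - Qval M h τ π‖))
      - ∑ s, ν s * ∑ a, (G s a - Qval M h τ π s a) * (v s a - πs s a) := by
  have hγ := M.γ_pos
  have hγ1 := sub_pos.2 M.γ_lt_one
  have hη0 : 0 < η := by
    rw [hη]
    positivity
  have hsum := Finset.sum_le_sum fun s (_ : s ∈ Finset.univ) =>
    mul_le_mul_of_nonneg_left (hstep.value_sub_advantage_le hη0 hc hπs s) (hν.1.1 s)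
  have hperformance := hν.sum_mul_fixedPoint
    fun s => perturbedValue_sub_eq_advantage M h τ hπs hstep.pol s
  have hcoeff' : 1 / M.γ / η = τ / (1 - M.γ) := by
    rw [hη]
    field_simp
  have hcoeff : η⁻¹ = M.γ * (τ / (1 - M.γ)) := by
    rw [hη]
    field_simp
  simp only [hcoeff', div_eq_mul_inv (klDist _ _), hcoeff, mul_add, mul_sub, Finset.sum_add_distrib,
    Finset.sum_sub_distrib, ← Finset.sum_mul, hν.1.2, mul_left_comm (ν _) (τ / _),
    ← mul_assoc (ν _) (klDist _ _), ← Finset.mul_sum] at hsum hperformance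
  simp only [lyapunov, mul_sub, Finset.sum_sub_distrib]
  linarith

end IsInexactPolicyStep

end PolicyStep

section SapmdParameters

variable {γ L : ℝ} {n : ℕ}

lemma sapmdTau_pos (hγ : 0 < γ) (hn : 2 ≤ n) (k : ℕ) : 0 < sapmdTau γ n k := by
  have : 0 < Real.log n := Real.log_pos (by exact_mod_cast hn)
  unfold sapmdTau
  positivity

lemma sapmdEta_pos (hγ : 0 < γ) (hγ1 : γ < 1) (hn : 2 ≤ n) (k : ℕ) : 0 < sapmdEta γ n k :=
  div_pos (sub_pos.2 hγ1) (mul_pos hγ (sapmdTau_pos hγ hn k))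

lemma sapmdEta_mul_sapmdTau (hγ : 0 < γ) (hn : 2 ≤ n) (k : ℕ) :
    sapmdEta γ n k * sapmdTau γ n k = (1 - γ) / γ := by
  have := sapmdTau_pos hγ hn k
  unfold sapmdEta
  field_simp

lemma sapmdMu_eq (hγ : 0 < γ) (hn : 2 ≤ n) (k : ℕ) : sapmdMu γ n k = 1 / γ := by
  rw [sapmdMu, sapmdEta_mul_sapmdTau hγ hn]
  field_simp
  ring

lemma sapmdMu_pos (hγ : 0 < γ) (hn : 2 ≤ n) (k : ℕ) : 0 < sapmdMu γ n k := by
  rw [sapmdMu_eq hγ hn]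
  exact one_div_pos.2 hγ

lemma sapmdMu_lt_sapmdSmooth (hγ : 0 < γ) (hγ1 : γ < 1) (hn : 2 ≤ n) (hL : 0 < L) (k : ℕ) :
    sapmdMu γ n k < sapmdSmooth γ n L k :=
  lt_add_of_pos_left _ (mul_pos (sapmdEta_pos hγ hγ1 hn k) hL)

lemma sapmdAccuracy_pos (hγ : 0 < γ) (hγ1 : γ < 1) : 0 < sapmdAccuracy γ := by
  have := sub_pos.2 hγ1
  unfold sapmdAccuracy
  positivity

end SapmdParameters

/-- The iteration counts `T` for which every subproblem is solved to the prescribed accuracy. -/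
structure IsAccurateSchedule (γ : ℝ) (n : ℕ) (L : ℝ) (T : ℕ → ℕ) : Prop where
  one_le : ∀ k, 1 ≤ T k
  agdAccuracy_le : ∀ k,
    agdAccuracy (sapmdSmooth γ n L k) (sapmdMu γ n k) (T k) ≤ sapmdAccuracy γ

section SapmdRun

variable {S A : Type*} [Fintype A] {h : S → (A → ℝ) → ℝ}
  {dh : S → (A → ℝ) → (A → ℝ)} {L γ : ℝ} {T : ℕ → ℕ} {G : ℕ → S → A → ℝ}

/-- The state of the accelerated gradient method after `t` iterations in step `k`. -/
noncomputable def sapmdInner (γ : ℝ) (dh : S → (A → ℝ) → (A → ℝ)) (L : ℝ)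
    (T : ℕ → ℕ) (G : ℕ → S → A → ℝ) (k t : ℕ) : AGDState S A :=
  agdRun dh (sapmdEta γ (Fintype.card A) k) (sapmdTau γ (Fintype.card A) k) (G k)
    (sapmdRun γ dh L T G k).center (sapmdSmooth γ (Fintype.card A) L k)
    (sapmdMu γ (Fintype.card A) k) t

/-- The policy and the prox-center of a state of the method are policies, and the prox-center
charges every action, as the entropy prox-mapping requires. -/
structure SapmdState.Interior (z : SapmdState S A) : Prop where
  pol_mem : IsPolicy z.pol
  center_mem : IsPolicy z.center
  center_pos : ∀ s a, 0 < z.center s a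

variable (hA : 2 ≤ Fintype.card A) (hγ : 0 < γ) (hγ1 : γ < 1) (hL : 0 < L)
include hA hγ hγ1 hL

lemma sapmdInner_interior_of_center_pos {k : ℕ}
    (hv : ∀ s a, 0 < (sapmdRun γ dh L T G k).center s a) (t : ℕ) :
    (sapmdInner γ dh L T G k t).Interior := by
  have : Nonempty A := Fintype.card_pos_iff.1 (by omega)
  exact agdRun_interior (mul_pos (sapmdEta_pos hγ hγ1 hA k) (sapmdTau_pos hγ hA k)).le
    (sapmdMu_pos hγ hA k) (sapmdMu_lt_sapmdSmooth hγ hγ1 hA hL k) hv t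

lemma sapmdRun_interior (k : ℕ) : (sapmdRun γ dh L T G k).Interior := by
  have : Nonempty A := Fintype.card_pos_iff.1 (by omega)
  induction k with
  | zero =>
    exact ⟨fun _ => uniformDist_mem_stdSimplex, fun _ => uniformDist_mem_stdSimplex,
      fun _ => uniformDist_pos⟩
  | succ k ih =>
    have hinner := sapmdInner_interior_of_center_pos hA hγ hγ1 hL ih.center_pos (T k)
    exact ⟨hinner.y_mem, hinner.x_mem, hinner.x_pos⟩

lemma sapmdInner_interior (k t : ℕ) : (sapmdInner γ dh L T G k t).Interior :=
  sapmdInner_interior_of_center_pos hA hγ hγ1 hL (sapmdRun_interior hA hγ hγ1 hL k).center_pos t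

variable (hreg : IsSmoothConvexRegularizer h dh L)
  (hT : IsAccurateSchedule γ (Fintype.card A) L T)
include hreg hT

lemma subObjective_sapmdRun_le (k : ℕ) (s : S) {p : A → ℝ} (hp : p ∈ stdSimplex ℝ A) :
    subObjective h (sapmdEta γ (Fintype.card A) k) (sapmdTau γ (Fintype.card A) k) (G k)
          (sapmdRun γ dh L T G k).center s ((sapmdRun γ dh L T G (k + 1)).pol s)
        - subObjective h (sapmdEta γ (Fintype.card A) k) (sapmdTau γ (Fintype.card A) k) (G k)
          (sapmdRun γ dh L T G k).center s p
        + 1 / γ * klDist p ((sapmdRun γ dh L T G (k + 1)).center s)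
      ≤ sapmdAccuracy γ * Real.log (Fintype.card A) := by
  have : Nonempty A := Fintype.card_pos_iff.1 (by omega)
  have hη := sapmdEta_pos hγ hγ1 hA k
  obtain ⟨t, ht⟩ := Nat.exists_eq_add_of_le' (hT.one_le k)
  have hagd := subObjective_agdRun_le hreg hη.le (mul_pos hη (sapmdTau_pos hγ hA k)).le
    (μ := sapmdMu γ (Fintype.card A) k) rfl (sapmdMu_lt_sapmdSmooth hγ hγ1 hA hL k) le_rfl
    (G := G k) (sapmdRun_interior (dh := dh) (T := T) (G := G) hA hγ hγ1 hL k).center_pos s hp t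
  rw [← ht] at hagd
  rw [← sapmdMu_eq hγ hA k]
  exact hagd.trans (mul_le_mul (hT.agdAccuracy_le k) (klDist_uniformDist_le hp)
    (klDist_uniformDist_nonneg hp) (sapmdAccuracy_pos hγ hγ1).le)

lemma klDist_sapmdRun_pol_center_le (k : ℕ) (s : S) :
    klDist ((sapmdRun γ dh L T G k).pol s) ((sapmdRun γ dh L T G k).center s)
      ≤ γ * (sapmdAccuracy γ * Real.log (Fintype.card A)) := by
  have : Nonempty A := Fintype.card_pos_iff.1 (by omega)
  cases k with
  | zero =>
    have hlog : 0 ≤ Real.log (Fintype.card A) := Real.log_natCast_nonneg _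
    exact (klDist_self uniformDist_pos).trans_le
      (mul_nonneg hγ.le (mul_nonneg (sapmdAccuracy_pos hγ hγ1).le hlog))
  | succ k =>
    have hprox := subObjective_sapmdRun_le (G := G) hA hγ hγ1 hL hreg hT k s
      ((sapmdRun_interior (dh := dh) (T := T) (G := G) hA hγ hγ1 hL (k + 1)).pol_mem s)
    rwa [sub_self, zero_add, one_div, inv_mul_le_iff₀ hγ] at hprox

lemma sum_abs_sapmdRun_pol_sub_center_le (k : ℕ) (s : S) :
    ∑ a, |(sapmdRun γ dh L T G k).pol s a - (sapmdRun γ dh L T G k).center s a|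
      ≤ (1 - γ) * (√(Real.log (Fintype.card A)) / √γ) := by
  have hi := sapmdRun_interior (dh := dh) (T := T) (G := G) hA hγ hγ1 hL k
  have hpinsker := sq_sum_abs_sub_le_two_mul_klDist (hi.pol_mem s) (hi.center_mem s)
    (hi.center_pos s)
  have hkl := klDist_sapmdRun_pol_center_le (G := G) hA hγ hγ1 hL hreg hT k s
  have hγ1' := sub_pos.2 hγ1
  have hlog : 0 ≤ Real.log (Fintype.card A) := Real.log_natCast_nonneg _
  refine le_of_sq_le_sq ?_ (by positivity)
  calc _ ≤ 2 * (γ * (sapmdAccuracy γ * Real.log (Fintype.card A))) := by linarith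
    _ = (1 - γ) ^ 2 * (Real.log (Fintype.card A) / γ) / (1 + γ) := by
        unfold sapmdAccuracy
        field_simp
    _ ≤ (1 - γ) ^ 2 * (Real.log (Fintype.card A) / γ) :=
        div_le_self (by positivity) (by linarith)
    _ = _ := by rw [mul_pow, div_pow, Real.sq_sqrt hlog, Real.sq_sqrt hγ.le]

lemma sapmdRun_isInexactPolicyStep (k : ℕ) :
    IsInexactPolicyStep γ h (sapmdEta γ (Fintype.card A) k) (sapmdTau γ (Fintype.card A) k)
      (sapmdAccuracy γ * Real.log (Fintype.card A)) (G k)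
      (sapmdRun γ dh L T G k).pol (sapmdRun γ dh L T G k).center
      (sapmdRun γ dh L T G (k + 1)).pol (sapmdRun γ dh L T G (k + 1)).center where
  pol := (sapmdRun_interior hA hγ hγ1 hL k).pol_mem
  center := (sapmdRun_interior hA hγ hγ1 hL k).center_mem
  center_pos := (sapmdRun_interior hA hγ hγ1 hL k).center_pos
  pol' := (sapmdRun_interior hA hγ hγ1 hL (k + 1)).pol_mem
  center' := (sapmdRun_interior hA hγ hγ1 hL (k + 1)).center_mem
  center'_pos := (sapmdRun_interior hA hγ hγ1 hL (k + 1)).center_pos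
  subObjective_le s _ hp := subObjective_sapmdRun_le hA hγ hγ1 hL hreg hT k s hp
  klDist_center_le := klDist_sapmdRun_pol_center_le hA hγ hγ1 hL hreg hT k

end SapmdRun

section OneStep

/-- Evaluates the errors of `IsInexactPolicyStep.lyapunov_le` at the parameters of step `k`. -/
lemma sapmd_stepError_le {γ : ℝ} {n : ℕ} (hγ : 0 < γ) (hγ1 : γ < 1) (hlog : 0 < Real.log n)
    (k : ℕ) (N : ℝ) :
    sapmdAccuracy γ * Real.log n / sapmdEta γ n k + sapmdEta γ n k / (2 * (1 - γ)) * N ^ 2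
        + γ / (1 - γ) * ((1 + γ) * (sapmdAccuracy γ * Real.log n) / sapmdEta γ n k
          + (1 - γ) * (√(Real.log n) / √γ) * N)
      ≤ (1 / 2) ^ (k / epochLen γ) * (√(Real.log n) / √γ
          * ((1 - γ) / (4 * γ * (1 + γ)) + 1 / 4 + γ / 8))
        + 2 ^ (k / epochLen γ) * (√(Real.log n) / √γ) * (1 + 2 * γ) * N ^ 2 := by
  have hτ : sapmdTau γ n k = (1 / 2) ^ (k / epochLen γ) / (2 * (√γ * √(Real.log n))) := by
    rw [sapmdTau, Real.sqrt_mul hγ.le, pow_succ]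
    field_simp
  have htwo : (2 : ℝ) ^ (k / epochLen γ) = 1 / (1 / 2) ^ (k / epochLen γ) := by
    rw [one_div_pow, one_div_one_div]
  have hγ1' := sub_pos.2 hγ1
  have hu : (0 : ℝ) < (1 / 2) ^ (k / epochLen γ) := by positivity
  rw [sapmdEta, hτ, sapmdAccuracy, htwo]
  generalize (1 / 2 : ℝ) ^ (k / epochLen γ) = u at hu
  obtain ⟨s, hs, hs2⟩ : ∃ s, 0 < s ∧ Real.log n = s ^ 2 :=
    ⟨_, Real.sqrt_pos.2 hlog, (Real.sq_sqrt hlog.le).symm⟩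
  obtain ⟨g, hg, rfl⟩ : ∃ g, 0 < g ∧ γ = g ^ 2 :=
    ⟨_, Real.sqrt_pos.2 hγ, (Real.sq_sqrt hγ.le).symm⟩
  rw [hs2, Real.sqrt_sq hs.le, Real.sqrt_sq hg.le]
  have hyoung : N ≤ 2 * N ^ 2 / u + u / 8 := by
    have : 0 ≤ (4 * N - u) ^ 2 / (8 * u) := by positivity
    field_simp at this ⊢
    linarith
  rw [← sub_nonneg]
  refine (mul_nonneg (mul_pos hg hs).le (sub_nonneg.2 hyoung)).trans_eq ?_
  field_simp
  ring

variable {S A : Type*} [Fintype S] [Fintype A]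

/-- The error of the `k`-th estimate of the perturbed action-value function. -/
noncomputable def sapmdError (M : MDP S A) (h : S → (A → ℝ) → ℝ) (dh : S → (A → ℝ) → (A → ℝ))
    (L : ℝ) (T : ℕ → ℕ) (G : ℕ → S → A → ℝ) (k : ℕ) : S → A → ℝ :=
  G k - Qval M h (sapmdTau M.γ (Fintype.card A) k) (sapmdRun M.γ dh L T G k).pol

/-- The Lyapunov function of the `k`-th iterate, with the perturbation of step `i`: the
perturbation changes only at the end of an epoch, and there `i = k` and `i = k + 1` are compared. -/
noncomputable def sapmdLyapunov (M : MDP S A) (h : S → (A → ℝ) → ℝ) (dh : S → (A → ℝ) → (A → ℝ))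
    (L : ℝ) (T : ℕ → ℕ) (ν : S → ℝ) (πs : S → A → ℝ) (G : ℕ → S → A → ℝ) (i k : ℕ) : ℝ :=
  lyapunov M h ν πs (sapmdTau M.γ (Fintype.card A) i) (sapmdRun M.γ dh L T G k).pol
    (sapmdRun M.γ dh L T G k).center

variable {M : MDP S A} {h : S → (A → ℝ) → ℝ} {dh : S → (A → ℝ) → (A → ℝ)} {L : ℝ}
  {πs : S → A → ℝ} {ν : S → ℝ} {T : ℕ → ℕ}

lemma sapmdLyapunov_succ_le (hA : 2 ≤ Fintype.card A) (hL : 0 < L)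
    (hreg : IsSmoothConvexRegularizer h dh L) (hT : IsAccurateSchedule M.γ (Fintype.card A) L T)
    (hπs : IsPolicy πs) (hν : IsStationaryDist M πs ν) (G : ℕ → S → A → ℝ) (k : ℕ) :
    sapmdLyapunov M h dh L T ν πs G k (k + 1) ≤ M.γ * sapmdLyapunov M h dh L T ν πs G k k
      + (1 / 2) ^ (k / epochLen M.γ) * (√(Real.log (Fintype.card A)) / √M.γ
          * ((1 - M.γ) / (4 * M.γ * (1 + M.γ)) + 1 / 4 + M.γ / 8))
      + 2 ^ (k / epochLen M.γ) * (√(Real.log (Fintype.card A)) / √M.γ) * (1 + 2 * M.γ)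
          * ‖sapmdError M h dh L T G k‖ ^ 2
      - ∑ s, ν s * ∑ a, sapmdError M h dh L T G k s a
          * ((sapmdRun M.γ dh L T G k).center s a - πs s a) := by
  have hlog : 0 < Real.log (Fintype.card A) := Real.log_pos (by exact_mod_cast hA)
  have hcontract := (sapmdRun_isInexactPolicyStep (G := G) hA M.γ_pos M.γ_lt_one hL hreg hT
    k).lyapunov_le (sapmdTau_pos M.γ_pos hA k) rfl
    (sum_abs_sapmdRun_pol_sub_center_le hA M.γ_pos M.γ_lt_one hL hreg hT k) hπs hν
  have herror := sapmd_stepError_le M.γ_pos M.γ_lt_one hlog k ‖sapmdError M h dh L T G k‖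
  simp only [sapmdLyapunov, sapmdError, Pi.sub_apply] at herror ⊢
  linarith

end OneStep

section Measurability

variable {S A : Type*} [Fintype A] {h : S → (A → ℝ) → ℝ}
  {dh : S → (A → ℝ) → (A → ℝ)} {L γ : ℝ} {T : ℕ → ℕ} {Ω : Type*} {mΩ : MeasurableSpace Ω}

lemma measurable_comp_stdSimplex {f : (A → ℝ) → ℝ}
    (hf : ContinuousOn f (stdSimplex ℝ A)) {u : Ω → A → ℝ} (hu : ∀ a, Measurable fun ω => u ω a)
    (hm : ∀ ω, u ω ∈ stdSimplex ℝ A) : Measurable fun ω => f (u ω) :=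
  (continuousOn_iff_continuous_domRestrict.1 hf).measurable.comp
    ((measurable_pi_lambda u hu).subtype_mk (h := hm))

lemma measurable_klDist {u v : Ω → A → ℝ} (hu : ∀ a, Measurable fun ω => u ω a)
    (hv : ∀ a, Measurable fun ω => v ω a) : Measurable fun ω => klDist (u ω) (v ω) := by
  unfold klDist
  exact Finset.measurable_sum _ fun a _ => (hu a).mul (((hu a).div (hv a)).log)

lemma measurable_gibbs {c : Ω → A → ℝ} (hc : ∀ a, Measurable fun ω => c ω a) (β : ℝ) (a : A) :
    Measurable fun ω => gibbs β (c ω) a := by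
  have hexp : ∀ a, Measurable fun ω => Real.exp (-(c ω a / β)) := fun a =>
    (((hc a).div_const β).neg).exp
  exact (hexp a).div (Finset.measurable_sum _ fun b _ => hexp b)

lemma measurable_agdStep_x [Nonempty A] (hreg : IsSmoothConvexRegularizer h dh L) {η τ q r ρ : ℝ}
    (hητ : 0 ≤ η * τ) (hq : q ∈ Set.Icc 0 1) (hr : 0 < r) {G v : Ω → S → A → ℝ}
    {z : Ω → AGDState S A} (hv0 : ∀ ω s a, 0 < v ω s a) (hz : ∀ ω, (z ω).Interior)
    (hG : ∀ s a, Measurable fun ω => G ω s a) (hv : ∀ s a, Measurable fun ω => v ω s a)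
    (hx : ∀ s a, Measurable fun ω => (z ω).x s a) (hy : ∀ s a, Measurable fun ω => (z ω).y s a)
    (s : S) (a : A) :
    Measurable fun ω => (agdStep dh η τ (G ω) (v ω) q r ρ (z ω)).x s a := by
  simp only [fun ω => agdStep_x_eq_gibbs (dh := dh) (G := G ω) (q := q) (ρ := ρ) hητ hr (hv0 ω)
    (hz ω) s]
  refine measurable_gibbs (fun b => ?_) _ a
  have hgradient : Measurable fun ω =>
      dh s (fun a => (1 - q) * (z ω).y s a + q * (z ω).x s a) b :=
    measurable_comp_stdSimplex (hreg.continuousOn_gradient s b)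
      (fun a => ((hy s a).const_mul _).add ((hx s a).const_mul _))
      fun ω => convexComb_mem_stdSimplex ((hz ω).x_mem s) ((hz ω).y_mem s) hq.1 hq.2
  exact (((((hG s b).add hgradient).const_mul _).const_mul _).sub
    ((hv s b).log.const_mul _)).sub (hx s b).log

variable {G : ℕ → Ω → S → A → ℝ} (hA : 2 ≤ Fintype.card A) (hγ : 0 < γ) (hγ1 : γ < 1) (hL : 0 < L)
include hA hγ hγ1 hL

lemma measurable_sapmdInner (hreg : IsSmoothConvexRegularizer h dh L) {k : ℕ}
    (hG : ∀ s a, Measurable fun ω => G k ω s a)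
    (hv : ∀ s a, Measurable fun ω => (sapmdRun γ dh L T (G · ω) k).center s a) (t : ℕ) :
    (∀ s a, Measurable fun ω => (sapmdInner γ dh L T (G · ω) k t).x s a) ∧
      ∀ s a, Measurable fun ω => (sapmdInner γ dh L T (G · ω) k t).y s a := by
  induction t with
  | zero => exact ⟨fun _ _ => measurable_const, fun _ _ => measurable_const⟩
  | succ t ih =>
    have : Nonempty A := Fintype.card_pos_iff.1 (by omega)
    have hητ := (mul_pos (sapmdEta_pos hγ hγ1 hA k) (sapmdTau_pos hγ hA k)).le
    have hμ := sapmdMu_pos hγ hA k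
    have hμl := sapmdMu_lt_sapmdSmooth hγ hγ1 hA hL k
    have hx := measurable_agdStep_x hreg hητ (agdQ_mem_Icc hμ hμl t) (agdR_pos hμ hμl t)
      (ρ := agdRho (sapmdSmooth γ (Fintype.card A) L k) (sapmdMu γ (Fintype.card A) k) (t + 1))
      (fun ω => (sapmdRun_interior (dh := dh) (T := T) (G := (G · ω)) hA hγ hγ1 hL k).center_pos)
      (fun ω => sapmdInner_interior (dh := dh) (T := T) (G := (G · ω)) hA hγ hγ1 hL k t)
      hG hv ih.1 ih.2
    exact ⟨hx, fun s a => ((ih.2 s a).const_mul _).add ((hx s a).const_mul _)⟩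

lemma measurable_sapmdRun (hreg : IsSmoothConvexRegularizer h dh L) (k : ℕ)
    (hG : ∀ j < k, ∀ s a, Measurable fun ω => G j ω s a) :
    (∀ s a, Measurable fun ω => (sapmdRun γ dh L T (G · ω) k).pol s a) ∧
      ∀ s a, Measurable fun ω => (sapmdRun γ dh L T (G · ω) k).center s a := by
  induction k with
  | zero => exact ⟨fun _ _ => measurable_const, fun _ _ => measurable_const⟩
  | succ k ih =>
    have hcenter := (ih fun j hj => hG j (hj.trans k.lt_succ_self)).2
    exact (measurable_sapmdInner hA hγ hγ1 hL hreg (hG k k.lt_succ_self) hcenter (T k)).symm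

end Measurability

section MeasurableValues

variable {S A : Type*} [Fintype S] [Fintype A] (M : MDP S A) {h : S → (A → ℝ) → ℝ}
  {dh : S → (A → ℝ) → (A → ℝ)} {L : ℝ} {Ω : Type*} {mΩ : MeasurableSpace Ω} {π m : Ω → S → A → ℝ}

lemma measurable_stateActionLaw (hπ : ∀ s a, Measurable fun ω => π ω s a)
    (hm : ∀ s a, Measurable fun ω => m ω s a) (t : ℕ) (s : S) (a : A) :
    Measurable fun ω => stateActionLaw M (π ω) (m ω) t s a := by
  induction t generalizing s a with
  | zero => exact hm s a
  | succ t ih =>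
    exact (Finset.measurable_sum _ fun s' _ => Finset.measurable_sum _ fun a' _ =>
      (ih s' a').mul_const _).mul (hπ s a)

variable (hreg : IsSmoothConvexRegularizer h dh L) (τ : ℝ) (hp : ∀ ω, IsPolicy (π ω))
  (hπ : ∀ s a, Measurable fun ω => π ω s a)
include hreg hp hπ

lemma measurable_discountedCost (hm : ∀ s a, Measurable fun ω => m ω s a) :
    Measurable fun ω => discountedCost M h τ (π ω) (m ω) := by
  refine measurable_of_tendsto_metrizable (fun N => ?_) (tendsto_pi_nhds.2 fun ω =>
    (summable_discountedCost M h τ (hp ω) (m ω)).hasSum.tendsto_sum_nat)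
  refine Finset.measurable_sum _ fun t _ => Measurable.const_mul ?_ _
  refine Finset.measurable_sum _ fun s _ => Finset.measurable_sum _ fun a _ => ?_
  have hregularizer := measurable_comp_stdSimplex (hreg.continuousOn s) (hπ s) fun ω => hp ω s
  exact (measurable_stateActionLaw M hπ hm t s a).mul ((measurable_const.add hregularizer).add
    ((measurable_klDist (hπ s) fun _ => measurable_const).const_mul _))

lemma measurable_Qval (s : S) (a : A) : Measurable fun ω => Qval M h τ (π ω) s a :=
  measurable_discountedCost M hreg τ hp hπ fun _ _ => measurable_const

lemma measurable_perturbedValue (s : S) : Measurable fun ω => perturbedValue M h τ (π ω) s := by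
  simp only [perturbedValue_eq_sum_Qval M h τ (hp _)]
  exact Finset.measurable_sum _ fun a _ => (hπ s a).mul (measurable_Qval M hreg τ hp hπ s a)

end MeasurableValues

section ValueBounds

lemma abs_sum_mul_le_of_mem_stdSimplex {ι : Type*} [Fintype ι] {p f : ι → ℝ} {C : ℝ}
    (hp : p ∈ stdSimplex ℝ ι) (hf : ∀ i, |f i| ≤ C) : |∑ i, p i * f i| ≤ C := by
  calc |∑ i, p i * f i| ≤ ∑ i, |p i * f i| := Finset.abs_sum_le_sum_abs _ _
    _ ≤ ∑ i, p i * C := Finset.sum_le_sum fun i _ => by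
        rw [abs_mul, abs_of_nonneg (hp.1 i)]
        exact mul_le_mul_of_nonneg_left (hf i) (hp.1 i)
    _ = C := by rw [← Finset.sum_mul, hp.2, one_mul]

lemma IsSmoothConvexRegularizer.exists_abs_le {S A : Type*} [Finite S] [Fintype A]
    {h : S → (A → ℝ) → ℝ} {dh : S → (A → ℝ) → (A → ℝ)} {L : ℝ}
    (hreg : IsSmoothConvexRegularizer h dh L) :
    ∃ C, ∀ s, ∀ p ∈ stdSimplex ℝ A, |h s p| ≤ C := by
  choose C hC using fun s =>
    (isCompact_stdSimplex ℝ A).exists_bound_of_continuousOn (hreg.continuousOn s)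
  obtain ⟨D, hD⟩ := Finite.exists_le C
  exact ⟨D, fun s p hp => (hC s p hp).trans (hD s)⟩

variable {S A : Type*} [Fintype S] [Fintype A] (M : MDP S A) {h : S → (A → ℝ) → ℝ}
  {dh : S → (A → ℝ) → (A → ℝ)} {L R τ : ℝ} {π : S → A → ℝ}

lemma exists_abs_stageCost_le (hreg : IsSmoothConvexRegularizer h dh L) (τ : ℝ) :
    ∃ R, ∀ π, IsPolicy π → ∀ s a, |stageCost M h τ π s a| ≤ R := by
  obtain ⟨C, hC⟩ := hreg.exists_abs_le
  obtain ⟨D, hD⟩ := Finite.exists_le fun sa : S × A => |M.c sa.1 sa.2|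
  refine ⟨D + C + |τ| * Real.log (Fintype.card A), fun π hπ s a => ?_⟩
  have hpenalty : |τ * klDist (π s) (uniformDist A)| ≤ |τ| * Real.log (Fintype.card A) := by
    have : Nonempty A := ⟨a⟩
    rw [abs_mul, abs_of_nonneg (klDist_uniformDist_nonneg (hπ s))]
    exact mul_le_mul_of_nonneg_left (klDist_uniformDist_le (hπ s)) (abs_nonneg _)
  exact (abs_add_three _ _ _).trans
    (add_le_add (add_le_add (hD (s, a)) (hC s _ (hπ s))) hpenalty)

lemma abs_stateTransition_le (hπ : IsPolicy π) (U : S → ℝ) (s : S) :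
    |stateTransition M π U s| ≤ stateTransition M π (fun s => |U s|) s := by
  refine (Finset.abs_sum_le_sum_abs _ _).trans (Finset.sum_le_sum fun a _ => ?_)
  rw [abs_mul, abs_of_nonneg ((hπ s).1 a)]
  refine mul_le_mul_of_nonneg_left ?_ ((hπ s).1 a)
  refine (Finset.abs_sum_le_sum_abs _ _).trans_eq (Finset.sum_congr rfl fun s' _ => ?_)
  rw [abs_mul, abs_of_nonneg (M.P_nonneg s a s')]

variable (hπ : IsPolicy π) (hR : ∀ s a, |stageCost M h τ π s a| ≤ R)
include hπ hR

lemma abs_perturbedValue_le (s : S) : |perturbedValue M h τ π s| ≤ R / (1 - M.γ) := by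
  refine le_div_of_le_add_stateTransition M hπ (U := fun s => |perturbedValue M h τ π s|)
    (fun s => ?_) s
  rw [perturbedValue_bellman M h τ hπ s]
  refine (abs_add_le _ _).trans
    (add_le_add (abs_sum_mul_le_of_mem_stdSimplex (hπ s) (hR s)) ?_)
  rw [abs_mul, abs_of_pos M.γ_pos]
  exact mul_le_mul_of_nonneg_left (abs_stateTransition_le M hπ _ s) M.γ_pos.le

lemma abs_Qval_le (s : S) (a : A) : |Qval M h τ π s a| ≤ R / (1 - M.γ) := by
  have htransition := abs_sum_mul_le_of_mem_stdSimplex (p := M.P s a)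
    ⟨M.P_nonneg s a, M.P_sum s a⟩ (abs_perturbedValue_le M hπ hR)
  have hγ1 := sub_pos.2 M.γ_lt_one
  calc |Qval M h τ π s a| ≤ R + M.γ * (R / (1 - M.γ)) := by
        rw [Qval_bellman M h τ hπ]
        refine (abs_add_le _ _).trans (add_le_add (hR s a) ?_)
        rw [abs_mul, abs_of_pos M.γ_pos]
        exact mul_le_mul_of_nonneg_left htransition M.γ_pos.le
    _ = R / (1 - M.γ) := by
        field_simp
        ring

end ValueBounds

section ConditionalExpectation

open MeasureTheory

lemma abs_integral_mul_le_of_abs_condExp_le {Ω : Type*} {m mΩ : MeasurableSpace Ω} {μ : Measure Ω}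
    [IsFiniteMeasure μ] (hm : m ≤ mΩ) {f y : Ω → ℝ} {c D : ℝ} (hf : Integrable f μ)
    (hy : StronglyMeasurable[m] y) (hyD : ∀ ω, |y ω| ≤ D) (hc : ∀ᵐ ω ∂μ, |(μ[f | m]) ω| ≤ c) :
    |∫ ω, f ω * y ω ∂μ| ≤ c * ∫ ω, |y ω| ∂μ := by
  have hbound : ∀ᵐ ω ∂μ, ‖y ω‖ ≤ D := .of_forall hyD
  have hym := (hy.mono hm).aestronglyMeasurable (μ := μ)
  have hcond : ∫ ω, f ω * y ω ∂μ = ∫ ω, (μ[f | m]) ω * y ω ∂μ := by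
    rw [← integral_condExp hm]
    exact integral_congr_ae
      (condExp_mul_of_stronglyMeasurable_right hy (hf.mul_bdd hym hbound) hf)
  calc |∫ ω, f ω * y ω ∂μ| ≤ ∫ ω, |(μ[f | m]) ω * y ω| ∂μ :=
        hcond ▸ abs_integral_le_integral_abs
    _ ≤ ∫ ω, c * |y ω| ∂μ := by
        refine integral_mono_ae (integrable_condExp.mul_bdd hym hbound).abs
          ((Integrable.of_bound hym D hbound).abs.const_mul c) ?_
        filter_upwards [hc] with ω hω
        rw [abs_mul]
        exact mul_le_mul_of_nonneg_right hω (abs_nonneg _)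
    _ = c * ∫ ω, |y ω| ∂μ := integral_const_mul _ _

end ConditionalExpectation

section Simplex

variable {ι : Type*} [Fintype ι] {p q : ι → ℝ}

lemma abs_sub_le_one_of_mem_stdSimplex (hp : p ∈ stdSimplex ℝ ι) (hq : q ∈ stdSimplex ℝ ι)
    (i : ι) : |p i - q i| ≤ 1 := by
  have hp1 := (mem_Icc_of_mem_stdSimplex hp i)
  have hq1 := (mem_Icc_of_mem_stdSimplex hq i)
  rw [abs_le]
  constructor <;> linarith [hp1.1, hp1.2, hq1.1, hq1.2]

lemma sum_abs_sub_le_two_of_mem_stdSimplex (hp : p ∈ stdSimplex ℝ ι) (hq : q ∈ stdSimplex ℝ ι) :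
    ∑ i, |p i - q i| ≤ 2 := by
  calc ∑ i, |p i - q i| ≤ ∑ i, (p i + q i) := Finset.sum_le_sum fun i _ => by
        have hpi := hp.1 i
        have hqi := hq.1 i
        rw [abs_le]
        constructor <;> linarith
    _ = 2 := by
        rw [Finset.sum_add_distrib, hp.2, hq.2]
        norm_num

lemma sum_mul_sub_sum_mul_le_sum_abs (hp : p ∈ stdSimplex ℝ ι) (hq : q ∈ stdSimplex ℝ ι)
    (f : ι → ℝ) : ∑ i, f i * p i - ∑ i, f i * q i ≤ ∑ i, |f i| := by
  rw [← Finset.sum_sub_distrib]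
  refine Finset.sum_le_sum fun i _ => ?_
  rw [← mul_sub]
  refine (le_abs_self _).trans ?_
  rw [abs_mul]
  exact mul_le_of_le_one_right (abs_nonneg _) (abs_sub_le_one_of_mem_stdSimplex hp hq i)

end Simplex

section Integrability

open MeasureTheory

lemma klDist_sapmdRun_center_succ_le {S A : Type*} [Fintype A] {h : S → (A → ℝ) → ℝ}
    {dh : S → (A → ℝ) → (A → ℝ)} {L γ : ℝ} {T : ℕ → ℕ} {G : ℕ → S → A → ℝ}
    (hA : 2 ≤ Fintype.card A) (hγ : 0 < γ) (hγ1 : γ < 1) (hL : 0 < L)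
    (hreg : IsSmoothConvexRegularizer h dh L) (hT : IsAccurateSchedule γ (Fintype.card A) L T)
    (k : ℕ) {s : S} {C : ℝ} (hC : ∀ p ∈ stdSimplex ℝ A, |h s p| ≤ C) {p : A → ℝ}
    (hp : p ∈ stdSimplex ℝ A) :
    klDist p ((sapmdRun γ dh L T G (k + 1)).center s)
      ≤ γ * (sapmdAccuracy γ * Real.log (Fintype.card A)
        + sapmdEta γ (Fintype.card A) k * ((∑ a, |G k s a|)
          + (2 * C + sapmdTau γ (Fintype.card A) k * Real.log (Fintype.card A)))
        + klDist p ((sapmdRun γ dh L T G k).center s)) := by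
  have : Nonempty A := Fintype.card_pos_iff.1 (by omega)
  have hη := sapmdEta_pos hγ hγ1 hA k
  have hτ := sapmdTau_pos hγ hA k
  have hcenter := sapmdRun_interior (dh := dh) (T := T) (G := G) hA hγ hγ1 hL k
  set π' := (sapmdRun γ dh L T G (k + 1)).pol with hπ'_def
  have hπ' : π' s ∈ stdSimplex ℝ A := (sapmdRun_interior hA hγ hγ1 hL (k + 1)).pol_mem s
  have hprox := subObjective_sapmdRun_le (G := G) hA hγ hγ1 hL hreg hT k s hp
  rw [← hπ'_def] at hprox
  have hkl := klDist_nonneg hπ' (hcenter.center_mem s) (hcenter.center_pos s)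
  have hentropy : klDist p (uniformDist A) - klDist (π' s) (uniformDist A)
      ≤ Real.log (Fintype.card A) := by
    linarith [klDist_uniformDist_le hp, klDist_uniformDist_nonneg hπ']
  have hregularizer : h s p - h s (π' s) ≤ 2 * C := by
    linarith [(abs_le.1 (hC p hp)).2, (abs_le.1 (hC _ hπ')).1]
  have hcost := sum_mul_sub_sum_mul_le_sum_abs hp hπ' (G k s)
  have hgain := mul_le_mul_of_nonneg_left (add_le_add hcost
    (add_le_add hregularizer (mul_le_mul_of_nonneg_left hentropy hτ.le))) hη.le
  simp only [subObjective, smoothPart, simplePart] at hprox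
  rw [← inv_mul_le_iff₀ hγ, ← one_div]
  linarith

variable {S A : Type*} [Fintype A] {h : S → (A → ℝ) → ℝ} {dh : S → (A → ℝ) → (A → ℝ)} {L γ : ℝ}
  {T : ℕ → ℕ} {Ω : Type*} {mΩ : MeasurableSpace Ω} {ℙ : Measure Ω} {ℱ : Filtration ℕ mΩ}
  {G : ℕ → Ω → S → A → ℝ} (hA : 2 ≤ Fintype.card A) (hL : 0 < L)
  (hreg : IsSmoothConvexRegularizer h dh L)
  (hG : ∀ k s a, Measurable[ℱ (k + 1)] fun ω => G k ω s a)

include hA hL hreg hG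

lemma measurable_filtration_sapmdRun (hγ : 0 < γ) (hγ1 : γ < 1) (k : ℕ) :
    (∀ s a, Measurable[ℱ k] fun ω => (sapmdRun γ dh L T (G · ω) k).pol s a) ∧
      ∀ s a, Measurable[ℱ k] fun ω => (sapmdRun γ dh L T (G · ω) k).center s a :=
  measurable_sapmdRun (mΩ := ℱ k) hA hγ hγ1 hL hreg k
    fun j hj s a => (hG j s a).mono (ℱ.mono hj) le_rfl

lemma integrable_klDist_sapmdRun_center [IsFiniteMeasure ℙ] (hγ : 0 < γ) (hγ1 : γ < 1)
    (hG2 : ∀ k s a, MemLp (fun ω => G k ω s a) 2 ℙ)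
    (hT : IsAccurateSchedule γ (Fintype.card A) L T) {p : A → ℝ} (hp : p ∈ stdSimplex ℝ A)
    (k : ℕ) (s : S) :
    Integrable (fun ω => klDist p ((sapmdRun γ dh L T (G · ω) k).center s)) ℙ := by
  have : Nonempty A := Fintype.card_pos_iff.1 (by omega)
  obtain ⟨C, hC⟩ := (isCompact_stdSimplex ℝ A).exists_bound_of_continuousOn (hreg.continuousOn s)
  induction k with
  | zero => exact integrable_const (μ := ℙ) (klDist p (uniformPolicy S A s))
  | succ k ih =>
    have hcenter := (measurable_filtration_sapmdRun (T := T) hA hL hreg hG hγ hγ1 (k + 1)).2 s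
    have hestimate : Integrable (fun ω => ∑ a, |G k ω s a|) ℙ :=
      integrable_finsetSum _ fun a _ => ((hG2 k s a).integrable one_le_two).abs
    have hdominating := (((integrable_const (sapmdAccuracy γ * Real.log (Fintype.card A))).add
      ((hestimate.add (integrable_const (2 * C + sapmdTau γ (Fintype.card A) k
        * Real.log (Fintype.card A)))).const_mul (sapmdEta γ (Fintype.card A) k))).add
      ih).const_mul γ
    refine hdominating.mono' (measurable_klDist (fun a => measurable_const (a := p a))
      fun a => (hcenter a).mono (ℱ.le _) le_rfl).aestronglyMeasurable (.of_forall fun ω => ?_)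
    have hinterior := sapmdRun_interior (dh := dh) (T := T) (G := (G · ω)) hA hγ hγ1 hL (k + 1)
    rw [Real.norm_of_nonneg (klDist_nonneg hp (hinterior.center_mem s) (hinterior.center_pos s))]
    exact klDist_sapmdRun_center_succ_le hA hγ hγ1 hL hreg hT k hC hp

end Integrability

section IntegrableValues

open MeasureTheory

variable {S A : Type*} [Fintype S] [Fintype A] {M : MDP S A} {h : S → (A → ℝ) → ℝ}
  {dh : S → (A → ℝ) → (A → ℝ)} {L : ℝ} {πs : S → A → ℝ} {ν : S → ℝ} {T : ℕ → ℕ}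
  {Ω : Type*} {mΩ : MeasurableSpace Ω} {ℙ : Measure Ω} [IsFiniteMeasure ℙ] {ℱ : Filtration ℕ mΩ}
  {G : ℕ → Ω → S → A → ℝ} (hA : 2 ≤ Fintype.card A) (hL : 0 < L)
  (hreg : IsSmoothConvexRegularizer h dh L)
  (hG : ∀ k s a, Measurable[ℱ (k + 1)] fun ω => G k ω s a)
include hA hL hreg hG

lemma integrable_perturbedValue (τ : ℝ) (k : ℕ) (s : S) :
    Integrable (fun ω => perturbedValue M h τ (sapmdRun M.γ dh L T (G · ω) k).pol s) ℙ := by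
  have hpol := fun ω => (sapmdRun_interior (dh := dh) (T := T) (G := (G · ω))
    hA M.γ_pos M.γ_lt_one hL k).pol_mem
  have hadapted := (measurable_filtration_sapmdRun (T := T) hA hL hreg hG M.γ_pos M.γ_lt_one k).1
  obtain ⟨R, hR⟩ := exists_abs_stageCost_le M hreg τ
  exact .of_bound (measurable_perturbedValue M hreg τ hpol
    (fun s a => (hadapted s a).mono (ℱ.le k) le_rfl) s).aestronglyMeasurable (R / (1 - M.γ))
    (.of_forall fun ω => abs_perturbedValue_le M (hpol ω) (hR _ (hpol ω)) s)

lemma integrable_objective_sub (k : ℕ) : Integrable (fun ω =>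
    objective M h ν (sapmdRun M.γ dh L T (G · ω) k).pol - objective M h ν πs) ℙ :=
  (integrable_finsetSum _ fun s _ =>
    (integrable_perturbedValue hA hL hreg hG 0 k s).const_mul (ν s)).sub (integrable_const _)

lemma measurable_filtration_Qval_sapmdRun (τ : ℝ) (k : ℕ) (s : S) (a : A) :
    Measurable[ℱ k] fun ω => Qval M h τ (sapmdRun M.γ dh L T (G · ω) k).pol s a :=
  measurable_Qval (mΩ := ℱ k) M hreg τ
    (fun _ => (sapmdRun_interior hA M.γ_pos M.γ_lt_one hL k).pol_mem)
    (measurable_filtration_sapmdRun hA hL hreg hG M.γ_pos M.γ_lt_one k).1 s a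

lemma memLp_Qval_sapmdRun (τ : ℝ) (k : ℕ) (s : S) (a : A) :
    MemLp (fun ω => Qval M h τ (sapmdRun M.γ dh L T (G · ω) k).pol s a) 2 ℙ := by
  have hpol := fun ω => (sapmdRun_interior (dh := dh) (T := T) (G := (G · ω))
    hA M.γ_pos M.γ_lt_one hL k).pol_mem
  obtain ⟨R, hR⟩ := exists_abs_stageCost_le M hreg τ
  exact .of_bound ((measurable_filtration_Qval_sapmdRun hA hL hreg hG τ k s a).mono
    (ℱ.le k) le_rfl).aestronglyMeasurable (R / (1 - M.γ))
    (.of_forall fun ω => abs_Qval_le M (hpol ω) (hR _ (hpol ω)) s a)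

variable (hG2 : ∀ k s a, MemLp (fun ω => G k ω s a) 2 ℙ)
include hG2

lemma memLp_sapmdError (k : ℕ) : MemLp (fun ω => sapmdError M h dh L T (G · ω) k) 2 ℙ :=
  .of_eval fun s => .of_eval fun a => (hG2 k s a).sub (memLp_Qval_sapmdRun hA hL hreg hG _ k s a)

lemma integrable_sapmdLyapunov (hT : IsAccurateSchedule M.γ (Fintype.card A) L T)
    (hπs : IsPolicy πs) (i k : ℕ) :
    Integrable (fun ω => sapmdLyapunov M h dh L T ν πs (G · ω) i k) ℙ := by
  refine .add (integrable_finsetSum _ fun s _ => ?_)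
    (.const_mul (integrable_finsetSum _ fun s _ => ?_) _)
  · exact ((integrable_perturbedValue hA hL hreg hG _ k s).sub (integrable_const _)).const_mul _
  · exact (integrable_klDist_sapmdRun_center hA hL hreg hG M.γ_pos M.γ_lt_one hG2 hT
      (hπs s) k s).const_mul _

end IntegrableValues

section ExpectedStep

open MeasureTheory

/-- The sequence `G` of random estimates driving the SAPMD method is adapted to `ℱ`, with a shift
by one, and square integrable, and in step `k` its conditional bias and its conditional mean
squared error, given `ℱ k`, are at most `2^{-(⌊k/l⌋ + 2)}` and `4^{-(⌊k/l⌋ + 2)}`. -/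
structure IsActionValueOracle {S A : Type*} [Fintype S] [Fintype A] (M : MDP S A)
    (h : S → (A → ℝ) → ℝ) (dh : S → (A → ℝ) → (A → ℝ)) (L : ℝ) (T : ℕ → ℕ) {Ω : Type*}
    {mΩ : MeasurableSpace Ω} (ℙ : Measure Ω) (ℱ : Filtration ℕ mΩ) (G : ℕ → Ω → S → A → ℝ) :
    Prop where
  measurable : ∀ k s a, Measurable[ℱ (k + 1)] fun ω => G k ω s a
  memLp : ∀ k s a, MemLp (fun ω => G k ω s a) 2 ℙ
  abs_condExp_sub_le : ∀ k, ∀ᵐ ω ∂ℙ, ∀ s a,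
    |(ℙ[fun ω => G k ω s a | ℱ k]) ω - Qval M h (sapmdTau M.γ (Fintype.card A) k)
      (sapmdRun M.γ dh L T (G · ω) k).pol s a| ≤ (1 / 2 : ℝ) ^ (k / epochLen M.γ + 2)
  condExp_sq_norm_le : ∀ k, ∀ᵐ ω ∂ℙ,
    (ℙ[fun ω => ‖G k ω - Qval M h (sapmdTau M.γ (Fintype.card A) k)
      (sapmdRun M.γ dh L T (G · ω) k).pol‖ ^ 2 | ℱ k]) ω ≤ (1 / 4 : ℝ) ^ (k / epochLen M.γ + 2)

/-- The errors of step `k` raise the expected Lyapunov function by at most `2^{-⌊k/l⌋}` times this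
constant. -/
noncomputable def sapmdStepError (γ : ℝ) (n : ℕ) : ℝ :=
  √(Real.log n) / √γ * ((1 - γ) / (4 * γ * (1 + γ)) + 5 / 16 + γ / 4) + 1 / 2

variable {S A : Type*} [Fintype S] [Fintype A] {M : MDP S A} {h : S → (A → ℝ) → ℝ}
  {dh : S → (A → ℝ) → (A → ℝ)} {L : ℝ} {πs : S → A → ℝ} {ν : S → ℝ} {T : ℕ → ℕ}
  {Ω : Type*} {mΩ : MeasurableSpace Ω} {ℙ : Measure Ω} [IsProbabilityMeasure ℙ]
  {ℱ : Filtration ℕ mΩ} {G : ℕ → Ω → S → A → ℝ}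

namespace IsActionValueOracle

lemma integral_sq_norm_sapmdError_le (hG : IsActionValueOracle M h dh L T ℙ ℱ G) (k : ℕ) :
    ∫ ω, ‖sapmdError M h dh L T (G · ω) k‖ ^ 2 ∂ℙ ≤ (1 / 4) ^ (k / epochLen M.γ + 2) := by
  rw [← integral_condExp (ℱ.le k)]
  refine (integral_mono_ae integrable_condExp (integrable_const _)
    (hG.condExp_sq_norm_le k)).trans_eq ?_
  rw [integral_const, probReal_univ, one_smul]

variable (hG : IsActionValueOracle M h dh L T ℙ ℱ G) (hA : 2 ≤ Fintype.card A) (hL : 0 < L)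
  (hreg : IsSmoothConvexRegularizer h dh L)
include hG hA hL hreg

lemma abs_condExp_sapmdError_le (k : ℕ) (s : S) (a : A) :
    ∀ᵐ ω ∂ℙ, |(ℙ[fun ω => sapmdError M h dh L T (G · ω) k s a | ℱ k]) ω|
      ≤ (1 / 2) ^ (k / epochLen M.γ + 2) := by
  have hQ := (memLp_Qval_sapmdRun (M := M) (T := T) (ℙ := ℙ) hA hL hreg hG.measurable
    (sapmdTau M.γ (Fintype.card A) k) k s a).integrable one_le_two
  have hQm := measurable_filtration_Qval_sapmdRun (M := M) (T := T) hA hL hreg hG.measurable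
    (sapmdTau M.γ (Fintype.card A) k) k s a
  filter_upwards [condExp_sub ((hG.memLp k s a).integrable one_le_two) hQ (ℱ k),
    hG.abs_condExp_sub_le k] with ω hsub hbias
  rw [condExp_of_stronglyMeasurable (ℱ.le k) hQm.stronglyMeasurable hQ] at hsub
  exact (congrArg abs hsub).trans_le (hbias s a)

lemma integrable_sapmdError_mul (hπs : IsPolicy πs) (k : ℕ) (s : S) (a : A) :
    Integrable (fun ω => sapmdError M h dh L T (G · ω) k s a
      * ((sapmdRun M.γ dh L T (G · ω) k).center s a - πs s a)) ℙ := by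
  have hcenter := (measurable_filtration_sapmdRun (T := T) hA hL hreg hG.measurable
    M.γ_pos M.γ_lt_one k).2 s a
  have herror := (((memLp_sapmdError (M := M) (T := T) hA hL hreg hG.measurable hG.memLp k).eval
    s).eval a).integrable one_le_two
  refine herror.mul_bdd (c := 1) ((hcenter.mono (ℱ.le k) le_rfl).sub_const _).aestronglyMeasurable
    (.of_forall fun ω => ?_)
  exact abs_sub_le_one_of_mem_stdSimplex
    ((sapmdRun_interior hA M.γ_pos M.γ_lt_one hL k).center_mem s) (hπs s) a

lemma abs_integral_sum_sapmdError_mul_le (hπs : IsPolicy πs) (k : ℕ) (s : S) :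
    |∫ ω, ∑ a, sapmdError M h dh L T (G · ω) k s a
        * ((sapmdRun M.γ dh L T (G · ω) k).center s a - πs s a) ∂ℙ|
      ≤ (1 / 2) ^ (k / epochLen M.γ) / 2 := by
  have hcenter := (measurable_filtration_sapmdRun (T := T) hA hL hreg hG.measurable
    M.γ_pos M.γ_lt_one k).2 s
  have hmem := fun ω => (sapmdRun_interior (dh := dh) (T := T) (G := (G · ω))
    hA M.γ_pos M.γ_lt_one hL k).center_mem s
  have hbound := fun ω => abs_sub_le_one_of_mem_stdSimplex (hmem ω) (hπs s)
  have hdiff : ∀ a, Integrable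
      (fun ω => |(sapmdRun M.γ dh L T (G · ω) k).center s a - πs s a|) ℙ := fun a =>
    (Integrable.of_bound (((hcenter a).mono (ℱ.le k) le_rfl).sub_const _).aestronglyMeasurable 1
      (.of_forall fun ω => hbound ω a)).abs
  have hterm := fun a => abs_integral_mul_le_of_abs_condExp_le (ℱ.le k)
    ((((memLp_sapmdError hA hL hreg hG.measurable hG.memLp k).eval s).eval a).integrable
      one_le_two) ((hcenter a).sub_const (πs s a)).stronglyMeasurable (fun ω => hbound ω a)
    (hG.abs_condExp_sapmdError_le hA hL hreg k s a)
  rw [integral_finsetSum _ fun a _ => hG.integrable_sapmdError_mul hA hL hreg hπs k s a]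
  calc _ ≤ ∑ a, (1 / 2) ^ (k / epochLen M.γ + 2)
          * ∫ ω, |(sapmdRun M.γ dh L T (G · ω) k).center s a - πs s a| ∂ℙ :=
        (Finset.abs_sum_le_sum_abs _ _).trans (Finset.sum_le_sum fun a _ => hterm a)
    _ = (1 / 2) ^ (k / epochLen M.γ + 2)
          * ∫ ω, ∑ a, |(sapmdRun M.γ dh L T (G · ω) k).center s a - πs s a| ∂ℙ := by
        rw [← Finset.mul_sum, integral_finsetSum _ fun a _ => hdiff a]
    _ ≤ (1 / 2) ^ (k / epochLen M.γ + 2) * ∫ _, 2 ∂ℙ := by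
        refine mul_le_mul_of_nonneg_left ?_ (by positivity)
        exact integral_mono (integrable_finsetSum _ fun a _ => hdiff a) (integrable_const _)
          fun ω => sum_abs_sub_le_two_of_mem_stdSimplex (hmem ω) (hπs s)
    _ = (1 / 2) ^ (k / epochLen M.γ) / 2 := by
        rw [integral_const, probReal_univ, one_smul, pow_add]
        ring

lemma neg_integral_sapmdError_mul_le (hπs : IsPolicy πs) (hν : ν ∈ stdSimplex ℝ S) (k : ℕ) :
    -∫ ω, ∑ s, ν s * ∑ a, sapmdError M h dh L T (G · ω) k s a
        * ((sapmdRun M.γ dh L T (G · ω) k).center s a - πs s a) ∂ℙ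
      ≤ (1 / 2) ^ (k / epochLen M.γ) / 2 := by
  rw [integral_finsetSum _ fun s _ => (integrable_finsetSum _ fun a _ =>
    hG.integrable_sapmdError_mul hA hL hreg hπs k s a).const_mul (ν s)]
  simp only [integral_const_mul]
  exact (neg_le_abs _).trans (abs_sum_mul_le_of_mem_stdSimplex hν
    (hG.abs_integral_sum_sapmdError_mul_le hA hL hreg hπs k))

lemma integral_sapmdLyapunov_succ_le (hT : IsAccurateSchedule M.γ (Fintype.card A) L T)
    (hπs : IsPolicy πs) (hν : IsStationaryDist M πs ν) (k : ℕ) :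
    ∫ ω, sapmdLyapunov M h dh L T ν πs (G · ω) k (k + 1) ∂ℙ
      ≤ M.γ * ∫ ω, sapmdLyapunov M h dh L T ν πs (G · ω) k k ∂ℙ
      + (1 / 2) ^ (k / epochLen M.γ) * sapmdStepError M.γ (Fintype.card A) := by
  have hγ := M.γ_pos
  have hlyap := integrable_sapmdLyapunov (ν := ν) hA hL hreg hG.measurable hG.memLp hT hπs k
  have hsq := (memLp_sapmdError (M := M) (T := T) hA hL hreg hG.measurable hG.memLp
    k).integrable_norm_pow two_ne_zero
  have hcorr : Integrable (fun ω => ∑ s, ν s * ∑ a, sapmdError M h dh L T (G · ω) k s a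
      * ((sapmdRun M.γ dh L T (G · ω) k).center s a - πs s a)) ℙ :=
    integrable_finsetSum _ fun s _ => (integrable_finsetSum _ fun a _ =>
      hG.integrable_sapmdError_mul hA hL hreg hπs k s a).const_mul (ν s)
  have hmono := integral_mono (hlyap (k + 1)) (((((hlyap k).const_mul _).add
    (integrable_const _)).add (hsq.const_mul _)).sub hcorr)
    fun ω => sapmdLyapunov_succ_le hA hL hreg hT hπs hν (G · ω) k
  rw [integral_sub' (((hlyap k).const_mul _).add (integrable_const _) |>.add (hsq.const_mul _))
    hcorr, integral_add' (((hlyap k).const_mul _).add (integrable_const _)) (hsq.const_mul _),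
    integral_add' ((hlyap k).const_mul _) (integrable_const _), integral_const, probReal_univ,
    one_smul, integral_const_mul, integral_const_mul] at hmono
  have hbias := hG.neg_integral_sapmdError_mul_le hA hL hreg hπs hν.1 k
  have hvariance := mul_le_mul_of_nonneg_left (hG.integral_sq_norm_sapmdError_le k)
    (by positivity : 0 ≤ 2 ^ (k / epochLen M.γ) * (√(Real.log (Fintype.card A)) / √M.γ)
      * (1 + 2 * M.γ))
  have hpow : (2 : ℝ) ^ (k / epochLen M.γ) * (1 / 4) ^ (k / epochLen M.γ + 2)
      = (1 / 2) ^ (k / epochLen M.γ) / 16 := by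
    rw [pow_add, ← mul_assoc, ← mul_pow]
    norm_num
    ring
  rw [sapmdStepError]
  linear_combination hmono + hbias + hvariance
    + (√(Real.log (Fintype.card A)) / √M.γ * (1 + 2 * M.γ)) * hpow

end IsActionValueOracle

end ExpectedStep

section Epochs

lemma epochLen_pos {γ : ℝ} (hγ : 0 < γ) (hγ1 : γ < 1) : 0 < epochLen γ :=
  Nat.ceil_pos.2 (Real.logb_pos_of_base_lt_one hγ hγ1 (by norm_num) (by norm_num))

lemma pow_epochLen_le {γ : ℝ} (hγ : 0 < γ) (hγ1 : γ < 1) : γ ^ epochLen γ ≤ 1 / 4 := by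
  rw [← Real.rpow_natCast]
  calc γ ^ (epochLen γ : ℝ) ≤ γ ^ Real.logb γ (1 / 4) :=
        Real.rpow_le_rpow_of_exponent_ge hγ hγ1.le (Nat.le_ceil _)
    _ = 1 / 4 := Real.rpow_logb hγ hγ1.ne (by norm_num)

lemma mod_add_one_eq_of_dvd_add_one {k l : ℕ} (hd : l ∣ k + 1) : k % l + 1 = l := by
  obtain ⟨i, hi⟩ := hd
  obtain ⟨i, rfl⟩ := Nat.exists_eq_succ_of_ne_zero (by rintro rfl; simp at hi : i ≠ 0)
  have hl : 0 < l := Nat.pos_of_ne_zero (by rintro rfl; simp at hi)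
  have hk : k = l * i + (l - 1) := by
    rw [Nat.mul_succ] at hi
    omega
  rw [hk, Nat.mul_add_mod, Nat.mod_eq_of_lt (Nat.sub_lt hl Nat.one_pos), Nat.sub_add_cancel hl]

lemma add_one_mod_of_not_dvd {k l : ℕ} (hd : ¬l ∣ k + 1) : (k + 1) % l = k % l + 1 := by
  have hk := Nat.div_add_mod k l
  have hk' := Nat.div_add_mod (k + 1) l
  rw [Nat.succ_div_of_not_dvd hd] at hk'
  omega

variable {γ F b C : ℝ} {l : ℕ} (hγ : 0 < γ) (hpow : γ ^ l ≤ 1 / 4)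
  {w : ℕ → ℝ} (h0 : w 0 ≤ C) (hF : 0 ≤ F) (hb : 0 ≤ b) (hC : F + b / 2 ≤ C / 4)
  (hstep : ∀ k, w (k + 1) ≤ γ * w k + (1 / 2) ^ (k / l) * ((1 - γ) * F)
    + ((1 / 2) ^ (k / l) - (1 / 2) ^ ((k + 1) / l)) * b)
include hγ hpow h0 hF hb hC hstep

-- Inside an epoch `w` relaxes geometrically towards `F`; the switch to the next one costs `b / 2`.
lemma le_half_pow_mul_of_epoch_recursion_of_mod (k : ℕ) :
    w k ≤ (1 / 2) ^ (k / l) * (γ ^ (k % l) * C + (1 - γ ^ (k % l)) * F) := by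
  induction k with
  | zero => simpa using h0
  | succ k ih =>
    have hcontract := mul_le_mul_of_nonneg_left ih hγ.le
    have hnext := hstep k
    by_cases hd : l ∣ k + 1
    · have hγl : γ * γ ^ (k % l) = γ ^ l := by
        rw [← pow_succ', mod_add_one_eq_of_dvd_add_one hd]
      have hepoch : γ ^ l * C + (1 - γ ^ l) * F + b / 2 ≤ C / 2 := by
        have hγC := mul_le_mul_of_nonneg_right hpow (show 0 ≤ C by linarith)
        have hγF : 0 ≤ γ ^ l * F := by positivity
        linarith
      have hscaled := mul_le_mul_of_nonneg_left hepoch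
        (show (0 : ℝ) ≤ (1 / 2) ^ (k / l) by positivity)
      rw [Nat.succ_div_of_dvd hd, pow_succ] at hnext ⊢
      rw [Nat.mod_eq_zero_of_dvd hd, pow_zero]
      linear_combination hnext + hcontract + hscaled + (1 / 2) ^ (k / l) * (C - F) * hγl
    · rw [Nat.succ_div_of_not_dvd hd] at hnext ⊢
      rw [add_one_mod_of_not_dvd hd, pow_succ]
      linarith

lemma le_half_pow_mul_of_epoch_recursion (hγ1 : γ < 1) (k : ℕ) : w k ≤ (1 / 2) ^ (k / l) * C := by
  refine (le_half_pow_mul_of_epoch_recursion_of_mod hγ hpow h0 hF hb hC hstep k).trans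
    (mul_le_mul_of_nonneg_left ?_ (by positivity))
  have hle_one : γ ^ (k % l) ≤ 1 := pow_le_one₀ hγ.le hγ1.le
  have hFC := mul_le_mul_of_nonneg_left (show F ≤ C by linarith) (sub_nonneg.2 hle_one)
  linarith

end Epochs

section Comparison

variable {S A : Type*} [Fintype S] [Fintype A] {M : MDP S A} {h : S → (A → ℝ) → ℝ}
  {πs : S → A → ℝ} {ν : S → ℝ} {π v : S → A → ℝ}

lemma objective_sub_objective : objective M h ν π - objective M h ν πs
    = ∑ s, ν s * (perturbedValue M h 0 π s - perturbedValue M h 0 πs s) := by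
  simp only [objective, Vval_eq_perturbedValue, mul_sub, Finset.sum_sub_distrib]

lemma sum_mul_le_add_of_mem_stdSimplex (hν : ν ∈ stdSimplex ℝ S) {f g : S → ℝ} {C : ℝ}
    (hfg : ∀ s, f s ≤ g s + C) : ∑ s, ν s * f s ≤ ∑ s, ν s * g s + C := by
  calc ∑ s, ν s * f s ≤ ∑ s, ν s * (g s + C) :=
        Finset.sum_le_sum fun s _ => mul_le_mul_of_nonneg_left (hfg s) (hν.1 s)
    _ = _ := by simp only [mul_add, Finset.sum_add_distrib, ← Finset.sum_mul, hν.2, one_mul]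

variable [Nonempty A] (hν : ν ∈ stdSimplex ℝ S) (hπs : IsPolicy πs)
include hν hπs

lemma lyapunov_le_lyapunov_add (hπ : IsPolicy π) (hv : IsPolicy v) (hv0 : ∀ s a, 0 < v s a)
    {τ τ' : ℝ} (hτ : τ' ≤ τ) :
    lyapunov M h ν πs τ' π v
      ≤ lyapunov M h ν πs τ π v + (τ - τ') * Real.log (Fintype.card A) / (1 - M.γ) := by
  have hvalue := sum_mul_le_add_of_mem_stdSimplex hν
    (f := fun s => perturbedValue M h τ' π s - perturbedValue M h τ' πs s)
    (g := fun s => perturbedValue M h τ π s - perturbedValue M h τ πs s)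
    (C := (τ - τ') * Real.log (Fintype.card A) / (1 - M.γ)) fun s => by
      linarith [perturbedValue_mono M h hπ hτ s, perturbedValue_sub_perturbedValue_le M h hπs hτ s]
  have hdiv : 0 ≤ ∑ s, ν s * klDist (πs s) (v s) := Finset.sum_nonneg fun s _ =>
    mul_nonneg (hν.1 s) (klDist_nonneg (hπs s) (hv s) (hv0 s))
  have := mul_le_mul_of_nonneg_right
    (div_le_div_of_nonneg_right hτ (sub_pos.2 M.γ_lt_one).le) hdiv
  unfold lyapunov
  linarith

lemma objective_sub_objective_le (hπ : IsPolicy π) (hv : IsPolicy v) (hv0 : ∀ s a, 0 < v s a)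
    {τ : ℝ} (hτ : 0 ≤ τ) :
    objective M h ν π - objective M h ν πs
      ≤ lyapunov M h ν πs τ π v + τ * Real.log (Fintype.card A) / (1 - M.γ) := by
  have hzero := lyapunov_le_lyapunov_add (M := M) (h := h) hν hπs hπ hv hv0 hτ
  rw [sub_zero, lyapunov, zero_div, zero_mul, add_zero] at hzero
  rwa [objective_sub_objective]

lemma lyapunov_uniformPolicy_le {τ : ℝ} (hτ : 0 ≤ τ) :
    lyapunov M h ν πs τ (uniformPolicy S A) (uniformPolicy S A)
      ≤ objective M h ν (uniformPolicy S A) - objective M h ν πs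
        + 2 * (τ * Real.log (Fintype.card A)) / (1 - M.γ) := by
  have hu : IsPolicy (uniformPolicy S A) := fun _ => uniformDist_mem_stdSimplex
  have hvalue := sum_mul_le_add_of_mem_stdSimplex hν
    (f := fun s => perturbedValue M h τ (uniformPolicy S A) s - perturbedValue M h τ πs s)
    (g := fun s => perturbedValue M h 0 (uniformPolicy S A) s - perturbedValue M h 0 πs s)
    (C := (τ - 0) * Real.log (Fintype.card A) / (1 - M.γ)) fun s => by
      linarith [perturbedValue_mono M h hπs hτ s, perturbedValue_sub_perturbedValue_le M h hu hτ s]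
  have hdiv := sum_mul_le_add_of_mem_stdSimplex hν
    (f := fun s => klDist (πs s) (uniformPolicy S A s)) (g := fun _ => 0)
    fun s => (klDist_uniformDist_le (hπs s)).trans_eq (zero_add _).symm
  simp only [mul_zero, Finset.sum_const_zero, zero_add] at hdiv
  have := mul_le_mul_of_nonneg_left hdiv (div_nonneg hτ (sub_pos.2 M.γ_lt_one).le)
  rw [objective_sub_objective, lyapunov]
  linear_combination hvalue + this

end Comparison

section Rate

variable {γ : ℝ} {n : ℕ}

lemma sapmdTau_mul_log (hγ : 0 < γ) (hn : 2 ≤ n) (k : ℕ) :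
    sapmdTau γ n k * Real.log n = (1 / 2) ^ (k / epochLen γ) * (√(Real.log n) / √γ / 2) := by
  have hlog : 0 < Real.log n := Real.log_pos (by exact_mod_cast hn)
  rw [sapmdTau, Real.sqrt_mul hγ.le, pow_succ]
  nth_rewrite 2 [← Real.sq_sqrt hlog.le]
  field_simp

lemma sapmdTau_antitone : Antitone (sapmdTau γ n) := fun _ _ hij =>
  mul_le_mul_of_nonneg_left (pow_le_pow_of_le_one (by norm_num) (by norm_num)
    (Nat.add_le_add_right (Nat.div_le_div_right hij) 1)) (by positivity)

variable (hγ : 0 < γ) (hγ1 : γ < 1)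
include hγ hγ1

lemma sapmdStepError_nonneg : 0 ≤ sapmdStepError γ n := by
  have := sub_pos.2 hγ1
  unfold sapmdStepError
  positivity

lemma one_sub_div_add_le_max :
    (1 - γ) / (γ * (1 + γ)) + γ ≤ 1 / 4 + max 1 ((1 - γ) / γ) * (5 / 4) := by
  rcases le_total γ (1 / 2) with h | h
  · have hle : (1 - γ) / (γ * (1 + γ)) ≤ (1 - γ) / γ :=
      div_le_div_of_nonneg_left (by linarith) hγ (by nlinarith)
    have hone : 1 ≤ (1 - γ) / γ := by
      rw [le_div_iff₀ hγ]
      linarith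
    linarith [le_max_right 1 ((1 - γ) / γ)]
  · have hle : (1 - γ) / (γ * (1 + γ)) ≤ 4 / 3 * (1 - γ) := by
      rw [div_le_iff₀ (by positivity)]
      nlinarith [mul_nonneg (sub_nonneg.2 hγ1.le) (sub_nonneg.2 h),
        mul_nonneg (mul_nonneg (sub_nonneg.2 hγ1.le) (sub_nonneg.2 h)) hγ.le]
    linarith [le_max_left 1 ((1 - γ) / γ)]

lemma add_sapmdStepError_le_sapmdRateConst (Δ : ℝ) :
    Δ + (4 * sapmdStepError γ n + √(Real.log n) / √γ) / (1 - γ)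
        + √(Real.log n) / √γ / 2 / (1 - γ) ≤ sapmdRateConst γ n Δ := by
  have hmax := mul_le_mul_of_nonneg_left (one_sub_div_add_le_max hγ hγ1)
    (show 0 ≤ √(Real.log n) / √γ by positivity)
  have hquarter : (1 - γ) / (4 * γ * (1 + γ)) = (1 - γ) / (γ * (1 + γ)) / 4 := by field_simp
  rw [add_assoc, ← add_div, sapmdRateConst, one_div_mul_eq_div, sapmdStepError, hquarter]
  refine add_le_add_right (div_le_div_of_nonneg_right ?_ (sub_pos.2 hγ1).le) _
  linear_combination hmax + 5 / 2 * hγ1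

end Rate

section ExpectedRate

open MeasureTheory

variable {S A : Type*} [Fintype S] [Fintype A] {M : MDP S A} {h : S → (A → ℝ) → ℝ}
  {dh : S → (A → ℝ) → (A → ℝ)} {L : ℝ} {πs : S → A → ℝ} {ν : S → ℝ} {T : ℕ → ℕ}
  {Ω : Type*} {mΩ : MeasurableSpace Ω} {ℙ : Measure Ω} [IsProbabilityMeasure ℙ]
  {ℱ : Filtration ℕ mΩ} {G : ℕ → Ω → S → A → ℝ}

lemma sapmdLyapunov_zero_le (hA : 2 ≤ Fintype.card A) (hπs : IsPolicy πs)
    (hν : ν ∈ stdSimplex ℝ S) (G : ℕ → S → A → ℝ) :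
    sapmdLyapunov M h dh L T ν πs G 0 0
      ≤ objective M h ν (uniformPolicy S A) - objective M h ν πs
        + √(Real.log (Fintype.card A)) / √M.γ / (1 - M.γ) := by
  have : Nonempty A := Fintype.card_pos_iff.1 (by omega)
  refine (lyapunov_uniformPolicy_le hν hπs (sapmdTau_pos M.γ_pos hA 0).le).trans_eq ?_
  rw [sapmdTau_mul_log M.γ_pos hA, Nat.zero_div, pow_zero]
  ring

namespace IsActionValueOracle

variable (hG : IsActionValueOracle M h dh L T ℙ ℱ G) (hA : 2 ≤ Fintype.card A) (hL : 0 < L)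
  (hreg : IsSmoothConvexRegularizer h dh L) (hT : IsAccurateSchedule M.γ (Fintype.card A) L T)
  (hπs : IsPolicy πs)
include hG hA hL hreg hT hπs

lemma integral_sapmdLyapunov_succ_self_le (hν : IsStationaryDist M πs ν) (k : ℕ) :
    ∫ ω, sapmdLyapunov M h dh L T ν πs (G · ω) (k + 1) (k + 1) ∂ℙ
      ≤ M.γ * ∫ ω, sapmdLyapunov M h dh L T ν πs (G · ω) k k ∂ℙ
        + (1 / 2) ^ (k / epochLen M.γ) * sapmdStepError M.γ (Fintype.card A)
        + ((1 / 2) ^ (k / epochLen M.γ) - (1 / 2) ^ ((k + 1) / epochLen M.γ))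
          * (√(Real.log (Fintype.card A)) / √M.γ / 2 / (1 - M.γ)) := by
  have : Nonempty A := Fintype.card_pos_iff.1 (by omega)
  have hlyap := integrable_sapmdLyapunov (ν := ν) hA hL hreg hG.measurable hG.memLp hT hπs
  have hchange := integral_mono (hlyap (k + 1) (k + 1)) ((hlyap k (k + 1)).add (integrable_const _))
    fun ω =>
      have hi := sapmdRun_interior (dh := dh) (T := T) (G := (G · ω)) hA M.γ_pos M.γ_lt_one hL
        (k + 1)
      lyapunov_le_lyapunov_add hν.1 hπs hi.pol_mem hi.center_mem hi.center_pos
        (sapmdTau_antitone k.le_succ)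
  rw [integral_add' (hlyap k (k + 1)) (integrable_const _), integral_const, probReal_univ, one_smul,
    sub_mul, sapmdTau_mul_log M.γ_pos hA, sapmdTau_mul_log M.γ_pos hA] at hchange
  linear_combination hchange + hG.integral_sapmdLyapunov_succ_le hA hL hreg hT hπs hν k

lemma integral_sapmdLyapunov_self_le (hν : IsStationaryDist M πs ν)
    (hΔ : objective M h ν πs ≤ objective M h ν (uniformPolicy S A)) (k : ℕ) :
    ∫ ω, sapmdLyapunov M h dh L T ν πs (G · ω) k k ∂ℙ
      ≤ (1 / 2) ^ (k / epochLen M.γ)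
        * (objective M h ν (uniformPolicy S A) - objective M h ν πs
          + (4 * sapmdStepError M.γ (Fintype.card A)
            + √(Real.log (Fintype.card A)) / √M.γ) / (1 - M.γ)) := by
  have hγ1 := sub_pos.2 M.γ_lt_one
  have hE := sapmdStepError_nonneg (n := Fintype.card A) M.γ_pos M.γ_lt_one
  have hgap := sub_nonneg.2 hΔ
  refine le_half_pow_mul_of_epoch_recursion
    (w := fun k => ∫ ω, sapmdLyapunov M h dh L T ν πs (G · ω) k k ∂ℙ)
    M.γ_pos (pow_epochLen_le M.γ_pos M.γ_lt_one)
    (F := sapmdStepError M.γ (Fintype.card A) / (1 - M.γ)) ?_ (by positivity)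
    (b := √(Real.log (Fintype.card A)) / √M.γ / 2 / (1 - M.γ)) (by positivity) ?_ (fun k => ?_)
    M.γ_lt_one k
  · refine (integral_mono (integrable_sapmdLyapunov hA hL hreg hG.measurable hG.memLp hT hπs 0 0)
      (integrable_const _) fun ω => sapmdLyapunov_zero_le hA hπs hν.1 (G · ω)).trans ?_
    rw [integral_const, probReal_univ, one_smul]
    gcongr
    linarith
  · linear_combination hgap / 4
  · rw [mul_div_cancel₀ _ hγ1.ne']
    exact hG.integral_sapmdLyapunov_succ_self_le hA hL hreg hT hπs hν k

theorem integral_objective_sub_le (hν : IsStationaryDist M πs ν)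
    (hΔ : objective M h ν πs ≤ objective M h ν (uniformPolicy S A)) (k : ℕ) :
    ∫ ω, (objective M h ν (sapmdRun M.γ dh L T (G · ω) k).pol - objective M h ν πs) ∂ℙ
      ≤ (1 / 2) ^ (k / epochLen M.γ) * sapmdRateConst M.γ (Fintype.card A)
        (objective M h ν (uniformPolicy S A) - objective M h ν πs) := by
  have : Nonempty A := Fintype.card_pos_iff.1 (by omega)
  have hlyap := integrable_sapmdLyapunov (ν := ν) hA hL hreg hG.measurable hG.memLp hT hπs k k
  have hobj := integral_mono (integrable_objective_sub hA hL hreg hG.measurable k)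
    (hlyap.add (integrable_const _)) fun ω =>
      have hi := sapmdRun_interior (dh := dh) (T := T) (G := (G · ω)) hA M.γ_pos M.γ_lt_one hL k
      objective_sub_objective_le hν.1 hπs hi.pol_mem hi.center_mem hi.center_pos
        (sapmdTau_pos M.γ_pos hA k).le
  rw [integral_add' hlyap (integrable_const _), integral_const, probReal_univ, one_smul,
    sapmdTau_mul_log M.γ_pos hA] at hobj
  have hconst := mul_le_mul_of_nonneg_left
    (add_sapmdStepError_le_sapmdRateConst (n := Fintype.card A) M.γ_pos M.γ_lt_one
      (objective M h ν (uniformPolicy S A) - objective M h ν πs))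
    (show (0 : ℝ) ≤ (1 / 2) ^ (k / epochLen M.γ) by positivity)
  linear_combination hobj + hG.integral_sapmdLyapunov_self_le hA hL hreg hT hπs hν hΔ k + hconst

end IsActionValueOracle

end ExpectedRate

section GradientCalls

variable {S A : Type*} [Fintype A]

lemma agdRun_gradCalls (dh : S → (A → ℝ) → (A → ℝ)) (η τ : ℝ) (G v : S → A → ℝ) (l μ : ℝ)
    (t : ℕ) : (agdRun dh η τ G v l μ t).gradCalls = t := by
  induction t with
  | zero => rfl
  | succ t ih => simp only [agdRun, agdStep, ih]

lemma sapmdRun_gradCalls (γ : ℝ) (dh : S → (A → ℝ) → (A → ℝ)) (L : ℝ) (T : ℕ → ℕ)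
    (G : ℕ → S → A → ℝ) (K : ℕ) :
    (sapmdRun γ dh L T G K).gradCalls = ∑ k ∈ Finset.range K, T k := by
  induction K with
  | zero => rfl
  | succ K ih => simp only [sapmdRun, agdRun_gradCalls, Finset.sum_range_succ, ih]

end GradientCalls

section InnerIterations

lemma one_sub_pow_ceil_le_inv {w X : ℝ} (hw0 : 0 < w) (hw1 : w ≤ 1) (hX : 0 < X) :
    (1 - w) ^ ⌈Real.log X / w⌉₊ ≤ X⁻¹ :=
  calc (1 - w) ^ ⌈Real.log X / w⌉₊
      ≤ Real.exp (-w) ^ ⌈Real.log X / w⌉₊ :=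
        pow_le_pow_left₀ (sub_nonneg.2 hw1) (Real.one_sub_le_exp_neg w) _
    _ = Real.exp (-(⌈Real.log X / w⌉₊ * w)) := by rw [← Real.exp_nat_mul, mul_neg]
    _ ≤ Real.exp (-Real.log X) :=
        Real.exp_le_exp.2 (neg_le_neg ((div_le_iff₀ hw0).1 (Nat.le_ceil _)))
    _ = X⁻¹ := by rw [Real.exp_neg, Real.exp_log hX]

variable {l μ a : ℝ} {T : ℕ}

lemma agdAccuracy_ceil_log_succ_le (hμ : 0 < μ) (hl : μ < l) (ha : 0 < a) {X : ℝ} (hX0 : 0 < X)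
    (hX : 2 * l / a ≤ X) : agdAccuracy l μ (⌈Real.log X / √(μ / l)⌉₊ + 1) ≤ a := by
  have hl0 := hμ.trans hl
  rw [agdAccuracy_succ]
  calc 2 * l * min ((1 - √(μ / l)) ^ ⌈Real.log X / √(μ / l)⌉₊) _
      ≤ 2 * l * X⁻¹ := by
        gcongr
        exact (min_le_left _ _).trans
          (one_sub_pow_ceil_le_inv (sqrt_div_pos hμ hl) (sqrt_div_lt_one hμ hl).le hX0)
    _ ≤ a := by
        rw [← div_eq_mul_inv, div_le_iff₀ hX0]
        exact (div_le_iff₀' ha).1 hX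

lemma agdAccuracy_ceil_sqrt_le (hl : 0 < l) (ha : 0 < a) (μ : ℝ) :
    agdAccuracy l μ ⌈√(4 * l / a)⌉₊ ≤ a := by
  have _ : 0 < √(4 * l / a) := Real.sqrt_pos.2 (by positivity)
  calc 2 * l * min _ (2 / ((⌈√(4 * l / a)⌉₊ : ℝ) * (⌈√(4 * l / a)⌉₊ + 1)))
      ≤ 2 * l * (2 / (√(4 * l / a) * √(4 * l / a))) := by
        gcongr
        refine (min_le_right _ _).trans ?_
        have hceil := Nat.le_ceil √(4 * l / a)
        gcongr
        linarith
    _ = a := by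
        rw [Real.mul_self_sqrt (by positivity)]
        field_simp
        norm_num

lemma agd_iterations_le_log (hμ : 0 < μ) (hl : μ < l) (ha : 0 < a)
    (hT : IsLeast {t : ℕ | 1 ≤ t ∧ agdAccuracy l μ t ≤ a} T) {X : ℝ} (hX : 2 * l / a ≤ X)
    (hX1 : 1 ≤ X) : (T : ℝ) ≤ 2 + √(l / μ) * Real.log X := by
  have hle : T ≤ ⌈Real.log X / √(μ / l)⌉₊ + 1 :=
    hT.2 ⟨Nat.le_add_left 1 _, agdAccuracy_ceil_log_succ_le hμ hl ha (by linarith) hX⟩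
  have hceil := Nat.ceil_lt_add_one
    (div_nonneg (Real.log_nonneg hX1) (Real.sqrt_nonneg (μ / l)))
  calc (T : ℝ) ≤ ⌈Real.log X / √(μ / l)⌉₊ + 1 := by exact_mod_cast hle
    _ ≤ 2 + Real.log X / √(μ / l) := by linarith
    _ = 2 + √(l / μ) * Real.log X := by
        rw [← inv_div l μ, Real.sqrt_inv, div_inv_eq_mul, mul_comm (Real.log X)]

lemma agd_iterations_le_sqrt (hl : 0 < l) (ha : 0 < a)
    (hT : IsLeast {t : ℕ | 1 ≤ t ∧ agdAccuracy l μ t ≤ a} T) : (T : ℝ) ≤ 1 + √(4 * l / a) := by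
  have hy : 0 < √(4 * l / a) := Real.sqrt_pos.2 (by positivity)
  have hle : (T : ℝ) ≤ ⌈√(4 * l / a)⌉₊ :=
    Nat.cast_le.2 (hT.2 ⟨Nat.ceil_pos.2 hy, agdAccuracy_ceil_sqrt_le hl ha μ⟩)
  linarith [Nat.ceil_lt_add_one hy.le]

end InnerIterations

section SapmdIterations

/-- The iteration counts `T` that stop the inner method as soon as the prescribed accuracy is
guaranteed. -/
def IsMinimalSchedule (γ : ℝ) (n : ℕ) (L : ℝ) (T : ℕ → ℕ) : Prop :=
  ∀ k, IsLeast {t : ℕ | 1 ≤ t ∧ agdAccuracy (sapmdSmooth γ n L k) (sapmdMu γ n k) t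
    ≤ sapmdAccuracy γ} (T k)

lemma sqrt_one_add_mul_two_pow_le {c : ℝ} (hc : 0 ≤ c) (i : ℕ) :
    √(1 + c * 2 ^ i) ≤ 1 + √c * √2 ^ i := by
  have hpow : √((2 : ℝ) ^ i) = √2 ^ i := by
    rw [Real.sqrt_eq_iff_mul_self_eq (by positivity) (by positivity), ← mul_pow,
      Real.mul_self_sqrt zero_le_two]
  rw [Real.sqrt_le_iff, ← hpow, ← Real.sqrt_mul hc, add_sq, Real.sq_sqrt (by positivity)]
  have hroot := Real.sqrt_nonneg (c * 2 ^ i)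
  constructor <;> linarith

variable {γ L : ℝ} {n : ℕ} {T : ℕ → ℕ} (hγ : 0 < γ) (hγ1 : γ < 1) (hn : 2 ≤ n)

include hγ hn in
lemma sapmdSmooth_eq (k : ℕ) : sapmdSmooth γ n L k
    = (1 + (1 - γ) * L * √(γ * Real.log n) * 2 ^ (k / epochLen γ + 1)) / γ := by
  have hlog : 0 < Real.log n := Real.log_pos (by exact_mod_cast hn)
  have _ : 0 < √(γ * Real.log n) := Real.sqrt_pos.2 (mul_pos hγ hlog)
  rw [sapmdSmooth, sapmdMu_eq hγ hn, sapmdEta, sapmdTau, one_div_pow]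
  field_simp
  ring

include hγ hn in
lemma sapmdSmooth_div_sapmdMu (k : ℕ) : sapmdSmooth γ n L k / sapmdMu γ n k
    = 1 + (1 - γ) * L * √(γ * Real.log n) * 2 ^ (k / epochLen γ + 1) := by
  rw [sapmdSmooth_eq hγ hn, sapmdMu_eq hγ hn]
  field_simp

variable (hL : 0 < L)
include hγ hγ1 hn hL

lemma two_mul_sapmdSmooth_div_sapmdAccuracy_le (k : ℕ) :
    2 * sapmdSmooth γ n L k / sapmdAccuracy γ
      ≤ 8 / (1 - γ) * L * √(Real.log n) * 2 ^ (k / epochLen γ + 1) + 8 / (1 - γ) ^ 2 := by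
  have hγ1' := sub_pos.2 hγ1
  have hcoef : 4 * γ * (1 + γ) ≤ 8 := by nlinarith
  have hroot : √(γ * Real.log n) ≤ √(Real.log n) :=
    Real.sqrt_le_sqrt (mul_le_of_le_one_left (Real.log_natCast_nonneg n) hγ1.le)
  calc 2 * sapmdSmooth γ n L k / sapmdAccuracy γ
      = 4 * γ * (1 + γ) * (1 / (1 - γ) * L * √(γ * Real.log n) * 2 ^ (k / epochLen γ + 1)
          + 1 / (1 - γ) ^ 2) := by
        rw [sapmdSmooth_eq hγ hn, sapmdAccuracy]
        field_simp
        ring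
    _ ≤ 8 * (1 / (1 - γ) * L * √(Real.log n) * 2 ^ (k / epochLen γ + 1)
          + 1 / (1 - γ) ^ 2) := by gcongr
    _ = _ := by ring

lemma sqrt_four_mul_sapmdSmooth_div_sapmdAccuracy_le (k : ℕ) :
    √(4 * sapmdSmooth γ n L k / sapmdAccuracy γ) ≤ (3 + γ) / (1 - γ)
      * (1 + √((1 - γ) * L * √(γ * Real.log n)) * √2 ^ (k / epochLen γ + 1)) := by
  have hγ1' := sub_pos.2 hγ1
  have hratio : 4 * sapmdSmooth γ n L k / sapmdAccuracy γ = 8 * γ * (1 + γ) / (1 - γ) ^ 2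
      * (1 + (1 - γ) * L * √(γ * Real.log n) * 2 ^ (k / epochLen γ + 1)) := by
    rw [sapmdSmooth_eq hγ hn, sapmdAccuracy]
    field_simp
    ring
  have hcoef : √(8 * γ * (1 + γ)) ≤ 3 + γ := by
    rw [Real.sqrt_le_left (by linarith)]
    nlinarith [mul_nonneg hγ1'.le hγ.le]
  rw [hratio, Real.sqrt_mul (by positivity), Real.sqrt_div (by positivity),
    Real.sqrt_sq hγ1'.le]
  gcongr
  exact sqrt_one_add_mul_two_pow_le (by positivity) _

variable (hT : IsMinimalSchedule γ n L T)
include hT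

lemma sapmd_iterations_le_log {k : ℕ} {X : ℝ} (hX1 : 1 ≤ X)
    (hX : 8 / (1 - γ) * L * √(Real.log n) * 2 ^ (k / epochLen γ + 1) + 8 / (1 - γ) ^ 2 ≤ X) :
    (T k : ℝ) ≤ (2 + Real.log X)
      * (1 + √((1 - γ) * L * √(γ * Real.log n)) * √2 ^ (k / epochLen γ + 1)) := by
  have _ := sub_pos.2 hγ1
  have hinner := agd_iterations_le_log (sapmdMu_pos hγ hn k)
    (sapmdMu_lt_sapmdSmooth hγ hγ1 hn hL k) (sapmdAccuracy_pos hγ hγ1) (hT k)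
    ((two_mul_sapmdSmooth_div_sapmdAccuracy_le hγ hγ1 hn hL k).trans hX) hX1
  rw [sapmdSmooth_div_sapmdMu hγ hn] at hinner
  have hroot := sqrt_one_add_mul_two_pow_le
    (c := (1 - γ) * L * √(γ * Real.log n)) (by positivity) (k / epochLen γ + 1)
  have hlogX := Real.log_nonneg hX1
  calc (T k : ℝ) ≤ 2 * 1 + _ * Real.log X := by rwa [mul_one]
    _ ≤ 2 * (1 + √((1 - γ) * L * √(γ * Real.log n)) * √2 ^ (k / epochLen γ + 1))
        + (1 + √((1 - γ) * L * √(γ * Real.log n)) * √2 ^ (k / epochLen γ + 1))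
          * Real.log X := by
      gcongr
      exact le_add_of_nonneg_right (by positivity)
    _ = _ := by ring

lemma sapmd_iterations_le_sqrt (k : ℕ) :
    (T k : ℝ) ≤ 4 / (1 - γ)
      * (1 + √((1 - γ) * L * √(γ * Real.log n)) * √2 ^ (k / epochLen γ + 1)) := by
  have hγ1' := sub_pos.2 hγ1
  have hsmooth := (sapmdMu_pos hγ hn k).trans (sapmdMu_lt_sapmdSmooth hγ hγ1 hn hL k)
  have hinner := agd_iterations_le_sqrt hsmooth (sapmdAccuracy_pos hγ hγ1) (hT k)
  have hroot := sqrt_four_mul_sapmdSmooth_div_sapmdAccuracy_le hγ hγ1 hn hL k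
  have hnonneg : 0 ≤ √((1 - γ) * L * √(γ * Real.log n)) * √2 ^ (k / epochLen γ + 1) := by
    positivity
  have hsplit : 4 / (1 - γ) = 1 + (3 + γ) / (1 - γ) := by
    field_simp
    ring
  rw [hsplit]
  linarith

end SapmdIterations

section EpochSums

lemma sum_range_mul_div {N : Type*} [AddCommMonoid N] (f : ℕ → N) {l : ℕ} (hl : 0 < l) (I : ℕ) :
    ∑ k ∈ Finset.range (l * I), f (k / l) = l • ∑ i ∈ Finset.range I, f i := by
  induction I with
  | zero => simp only [mul_zero, Finset.range_zero, Finset.sum_empty, smul_zero]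
  | succ I ih =>
    have hlast : ∀ j ∈ Finset.range l, f ((l * I + j) / l) = f I := fun j hj => by
      rw [Nat.mul_add_div hl, Nat.div_eq_of_lt (Finset.mem_range.1 hj), add_zero]
    rw [mul_add_one, Finset.sum_range_add, ih, Finset.sum_congr rfl hlast, Finset.sum_const,
      Finset.card_range, Finset.sum_range_succ, smul_add]

lemma sum_sqrt_two_pow_le (I : ℕ) :
    ∑ i ∈ Finset.range I, √2 ^ (i + 1) ≤ (2 + √2) * √2 ^ I := by
  induction I with
  | zero =>
    rw [Finset.range_zero, Finset.sum_empty]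
    positivity
  | succ I ih =>
    rw [Finset.sum_range_succ]
    refine (add_le_add_left ih _).trans_eq ?_
    rw [pow_succ]
    linear_combination (-√2 ^ I) * Real.mul_self_sqrt zero_le_two

lemma sum_sqrt_two_pow_le_five_mul_sqrt {r : ℝ} {I : ℕ} (hI : (2 : ℝ) ^ I ≤ 2 * r) :
    ∑ i ∈ Finset.range I, √2 ^ (i + 1) ≤ 5 * √r := by
  have hsq : √2 * √2 = (2 : ℝ) := Real.mul_self_sqrt zero_le_two
  have hsqrt : √2 ≤ 3 / 2 := by
    rw [Real.sqrt_le_left (by norm_num)]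
    norm_num
  have hpow : √2 ^ I ≤ √2 * √r := by
    rw [← Real.sqrt_mul zero_le_two]
    refine Real.le_sqrt_of_sq_le ?_
    rwa [pow_right_comm, Real.sq_sqrt zero_le_two]
  calc ∑ i ∈ Finset.range I, √2 ^ (i + 1)
      ≤ (2 + √2) * (√2 * √r) :=
        (sum_sqrt_two_pow_le I).trans (mul_le_mul_of_nonneg_left hpow (by positivity))
    _ = (2 * √2 + √2 * √2) * √r := by ring
    _ ≤ 5 * √r := by
        gcongr
        linarith

lemma natCast_le_logb_two {r : ℝ} {I : ℕ} (hI : (2 : ℝ) ^ I ≤ r) : (I : ℝ) ≤ Real.logb 2 r := by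
  rwa [Real.le_logb_iff_rpow_le one_lt_two (lt_of_lt_of_le (by positivity) hI),
    Real.rpow_natCast]

lemma exists_le_two_pow_le_two_mul {r : ℝ} (hr : 1 ≤ r) :
    ∃ I : ℕ, r ≤ 2 ^ I ∧ (2 : ℝ) ^ I ≤ 2 * r := by
  obtain ⟨i, hle, hlt⟩ := exists_nat_pow_near hr one_lt_two
  exact ⟨i + 1, hlt.le, by rw [pow_succ']; linarith⟩

lemma half_pow_mul_le_of_div_le_two_pow {B ε : ℝ} (hε : 0 < ε) (hB : 0 ≤ B) {I m : ℕ}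
    (hI : B / ε ≤ 2 ^ I) (hm : I ≤ m) : (1 / 2 : ℝ) ^ m * B ≤ ε :=
  calc (1 / 2 : ℝ) ^ m * B ≤ (1 / 2) ^ I * B :=
        mul_le_mul_of_nonneg_right (pow_le_pow_of_le_one (by norm_num) (by norm_num) hm) hB
    _ ≤ ε := by
        rw [one_div_pow, one_div_mul_eq_div, div_le_comm₀ (by positivity) hε]
        exact hI

lemma sum_iterations_le {T : ℕ → ℕ} {l I : ℕ} (hl : 0 < l) {C c r : ℝ} (hC : 0 ≤ C)
    (hc : 0 ≤ c) (hT : ∀ k < l * I, (T k : ℝ) ≤ C * (1 + √c * √2 ^ (k / l + 1)))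
    (hI : (2 : ℝ) ^ I ≤ 2 * r) :
    ((∑ k ∈ Finset.range (l * I), T k : ℕ) : ℝ) ≤ l * C * (Real.logb 2 (2 * r) + 5 * √(c * r)) :=
  calc ((∑ k ∈ Finset.range (l * I), T k : ℕ) : ℝ)
      ≤ ∑ k ∈ Finset.range (l * I), C * (1 + √c * √2 ^ (k / l + 1)) := by
        rw [Nat.cast_sum]
        exact Finset.sum_le_sum fun k hk => hT k (Finset.mem_range.1 hk)
    _ = l * C * (I + √c * ∑ i ∈ Finset.range I, √2 ^ (i + 1)) := by
        rw [sum_range_mul_div (fun i => C * (1 + √c * √2 ^ (i + 1))) hl, ← Finset.mul_sum,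
          Finset.sum_add_distrib, ← Finset.mul_sum, Finset.sum_const, Finset.card_range,
          nsmul_one, nsmul_eq_mul, mul_assoc]
    _ ≤ l * C * (Real.logb 2 (2 * r) + √c * (5 * √r)) := by
        gcongr
        · exact natCast_le_logb_two hI
        · exact sum_sqrt_two_pow_le_five_mul_sqrt hI
    _ = l * C * (Real.logb 2 (2 * r) + 5 * √(c * r)) := by
        rw [Real.sqrt_mul hc, mul_left_comm]

end EpochSums

section TotalComplexity

lemma le_sqrt_log_natCast {n : ℕ} (hn : 2 ≤ n) : 4 / 5 ≤ √(Real.log n) := by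
  refine Real.le_sqrt_of_sq_le ?_
  have hlog : Real.log 2 ≤ Real.log n := Real.log_le_log two_pos (by exact_mod_cast hn)
  linarith [Real.log_two_gt_d9]

lemma log_le_div_exp_one {y : ℝ} (hy : 0 < y) : Real.log y ≤ y / Real.exp 1 := by
  rw [le_div_iff₀' (Real.exp_pos 1)]
  simpa only [Real.exp_log hy] using Real.exp_one_mul_le_exp (x := Real.log y)

lemma logb_two_mul_le {B s : ℝ} (hB : 0 < B) (hs : 4 / 5 ≤ s) :
    Real.logb 2 (2 * B) ≤ 2 * √(B * s) := by
  have hlog : Real.log (2 * B) = 2 * Real.log √(2 * B) := by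
    rw [Real.log_sqrt (by positivity)]
    ring
  have hroot : √(2 * B) ≤ 1.8 * √(B * s) := by
    rw [Real.sqrt_le_left (by positivity), mul_pow, Real.sq_sqrt (by positivity)]
    nlinarith
  have hconst : 1.8 ≤ Real.exp 1 * Real.log 2 := by
    nlinarith [Real.exp_one_gt_d9, Real.log_two_gt_d9]
  rw [Real.logb, div_le_iff₀ (Real.log_pos one_lt_two), hlog, mul_assoc]
  refine mul_le_mul_of_nonneg_left ?_ zero_le_two
  calc Real.log √(2 * B) ≤ √(2 * B) / Real.exp 1 :=
        log_le_div_exp_one (Real.sqrt_pos.2 (by positivity))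
    _ ≤ Real.exp 1 * Real.log 2 * √(B * s) / Real.exp 1 := by
        gcongr
        exact hroot.trans (by gcongr)
    _ = √(B * s) * Real.log 2 := by
        rw [mul_assoc, mul_div_cancel_left₀ _ (Real.exp_pos 1).ne', mul_comm]

lemma epochLen_mul_logb_le {γ ε : ℝ} (hγ : 0 < γ) (hγ1 : γ < 1) (hε : 0 < ε) (hε1 : ε ≤ 1) :
    epochLen γ * Real.logb 2 (1 / ε) ≤ (2 + Real.logb 2 (1 / γ)) * Real.logb γ ε := by
  have hlogγ := (Real.log_neg hγ hγ1).ne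
  have hlog4 : Real.log (1 / 4) = -(2 * Real.log 2) := by
    rw [one_div, Real.log_inv, show (4 : ℝ) = 2 ^ 2 by norm_num, Real.log_pow, Nat.cast_two]
  have hlogb : 0 ≤ Real.logb 2 (1 / ε) :=
    Real.logb_nonneg one_lt_two ((one_le_div hε).2 hε1)
  calc epochLen γ * Real.logb 2 (1 / ε)
      ≤ (Real.logb γ (1 / 4) + 1) * Real.logb 2 (1 / ε) := by
        gcongr
        exact (Nat.ceil_lt_add_one
          (Real.logb_pos_of_base_lt_one hγ hγ1 (by norm_num) (by norm_num)).le).le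
    _ = (2 + Real.logb 2 (1 / γ)) * Real.logb γ ε := by
        have := Real.log_pos one_lt_two
        simp only [Real.logb, hlog4, one_div γ, one_div ε, Real.log_inv]
        field_simp
        ring

lemma le_sapmdRateConst {γ Δ : ℝ} (hγ1 : γ < 1) (hΔ : 0 ≤ Δ) (n : ℕ) :
    5 / 2 ≤ sapmdRateConst γ n Δ := by
  have hγ1' := sub_pos.2 hγ1
  have hmiddle : 5 / 2 ≤ 1 / (1 - γ) * (5 * (2 - γ) / 2) := by
    rw [one_div_mul_eq_div, le_div_iff₀ hγ1']
    linarith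
  have hrest : 0 ≤ 1 / (1 - γ) * (3 * √(Real.log n) / √γ
      + max 1 ((1 - γ) / γ) * (5 * √(Real.log n) / (4 * √γ))) := by positivity
  unfold sapmdRateConst
  linarith

variable {γ L B ε : ℝ} {n I : ℕ} {T : ℕ → ℕ}

lemma sum_minimalSchedule_le_log (hγ : 0 < γ) (hγ1 : γ < 1) (hn : 2 ≤ n) (hL : 0 < L)
    (hT : IsMinimalSchedule γ n L T) (hε : 0 < ε) (hB : 0 < B)
    (hI : (2 : ℝ) ^ I ≤ 2 * (B / ε)) :
    ((∑ k ∈ Finset.range (epochLen γ * I), T k : ℕ) : ℝ)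
      ≤ epochLen γ * (2 + Real.log (16 * L * √(Real.log n) * B / ((1 - γ) * ε)
          + 8 / (1 - γ) ^ 2))
        * (Real.logb 2 (2 * B / ε) + 5 * √((1 - γ) * L * B * √(γ * Real.log n) / ε)) := by
  have hγ1' := sub_pos.2 hγ1
  set X := 16 * L * √(Real.log n) * B / ((1 - γ) * ε) + 8 / (1 - γ) ^ 2 with hX
  have hX1 : 1 ≤ X := by
    have hinv : 8 ≤ 8 / (1 - γ) ^ 2 :=
      le_div_self (by norm_num) (by positivity) (pow_le_one₀ hγ1'.le (by linarith))
    linarith [show 0 ≤ 16 * L * √(Real.log n) * B / ((1 - γ) * ε) by positivity]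
  have hlogX := Real.log_nonneg hX1
  have hstep : ∀ k < epochLen γ * I, (T k : ℝ) ≤ (2 + Real.log X)
      * (1 + √((1 - γ) * L * √(γ * Real.log n)) * √2 ^ (k / epochLen γ + 1)) := by
    refine fun k hk => sapmd_iterations_le_log hγ hγ1 hn hL hT hX1 ?_
    have hpow : (2 : ℝ) ^ (k / epochLen γ + 1) ≤ 2 * (B / ε) :=
      (pow_le_pow_right₀ one_le_two (Nat.div_lt_of_lt_mul hk)).trans hI
    calc _ ≤ 8 / (1 - γ) * L * √(Real.log n) * (2 * (B / ε)) + 8 / (1 - γ) ^ 2 := by gcongr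
      _ = X := by
        rw [hX]
        field_simp
        ring
  convert sum_iterations_le (epochLen_pos hγ hγ1) (by positivity) (by positivity) hstep hI
    using 4
  · ring
  · congr 1
    ring

lemma two_mul_add_add_five_mul_le {x y z : ℝ} (hx : 0 ≤ x) (hy : 1 ≤ y) (hz : 1 ≤ z) :
    2 * x + y + 5 * (x * z) ≤ 15 / 2 * ((1 + x) * (y * z)) := by
  have hyz : y ≤ y * z := le_mul_of_one_le_right (by linarith) hz
  have hxz : x * z ≤ x * (y * z) :=
    mul_le_mul_of_nonneg_left (le_mul_of_one_le_left (by linarith) hy) hx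
  have hxyz : x ≤ x * (y * z) := le_mul_of_one_le_right hx (hy.trans hyz)
  linarith

lemma logb_add_sqrt_le (hγ : 0 < γ) (hγ1 : γ < 1) (hn : 2 ≤ n) (hε : 0 < ε) (hε2 : ε ≤ 1 / 2)
    (hεL : ε ≤ L) (hB : 0 < B) :
    Real.logb 2 (2 * (B / ε)) + 5 * √((1 - γ) * L * √(γ * Real.log n) * (B / ε))
      ≤ 15 / 2 * ((1 + √(B * √(Real.log n))) * (Real.logb 2 (1 / ε) * √(L / ε))) := by
  have hL := hε.trans_le hεL
  have hroot : √(γ * Real.log n) ≤ √(Real.log n) :=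
    Real.sqrt_le_sqrt (mul_le_of_le_one_left (Real.log_natCast_nonneg n) hγ1.le)
  have hsqrt : √((1 - γ) * L * √(γ * Real.log n) * (B / ε))
      ≤ √(B * √(Real.log n)) * √(L / ε) := by
    rw [← Real.sqrt_mul (by positivity)]
    refine Real.sqrt_le_sqrt ?_
    calc (1 - γ) * L * √(γ * Real.log n) * (B / ε)
        ≤ 1 * L * √(Real.log n) * (B / ε) := by
          gcongr
          linarith
      _ = B * √(Real.log n) * (L / ε) := by ring
  have hlogb : Real.logb 2 (2 * (B / ε)) ≤ 2 * √(B * √(Real.log n)) + Real.logb 2 (1 / ε) := by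
    rw [show 2 * (B / ε) = 2 * B * (1 / ε) by ring, Real.logb_mul (by positivity) (by positivity)]
    linarith [logb_two_mul_le hB (le_sqrt_log_natCast hn)]
  have hY : 1 ≤ √(L / ε) := Real.one_le_sqrt.2 ((one_le_div hε).2 hεL)
  have hlam : 1 ≤ Real.logb 2 (1 / ε) := by
    rw [Real.le_logb_iff_rpow_le one_lt_two (by positivity), Real.rpow_one, le_div_comm₀ two_pos hε]
    exact hε2
  calc _ ≤ 2 * √(B * √(Real.log n)) + Real.logb 2 (1 / ε)
        + 5 * (√(B * √(Real.log n)) * √(L / ε)) :=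
        add_le_add hlogb (mul_le_mul_of_nonneg_left hsqrt (by norm_num))
    _ ≤ _ := two_mul_add_add_five_mul_le (Real.sqrt_nonneg _) hlam hY

lemma sum_minimalSchedule_le_sqrt (hγ : 0 < γ) (hγ1 : γ < 1) (hn : 2 ≤ n)
    (hT : IsMinimalSchedule γ n L T) (hε : 0 < ε) (hε2 : ε ≤ 1 / 2) (hεL : ε ≤ L) (hB : 0 < B)
    (hI : (2 : ℝ) ^ I ≤ 2 * (B / ε)) :
    ((∑ k ∈ Finset.range (epochLen γ * I), T k : ℕ) : ℝ)
      ≤ 30 * (2 + Real.logb 2 (1 / γ)) / (1 - γ) * (1 + √(B * √(Real.log n)))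
        * Real.logb γ ε * √(L / ε) := by
  have _ := sub_pos.2 hγ1
  have hL := hε.trans_le hεL
  calc ((∑ k ∈ Finset.range (epochLen γ * I), T k : ℕ) : ℝ)
      ≤ epochLen γ * (4 / (1 - γ)) * (Real.logb 2 (2 * (B / ε))
          + 5 * √((1 - γ) * L * √(γ * Real.log n) * (B / ε))) :=
        sum_iterations_le (epochLen_pos hγ hγ1) (by positivity) (by positivity)
          (fun k _ => sapmd_iterations_le_sqrt hγ hγ1 hn hL hT k) hI
    _ ≤ epochLen γ * (4 / (1 - γ))
          * (15 / 2 * ((1 + √(B * √(Real.log n))) * (Real.logb 2 (1 / ε) * √(L / ε)))) := by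
        gcongr
        exact logb_add_sqrt_le hγ hγ1 hn hε hε2 hεL hB
    _ = 30 / (1 - γ) * (1 + √(B * √(Real.log n))) * √(L / ε)
          * (epochLen γ * Real.logb 2 (1 / ε)) := by ring
    _ ≤ 30 / (1 - γ) * (1 + √(B * √(Real.log n))) * √(L / ε)
          * ((2 + Real.logb 2 (1 / γ)) * Real.logb γ ε) := by
        exact mul_le_mul_of_nonneg_left (epochLen_mul_logb_le hγ hγ1 hε (by linarith))
          (by positivity)
    _ = _ := by ring

end TotalComplexity

section Main

open MeasureTheory

variable {S A : Type*} [Fintype S] [Fintype A]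

lemma IsOptimalPolicy.objective_le {M : MDP S A} {h : S → (A → ℝ) → ℝ} {πs π : S → A → ℝ}
    {ν : S → ℝ} (hπs : IsOptimalPolicy M h πs) (hν : ∀ s, 0 ≤ ν s) (hπ : IsPolicy π) :
    objective M h ν πs ≤ objective M h ν π :=
  Finset.sum_le_sum fun s _ => mul_le_mul_of_nonneg_left (hπs.2 π hπ s) (hν s)

theorem mainTheorem12_general (hA : 2 ≤ Fintype.card A) (M : MDP S A) (h : S → (A → ℝ) → ℝ)
    (dh : S → (A → ℝ) → (A → ℝ)) (L : ℝ) (hL : 0 < L) (hreg : IsSmoothConvexRegularizer h dh L)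
    (πs : S → A → ℝ) (hπs : IsPolicy πs) (ν : S → ℝ) (hν : IsStationaryDist M πs ν)
    (hΔ : objective M h ν πs ≤ objective M h ν (uniformPolicy S A))
    (T : ℕ → ℕ) (hT : IsAccurateSchedule M.γ (Fintype.card A) L T)
    {Ω : Type*} {mΩ : MeasurableSpace Ω} (ℙ : Measure Ω) [IsProbabilityMeasure ℙ]
    (ℱ : Filtration ℕ mΩ) (G : ℕ → Ω → S → A → ℝ)
    (hG : IsActionValueOracle M h dh L T ℙ ℱ G) (B : ℝ)
    (hB : B = sapmdRateConst M.γ (Fintype.card A)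
      (objective M h ν (uniformPolicy S A) - objective M h ν πs)) :
    (∀ k, Integrable (fun ω =>
        objective M h ν (sapmdRun M.γ dh L T (G · ω) k).pol - objective M h ν πs) ℙ ∧
      ∫ ω, (objective M h ν (sapmdRun M.γ dh L T (G · ω) k).pol - objective M h ν πs) ∂ℙ
        ≤ (1 / 2 : ℝ) ^ (k / epochLen M.γ) * B) ∧
    (IsMinimalSchedule M.γ (Fintype.card A) L T →
      ∀ ε : ℝ, 0 < ε → ε ≤ 1 / 2 → ∃ K : ℕ,
        (∀ k, K ≤ k →
          ∫ ω, (objective M h ν (sapmdRun M.γ dh L T (G · ω) k).pol - objective M h ν πs) ∂ℙ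
            ≤ ε) ∧
        (∀ ω, ((sapmdRun M.γ dh L T (G · ω) K).gradCalls : ℝ) ≤
          epochLen M.γ *
            (2 + Real.log (16 * L * √(Real.log (Fintype.card A)) * B / ((1 - M.γ) * ε)
              + 8 / (1 - M.γ) ^ 2)) *
            (Real.logb 2 (2 * B / ε)
              + 5 * √((1 - M.γ) * L * B * √(M.γ * Real.log (Fintype.card A)) / ε))) ∧
        (ε ≤ L → ∀ ω, ((sapmdRun M.γ dh L T (G · ω) K).gradCalls : ℝ) ≤
          30 * (2 + Real.logb 2 (1 / M.γ)) / (1 - M.γ) *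
            (1 + √(B * √(Real.log (Fintype.card A)))) * Real.logb M.γ ε * √(L / ε))) := by
  have hγ := M.γ_pos
  have hγ1 := M.γ_lt_one
  have hrate := hG.integral_objective_sub_le hA hL hreg hT hπs hν hΔ
  have hB1 : 5 / 2 ≤ B := hB ▸ le_sapmdRateConst hγ1 (sub_nonneg.2 hΔ) (Fintype.card A)
  have hB0 : 0 < B := by linarith
  rw [← hB] at hrate
  refine ⟨fun k => ⟨integrable_objective_sub hA hL hreg hG.measurable k, hrate k⟩,
    fun hmin ε hε hε2 => ?_⟩
  obtain ⟨I, hBI, hIB⟩ := exists_le_two_pow_le_two_mul ((one_le_div hε).2 (show ε ≤ B by linarith))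
  refine ⟨epochLen M.γ * I, fun k hk => (hrate k).trans ?_, fun ω => ?_, fun hεL ω => ?_⟩
  · exact half_pow_mul_le_of_div_le_two_pow hε hB0.le hBI
      ((Nat.le_div_iff_mul_le (epochLen_pos hγ hγ1)).2 (mul_comm I _ ▸ hk))
  · rw [sapmdRun_gradCalls]
    exact sum_minimalSchedule_le_log hγ hγ1 hA hL hmin hε hB0 hIB
  · rw [sapmdRun_gradCalls]
    exact sum_minimalSchedule_le_sqrt hγ hγ1 hA hmin hε hε2 hεL hB0 hIB

end Main

theorem mainTheorem12 {S A : Type*} [Fintype S] [Fintype A] (hA : 2 ≤ Fintype.card A)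
    (M : MDP S A) (h : S → (A → ℝ) → ℝ) (dh : S → (A → ℝ) → (A → ℝ)) (L : ℝ) (hL : 0 < L)
    (hreg : IsSmoothConvexRegularizer h dh L)
    (πs : S → A → ℝ) (hπs : IsOptimalPolicy M h πs)
    (ν : S → ℝ) (hν : IsStationaryDist M πs ν)
    -- numbers of inner iterations that guarantee the prescribed accuracy
    (T : ℕ → ℕ) (hT : ∀ k, 1 ≤ T k)
    (hTacc : ∀ k, agdAccuracy (sapmdSmooth M.γ (Fintype.card A) L k)
      (sapmdMu M.γ (Fintype.card A) k) (T k) ≤ sapmdAccuracy M.γ)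
    -- the stochastic estimates `G k` of the action-value function; `ℱ k` is the information
    -- that is available before `G k` is drawn
    {Ω : Type*} {mΩ : MeasurableSpace Ω} (ℙ : MeasureTheory.Measure Ω)
    [MeasureTheory.IsProbabilityMeasure ℙ] (ℱ : MeasureTheory.Filtration ℕ mΩ)
    (G : ℕ → Ω → S → A → ℝ)
    (hGmeas : ∀ k s a, Measurable[ℱ (k + 1)] fun ω => G k ω s a)
    (hGL2 : ∀ k s a, MeasureTheory.MemLp (fun ω => G k ω s a) 2 ℙ)
    -- the policy `π_k` that the method produces
    (π : ℕ → Ω → S → A → ℝ)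
    (hπ : ∀ k ω, π k ω = (sapmdRun M.γ dh L T (fun j => G j ω) k).pol)
    -- conditional bias at most `ς_k`
    (hbias : ∀ k, ∀ᵐ ω ∂ℙ, ∀ s a,
      |MeasureTheory.condExp (ℱ k) ℙ (fun ω' => G k ω' s a) ω
          - Qval M h (sapmdTau M.γ (Fintype.card A) k) (π k ω) s a|
        ≤ (1 / 2 : ℝ) ^ (k / epochLen M.γ + 2))
    -- conditional expected squared error at most `σ_k ^ 2`
    (hvar : ∀ k, ∀ᵐ ω ∂ℙ,
      MeasureTheory.condExp (ℱ k) ℙ (fun ω' =>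
          ‖G k ω' - Qval M h (sapmdTau M.γ (Fintype.card A) k) (π k ω')‖ ^ 2) ω
        ≤ (1 / 4 : ℝ) ^ (k / epochLen M.γ + 2))
    (B : ℝ)
    (hB : B = sapmdRateConst M.γ (Fintype.card A)
      (objective M h ν (uniformPolicy S A) - objective M h ν πs)) :
    -- convergence
    (∀ k, MeasureTheory.Integrable (fun ω => objective M h ν (π k ω) - objective M h ν πs) ℙ ∧
      ∫ ω, (objective M h ν (π k ω) - objective M h ν πs) ∂ℙ
        ≤ (1 / 2 : ℝ) ^ (k / epochLen M.γ) * B) ∧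
    -- gradient complexity, if the inner method stops as soon as the accuracy is guaranteed
    ((∀ k, IsLeast {t : ℕ | 1 ≤ t ∧ agdAccuracy (sapmdSmooth M.γ (Fintype.card A) L k)
        (sapmdMu M.γ (Fintype.card A) k) t ≤ sapmdAccuracy M.γ} (T k)) →
      ∀ ε : ℝ, 0 < ε → ε ≤ 1 / 2 → ∃ K : ℕ,
        (∀ k, K ≤ k →
          ∫ ω, (objective M h ν (π k ω) - objective M h ν πs) ∂ℙ ≤ ε) ∧
        (∀ ω, ((sapmdRun M.γ dh L T (fun j => G j ω) K).gradCalls : ℝ) ≤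
          epochLen M.γ *
            (2 + Real.log (16 * L * Real.sqrt (Real.log (Fintype.card A)) * B / ((1 - M.γ) * ε)
              + 8 / (1 - M.γ) ^ 2)) *
            (Real.logb 2 (2 * B / ε)
              + 5 * Real.sqrt
                ((1 - M.γ) * L * B * Real.sqrt (M.γ * Real.log (Fintype.card A)) / ε))) ∧
        (ε ≤ L → ∀ ω, ((sapmdRun M.γ dh L T (fun j => G j ω) K).gradCalls : ℝ) ≤
          30 * (2 + Real.logb 2 (1 / M.γ)) / (1 - M.γ) *
            (1 + Real.sqrt (B * Real.sqrt (Real.log (Fintype.card A)))) *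
            Real.logb M.γ ε * Real.sqrt (L / ε))) := by
  have : Nonempty A := Fintype.card_pos_iff.1 (by omega)
  obtain rfl : π = fun k ω => (sapmdRun M.γ dh L T (G · ω) k).pol := funext₂ hπ
  exact mainTheorem12_general hA M h dh L hL hreg πs hπs.1 ν hν
    (hπs.objective_le hν.1.1 fun _ => uniformDist_mem_stdSimplex) T ⟨hT, hTacc⟩ ℙ ℱ G
    ⟨hGmeas, hGL2, hbias, hvar⟩ B hB
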